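/- Let $\Omega\subset\mathbb{R}^2$ be a polygon bounded by a simple closed polygonal curve with corners $x_1,\dots,x_r$ ($x_0=x_r$), and let $s\mapsto x(s)$ be the parametrization of the boundary by arc length, extended periodically, with $x(s_j)=x_j$. Let $s_0<\gamma_0<s_1<\gamma_1<\dots<\gamma_{r-1}<s_r$, put $\gamma_r=\gamma_0+(s_r-s_0)$, $\Gamma=[\gamma_0,\gamma_r]$, and $\Gamma_j=[\gamma_{j-1},\gamma_j]$ for $1\le j\le r$. Let $$Tu(s)=\int_\Gamma k(s,t)u(t)\,dt,\qquad k(s,t)=\frac1\pi\,\frac{\partial}{\partial n_y}\ln|x(s)-y|\Big|_{y=x(t)},$$ be the double layer operator, where $n_y$ is the unit normal at $y$. For $a=(a_1,\dots,a_r)$ and an integer $m\ge0$ let $C^m_a(\Gamma)$ be the space of functions $u$ on $\Gamma$ that are $C^m$ on each $\Gamma_j\setminus\{s_j\}$ and satisfy $$\|u\|_{m,a}=\max_{1\le j\le r}\ \max_{0\le i\le m}\ \sup_{s\in\Gamma_j\setminus\{s_j\}}|s-s_j|^{\max\{i-a_j,0\}}\,|D^iu(s)|<\infty .$$ Given integers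 $n_j\ge1$ and grading exponents $q_j$, the mesh on $\Gamma_j$ consists of the $2n_j$ intervals $\tau=[t_{j,i},t_{j,i+1}]$ with nodes $$t_{j,i}=s_j-\Big(\tfrac{n_j-i}{n_j}\Big)^{q_j}(s_j-\gamma_{j-1}),\qquad t_{j,n_j+i}=s_j+\Big(\tfrac{i}{n_j}\Big)^{q_j}(\gamma_j-s_j),\qquad 0\le i\le n_j .$$ Let $h=\max_j n_j^{-1}$, let $h_\tau$ be the length of $\tau$, and let $\pi_h$ be the orthogonal projection of $L^2(\Gamma)$ onto the functions that are constant on each mesh interval, $\pi_hu|_\tau=\frac1{h_\tau}\int_\tau u$. Let $\mathcal T_j$ be the set of the mesh intervals $\tau\subset\Gamma_j$ with $s_j\notin\tau$. Suppose that for $j=1,\dots,r$ $$\frac{2}{q_j}<a_j\le 1,\qquad \alpha_j=a_j-\frac{2}{q_j},\qquad q_j>\frac{4}{\alpha_j}.$$ Then there is a constant $C$, depending only on the parametrized boundary, the points $\gamma_j$, $q$ and $a$, such that for all $n_1,\dots,n_r\ge1$, all $u\in C^4_a(\Gamma)$ and all $s\in\Gamma$ $$\big(T(I-\pi_h)T(I-\pi_h)u\big)(s)=L_h(s)+R_h(s),$$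 $$L_h(s)=\frac1{144}\sum_{j_1=1}^r\sum_{j_2=1}^r\ \sum_{\tau_1\in\mathcal T_{j_1}}\ \sum_{\tau_2\in\mathcal T_{j_2}}h_{\tau_1}^2h_{\tau_2}^2\int_{\tau_1}\partial_tk(s,t)\Big(\int_{\tau_2}\partial_{t'}\partial_tk(t,t')\,Du(t')\,dt'\Big)dt,$$ $$|R_h(s)|\le C\,h^6\,\|u\|_{4,a},\qquad |L_h(s)|\le C\,h^4\,\|u\|_{4,a}.$$ -/

import Mathlib

open scoped ENNReal

noncomputable section

/-- The Euclidean plane. -/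
abbrev Plane : Type := EuclideanSpace ℝ (Fin 2)

/-- The boundary of a simple closed polygon with `r` corners, parametrized by arc length, with an
initial partition. `x` is the parametrization, extended periodically with period `s r - s 0` (the
perimeter). The corners are `x (s 0), …, x (s r)` with `x (s r) = x (s 0)`, and `γ` are the
partition points, `s 0 < γ 0 < s 1 < γ 1 < … < γ (r-1) < s r`; the point `γ r` is `γ 0` after one
turn. Only the indices `0, …, r` of `s` and `γ` matter. -/
structure PolygonBoundary where
  /-- number of corners -/
  r : ℕ
  three_le_r : 3 ≤ r
  /-- parameters of the corners -/
  s : ℕ → ℝ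
  /-- end points of the segments of the initial partition -/
  γ : ℕ → ℝ
  s_lt_γ : ∀ j < r, s j < γ j
  γ_lt_s : ∀ j < r, γ j < s (j + 1)
  γ_last : γ r = γ 0 + (s r - s 0)
  /-- arc length parametrization -/
  x : ℝ → Plane
  periodic : Function.Periodic x (s r - s 0)
  /-- between consecutive corners the curve is a straight segment run through at unit speed -/
  edge : ∀ j < r, ∃ e : Plane, ‖e‖ = 1 ∧
    ∀ t ∈ Set.Icc (s j) (s (j + 1)), x t = x (s j) + (t - s j) • e
  /-- the closed curve has no self-intersections -/
  injOn : Set.InjOn x (Set.Ico (s 0) (s r))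

namespace PolygonBoundary

variable (P : PolygonBoundary)

/-- The index set `{1, …, r}` of the corners and of the segments. -/
def idx : Finset ℕ := Finset.Icc 1 P.r

theorem idx_nonempty : P.idx.Nonempty :=
  Finset.nonempty_Icc.2 (le_trans (by norm_num) P.three_le_r)

/-- The parameter set `Γ` of the whole boundary (one full turn, starting at `γ 0`). -/
def bdry : Set ℝ := Set.Icc (P.γ 0) (P.γ P.r)

/-- The segment `Γ_j = [γ_{j-1}, γ_j]`, `1 ≤ j ≤ r`; it has the corner `s_j` in its interior. -/
def seg (j : ℕ) : Set ℝ := Set.Icc (P.γ (j - 1)) (P.γ j)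

/-- The unit normal at the parameter `t` (outside the corners): the unit tangent rotated by
`-π/2`. It is the outward normal if the boundary is run through counterclockwise. -/
def normal (t : ℝ) : Plane := !₂[deriv P.x t 1, -(deriv P.x t 0)]

/-- The double layer kernel `k(s,t) = (1/π) ∂/∂n_y ln |x - y|` at `x = x(s)`, `y = x(t)`. -/
def k (s t : ℝ) : ℝ :=
  (1 / Real.pi) * lineDeriv ℝ (fun y : Plane => Real.log ‖P.x s - y‖) (P.x t) (P.normal t)

/-- The double layer operator `(T u)(s) = ∫_Γ k(s,t) u(t) dt`. -/
def T (u : ℝ → ℝ) (s : ℝ) : ℝ := ∫ t in (P.γ 0)..(P.γ P.r), P.k s t * u t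

/-- `∂_t k(s,t)`. -/
def dtk (s t : ℝ) : ℝ := deriv (fun t' => P.k s t') t

/-- `∂_t ∂_s k(s,t)`. -/
def dtdsk (s t : ℝ) : ℝ := deriv (fun t' => deriv (fun s' => P.k s' t') s) t

/-! ### Weighted spaces -/

/-- The weighted norm
`‖u‖_{m,a} = max_j max_{i ≤ m} sup {|s - s_j|^{max(i - a_j, 0)} |D^i u(s)| : s ∈ Γ_j \ {s_j}}`. -/
def wnorm (m : ℕ) (a : ℕ → ℝ) (u : ℝ → ℝ) : ℝ≥0∞ :=
  ⨆ j ∈ P.idx, ⨆ i ∈ Finset.range (m + 1), ⨆ s ∈ P.seg j \ {P.s j},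
    ENNReal.ofReal (|s - P.s j| ^ (max ((i : ℝ) - a j) 0) *
      |iteratedDerivWithin i u (P.seg j \ {P.s j}) s|)

/-- `u ∈ C^m_a(Γ)`: `u` is `C^m` on every `Γ_j \ {s_j}` and its weighted norm is finite. -/
def MemC (m : ℕ) (a : ℕ → ℝ) (u : ℝ → ℝ) : Prop :=
  (∀ j ∈ P.idx, ContDiffOn ℝ m u (P.seg j \ {P.s j})) ∧ P.wnorm m a u < ⊤

/-! ### Graded meshes -/

/-- The nodes `t_{j,i}`, `0 ≤ i ≤ 2 n_j`, graded with exponent `q_j` towards the corner `s_j`. -/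
def node (q : ℕ → ℝ) (n : ℕ → ℕ) (j i : ℕ) : ℝ :=
  if i ≤ n j then
    P.s j - (((n j : ℝ) - i) / n j) ^ q j * (P.s j - P.γ (j - 1))
  else
    P.s j + (((i : ℝ) - n j) / n j) ^ q j * (P.γ j - P.s j)

/-- The length `h_τ` of the element `τ = [t_{j,i}, t_{j,i+1}]`. -/
def len (q : ℕ → ℝ) (n : ℕ → ℕ) (j i : ℕ) : ℝ := P.node q n j (i + 1) - P.node q n j i

/-- The mesh parameter `h = max_j h_j`, `h_j = 1 / n_j`. -/
def mesh (n : ℕ → ℕ) : ℝ := P.idx.sup' P.idx_nonempty (fun j => 1 / (n j : ℝ))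

/-- The projection `π_h` onto piecewise constant functions: on every element `τ` the function is
replaced by its mean value `(1/|τ|) ∫_τ u`. (At the nodes the value is that of the element to the
right.) -/
def proj (q : ℕ → ℝ) (n : ℕ → ℕ) (u : ℝ → ℝ) (s : ℝ) : ℝ :=
  ∑ j ∈ P.idx, ∑ i ∈ Finset.range (2 * n j),
    (Set.Ico (P.node q n j i) (P.node q n j (i + 1))).indicator
      (fun _ => (1 / P.len q n j i) *
        ∫ t in (P.node q n j i)..(P.node q n j (i + 1)), u t) s

/-- The operator `T (I - π_h)`. -/
def TIsubProj (q : ℕ → ℝ) (n : ℕ → ℕ) (u : ℝ → ℝ) : ℝ → ℝ :=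
  P.T (fun t => u t - P.proj q n u t)

open Classical in
/-- The elements `[t_{j,i}, t_{j,i+1}]` of the mesh on `Γ_j` that do not contain the corner `s_j`,
given by their indices `i`. -/
def regularElements (q : ℕ → ℝ) (n : ℕ → ℕ) (j : ℕ) : Finset ℕ :=
  (Finset.range (2 * n j)).filter
    (fun i => P.s j ∉ Set.Icc (P.node q n j i) (P.node q n j (i + 1)))

/-- The leading term
`(1/144) ∑_{τ₁, τ₂} h_{τ₁}² h_{τ₂}² ∫_{τ₁} ∂_t k(s,t) (∫_{τ₂} ∂_{t'} ∂_t k(t,t') Du(t') dt') dt`,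
the sums being over all elements of the mesh that contain no corner. -/
def leadingTerm (q : ℕ → ℝ) (n : ℕ → ℕ) (u : ℝ → ℝ) (s : ℝ) : ℝ :=
  (1 / 144) * ∑ j₁ ∈ P.idx, ∑ j₂ ∈ P.idx,
    ∑ i₁ ∈ P.regularElements q n j₁, ∑ i₂ ∈ P.regularElements q n j₂,
      P.len q n j₁ i₁ ^ 2 * P.len q n j₂ i₂ ^ 2 *
        ∫ t in (P.node q n j₁ i₁)..(P.node q n j₁ (i₁ + 1)),
          P.dtk s t *
            ∫ t' in (P.node q n j₂ i₂)..(P.node q n j₂ (i₂ + 1)), P.dtdsk t t' * deriv u t'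

end PolygonBoundary

end

/-! Cut every `Γ_j` at its corner and measure positions by the distance to the corner. The boundary
becomes a finite family of intervals `[0, b]` with nodes `b (i/n)^q`. The kernel vanishes between
pieces of one edge; otherwise it is the imaginary part of a constant over `y - x`, so its derivative
of orders `i`, `l` is at most `C D^(-(i+l+1))` with `D = |x - y|`. At a common corner `D` dominates
`σ + τ`, because the two directions differ; at different corners `D` is bounded below, by
compactness and injectivity. Hence the singularity can be shared between the variables: the
derivative is at most `C σ^(θ-i) τ^(-(1+l+θ))` for `0 ≤ θ ≤ 1 ≤ i`.

On an element without corner, the integral of `f` against `g` minus its mean is `(h_τ²/12) ∫ f' g'`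
up to fifth order (`abs_devIntegral_sub_le`), and is in any case of third order
(`abs_devIntegral_le`). On a graded mesh `h_τ ≤ C n⁻¹ t^(1-1/q)`, so every power of `h` gained in a
sum over elements costs `1/q` in the exponent of `t` (`exists_sum_gradedNode_pow_le`).

The hypotheses on the grading amount to `q a > 6`. Write `T(I-π)u` as `cornerPart` (elements at the
corners) plus `regularPart`. The first is `O(h⁶)` and stays so under the second `T(I-π)`, since `∫
|k|` is bounded. The derivatives of the second are `O(h² σ^(θ-i))` with `θ = a/2 + 1/q`; this
suffices to treat the corner elements of the outer integral and to expand on the others, each with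
error `h² h⁴`. What is left is `(h_τ²/12) ∫ ∂_t k` times the derivative of `regularPart`, and this
derivative is `leadingPart` up to `O(h⁴ σ^(θ-1))`, now with `θ = a/2 - 1/q`; the outer sum supplies
the missing `h²`.

The two values of `θ` balance the inner and the outer sum, of orders 2 and 4 or 4 and 2: each needs
exactly `a/2 - 3/q > 0`. `exists_total_sub_leading_le` collects the estimates; the rest translates
the polygon, the mesh and the leading term into local coordinates. -/

section

open Set MeasureTheory Filter Topology intervalIntegral
open scoped ENNReal

/-! ### Expansion of the mean deviation integral on one element -/

/-- The integral over `[c, d]` of `f` times the deviation of `g` from its mean value. -/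
noncomputable def devIntegral (f g : ℝ → ℝ) (c d : ℝ) : ℝ :=
  ∫ t in c..d, f t * (g t - (d - c)⁻¹ * ∫ x in c..d, g x)

theorem intervalIntegrable_of_bound_Ioo {f : ℝ → ℝ} {c d M : ℝ} (hcd : c ≤ d)
    (hf : ContinuousOn f (Ioo c d)) (hM : ∀ x ∈ Ioo c d, |f x| ≤ M) :
    IntervalIntegrable f volume c d := by
  rw [intervalIntegrable_iff_integrableOn_Ioo_of_le hcd]
  exact IntegrableOn.of_bound (by simp) (hf.aestronglyMeasurable measurableSet_Ioo) M
    ((ae_restrict_iff' measurableSet_Ioo).2 (Eventually.of_forall hM))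

theorem abs_integral_le_of_bound_Ioo {f : ℝ → ℝ} {c d M : ℝ} (hcd : c ≤ d)
    (hM : ∀ x ∈ Ioo c d, |f x| ≤ M) : |∫ x in c..d, f x| ≤ M * (d - c) := by
  rw [integral_of_le hcd, integral_Ioc_eq_integral_Ioo]
  have := norm_setIntegral_le_of_norm_le_const (μ := volume) (s := Ioo c d) (f := f) (C := M)
    (by simp) hM
  simpa [Measure.real, hcd] using this

theorem integral_congr_Ioo {f g : ℝ → ℝ} {c d : ℝ} (hcd : c ≤ d)
    (h : ∀ x ∈ Ioo c d, f x = g x) : ∫ x in c..d, f x = ∫ x in c..d, g x := by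
  rw [integral_of_le hcd, integral_of_le hcd, integral_Ioc_eq_integral_Ioo,
    integral_Ioc_eq_integral_Ioo]
  exact setIntegral_congr_fun measurableSet_Ioo h

theorem intervalIntegrable_congr_Ioo {f g : ℝ → ℝ} {c d : ℝ} (hcd : c ≤ d)
    (h : ∀ x ∈ Ioo c d, f x = g x) (hf : IntervalIntegrable f volume c d) :
    IntervalIntegrable g volume c d := by
  rw [intervalIntegrable_iff_integrableOn_Ioo_of_le hcd] at hf ⊢
  exact hf.congr_fun h measurableSet_Ioo

theorem continuousOn_Ioo_of_hasDerivAt {f f' : ℝ → ℝ} {c d : ℝ}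
    (hf : ∀ x ∈ Ioo c d, HasDerivAt f (f' x) x) : ContinuousOn f (Ioo c d) :=
  fun x hx => (hf x hx).continuousAt.continuousWithinAt

theorem abs_sub_le_of_hasDerivAt {f f' : ℝ → ℝ} {c d M : ℝ}
    (hf : ∀ x ∈ Ioo c d, HasDerivAt f (f' x) x) (hM : ∀ x ∈ Ioo c d, |f' x| ≤ M)
    {x y : ℝ} (hx : x ∈ Ioo c d) (hy : y ∈ Ioo c d) : |f x - f y| ≤ M * (d - c) := by
  have h := Convex.norm_image_sub_le_of_norm_hasDerivWithin_le (C := M)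
    (fun z hz => (hf z hz).hasDerivWithinAt) hM (convex_Ioo c d) hy hx
  have hM0 : 0 ≤ M := (abs_nonneg _).trans (hM x hx)
  refine h.trans (mul_le_mul_of_nonneg_left ?_ hM0)
  rw [Real.norm_eq_abs, abs_le]
  constructor <;> linarith [hx.1, hx.2, hy.1, hy.2]

theorem abs_sub_linear_le {f f1 f2 : ℝ → ℝ} {c d M : ℝ}
    (hf : ∀ x ∈ Ioo c d, HasDerivAt f (f1 x) x) (hf1 : ∀ x ∈ Ioo c d, HasDerivAt f1 (f2 x) x)
    (hM : ∀ x ∈ Ioo c d, |f2 x| ≤ M) {x m : ℝ} (hx : x ∈ Ioo c d) (hm : m ∈ Ioo c d) :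
    |f x - (f m + f1 m * (x - m))| ≤ M * (d - c) ^ 2 := by
  have h := abs_sub_le_of_hasDerivAt (f := fun x => f x - (f m + f1 m * (x - m)))
    (f' := fun x => f1 x - f1 m) (M := M * (d - c))
    (fun z hz => by
      have := (hf z hz).fun_sub ((((hasDerivAt_id z).sub_const m).const_mul (f1 m)).const_add (f m))
      simpa using this)
    (fun z hz => abs_sub_le_of_hasDerivAt hf1 hM hz hm) hx hm
  simp only [sub_self, mul_zero, add_zero, sub_zero] at h
  linarith

theorem abs_sub_quadratic_le {f f1 f2 f3 : ℝ → ℝ} {c d M : ℝ}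
    (hf : ∀ x ∈ Ioo c d, HasDerivAt f (f1 x) x) (hf1 : ∀ x ∈ Ioo c d, HasDerivAt f1 (f2 x) x)
    (hf2 : ∀ x ∈ Ioo c d, HasDerivAt f2 (f3 x) x)
    (hM : ∀ x ∈ Ioo c d, |f3 x| ≤ M) {x m : ℝ} (hx : x ∈ Ioo c d) (hm : m ∈ Ioo c d) :
    |f x - (f m + f1 m * (x - m) + f2 m / 2 * (x - m) ^ 2)| ≤ M * (d - c) ^ 3 := by
  have h := abs_sub_le_of_hasDerivAt
    (f := fun x => f x - (f m + f1 m * (x - m) + f2 m / 2 * (x - m) ^ 2))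
    (f' := fun x => f1 x - (f1 m + f2 m * (x - m))) (M := M * (d - c) ^ 2)
    (fun z hz => by
      have h1 := ((hasDerivAt_id z).sub_const m)
      have := (hf z hz).fun_sub (((h1.const_mul (f1 m)).const_add (f m)).fun_add
        ((h1.fun_pow 2).const_mul (f2 m / 2)))
      refine this.congr_deriv ?_
      simp only [id]; push_cast; ring)
    (fun z hz => abs_sub_linear_le hf1 hf2 hM hz hm) hx hm
  simp only [sub_self, mul_zero, add_zero, sub_zero, ne_eq, OfNat.ofNat_ne_zero,
    not_false_eq_true, zero_pow] at h
  linarith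

theorem integral_sub_mid (c d : ℝ) : ∫ x in c..d, (x - (c + d) / 2) = 0 := by
  rw [integral_comp_sub_right (fun x => x), integral_id]; ring

theorem integral_sub_mid_sq (c d : ℝ) :
    ∫ x in c..d, (x - (c + d) / 2) ^ 2 = (d - c) ^ 3 / 12 := by
  rw [integral_comp_sub_right (fun x => x ^ 2), integral_pow]; norm_num; ring

theorem integral_sub_mid_cube (c d : ℝ) : ∫ x in c..d, (x - (c + d) / 2) ^ 3 = 0 := by
  rw [integral_comp_sub_right (fun x => x ^ 3), integral_pow]; norm_num; ring

/-- First moment of a `C³` function on an interval against the midpoint. -/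
theorem abs_moment_sub_le {g g1 g2 g3 : ℝ → ℝ} {c d M : ℝ} (hcd : c < d)
    (hg : ∀ x ∈ Ioo c d, HasDerivAt g (g1 x) x) (hg1 : ∀ x ∈ Ioo c d, HasDerivAt g1 (g2 x) x)
    (hg2 : ∀ x ∈ Ioo c d, HasDerivAt g2 (g3 x) x) (hM : ∀ x ∈ Ioo c d, |g3 x| ≤ M) :
    |(∫ x in c..d, (x - (c + d) / 2) * g x) - (d - c) ^ 2 / 12 * ∫ x in c..d, g1 x|
      ≤ 2 * M * (d - c) ^ 5 := by
  set m := (c + d) / 2 with hm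
  have hmI : m ∈ Ioo c d := ⟨by linarith, by linarith⟩
  have hM0 : 0 ≤ M := (abs_nonneg _).trans (hM m hmI)
  have hh : 0 < d - c := sub_pos.2 hcd
  have hX : ∀ x ∈ Ioo c d, |x - m| ≤ d - c := fun x hx => by
    rw [abs_le]; constructor <;> linarith [hx.1, hx.2]
  -- Odd powers of `x - m` integrate to zero, so both integrals have the main term `g1 m (d -
  -- c)³/12`, and only the Taylor remainders `χ` and `χ1` are left to estimate.
  set χ : ℝ → ℝ := fun x => g x - (g m + g1 m * (x - m) + g2 m / 2 * (x - m) ^ 2) with hχ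
  set χ1 : ℝ → ℝ := fun x => g1 x - (g1 m + g2 m * (x - m)) with hχ1
  have bχ : ∀ x ∈ Ioo c d, |χ x| ≤ M * (d - c) ^ 3 :=
    fun x hx => abs_sub_quadratic_le hg hg1 hg2 hM hx hmI
  have bχ1 : ∀ x ∈ Ioo c d, |χ1 x| ≤ M * (d - c) ^ 2 :=
    fun x hx => abs_sub_linear_le hg1 hg2 hM hx hmI
  have cg := continuousOn_Ioo_of_hasDerivAt hg
  have cg1 := continuousOn_Ioo_of_hasDerivAt hg1
  have cχ : ContinuousOn χ (Ioo c d) := by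
    refine cg.sub (Continuous.continuousOn ?_); fun_prop
  have cχ1 : ContinuousOn χ1 (Ioo c d) := by
    refine cg1.sub (Continuous.continuousOn ?_); fun_prop
  have iχ1 := intervalIntegrable_of_bound_Ioo hcd.le cχ1 bχ1
  have bXχ : ∀ x ∈ Ioo c d, |(x - m) * χ x| ≤ (d - c) * (M * (d - c) ^ 3) := fun x hx => by
    rw [abs_mul]; exact mul_le_mul (hX x hx) (bχ x hx) (abs_nonneg _) hh.le
  have iXχ : IntervalIntegrable (fun x => (x - m) * χ x) volume c d :=
    intervalIntegrable_of_bound_Ioo hcd.le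
      ((Continuous.continuousOn (by fun_prop)).mul cχ) bXχ
  have e1 : ∫ x in c..d, (x - m) * g x
      = g1 m * ((d - c) ^ 3 / 12) + ∫ x in c..d, (x - m) * χ x := by
    have : ∀ x, (x - m) * g x = (g m * (x - m) + g1 m * (x - m) ^ 2 + g2 m / 2 * (x - m) ^ 3)
        + (x - m) * χ x := fun x => by simp only [hχ]; ring
    simp_rw [this]
    rw [integral_add (Continuous.intervalIntegrable (by fun_prop) _ _) iXχ,
      integral_add (Continuous.intervalIntegrable (by fun_prop) _ _)
        (Continuous.intervalIntegrable (by fun_prop) _ _),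
      integral_add (Continuous.intervalIntegrable (by fun_prop) _ _)
        (Continuous.intervalIntegrable (by fun_prop) _ _),
      intervalIntegral.integral_const_mul, intervalIntegral.integral_const_mul, intervalIntegral.integral_const_mul, hm, integral_sub_mid,
      integral_sub_mid_sq, integral_sub_mid_cube]
    ring
  have e2 : ∫ x in c..d, g1 x = g1 m * (d - c) + ∫ x in c..d, χ1 x := by
    have : ∀ x, g1 x = (g1 m + g2 m * (x - m)) + χ1 x := fun x => by simp only [hχ1]; ring
    conv_lhs => enter [1, x]; rw [this x]
    rw [integral_add (Continuous.intervalIntegrable (by fun_prop) _ _) iχ1,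
      integral_add (Continuous.intervalIntegrable (by fun_prop) _ _)
        (Continuous.intervalIntegrable (by fun_prop) _ _),
      intervalIntegral.integral_const_mul, hm, integral_sub_mid]
    simp; ring
  have b1 := abs_integral_le_of_bound_Ioo hcd.le bXχ
  have b2 := abs_integral_le_of_bound_Ioo hcd.le bχ1
  rw [e1, e2]
  have : g1 m * ((d - c) ^ 3 / 12) + (∫ x in c..d, (x - m) * χ x)
      - (d - c) ^ 2 / 12 * (g1 m * (d - c) + ∫ x in c..d, χ1 x)
      = (∫ x in c..d, (x - m) * χ x) - (d - c) ^ 2 / 12 * ∫ x in c..d, χ1 x := by ring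
  rw [this]
  refine (abs_sub _ _).trans ?_
  rw [abs_mul, abs_of_nonneg (by positivity : 0 ≤ (d - c) ^ 2 / 12)]
  have : (d - c) ^ 2 / 12 * |∫ x in c..d, χ1 x|
      ≤ (d - c) ^ 2 / 12 * (M * (d - c) ^ 2 * (d - c)) :=
    mul_le_mul_of_nonneg_left b2 (by positivity)
  nlinarith [mul_nonneg hM0 (pow_nonneg hh.le 5)]

/-- The mean deviation product of two `C³` functions on a short interval is the product of the
derivatives up to a term of fifth order. -/
theorem abs_devIntegral_sub_le {f f1 f2 f3 g g1 g2 g3 : ℝ → ℝ} {c d A1 A2 A3 B1 B2 B3 : ℝ}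
    (hcd : c < d)
    (hf : ∀ x ∈ Ioo c d, HasDerivAt f (f1 x) x) (hf1 : ∀ x ∈ Ioo c d, HasDerivAt f1 (f2 x) x)
    (hf2 : ∀ x ∈ Ioo c d, HasDerivAt f2 (f3 x) x)
    (hg : ∀ x ∈ Ioo c d, HasDerivAt g (g1 x) x) (hg1 : ∀ x ∈ Ioo c d, HasDerivAt g1 (g2 x) x)
    (hg2 : ∀ x ∈ Ioo c d, HasDerivAt g2 (g3 x) x)
    (hA1 : ∀ x ∈ Ioo c d, |f1 x| ≤ A1) (hA2 : ∀ x ∈ Ioo c d, |f2 x| ≤ A2)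
    (hA3 : ∀ x ∈ Ioo c d, |f3 x| ≤ A3)
    (hB1 : ∀ x ∈ Ioo c d, |g1 x| ≤ B1) (hB2 : ∀ x ∈ Ioo c d, |g2 x| ≤ B2)
    (hB3 : ∀ x ∈ Ioo c d, |g3 x| ≤ B3) :
    |devIntegral f g c d - (d - c) ^ 2 / 12 * ∫ x in c..d, f1 x * g1 x|
      ≤ 4 * (d - c) ^ 5 * (A1 * B3 + A2 * B2 + A3 * B1) := by
  set m := (c + d) / 2 with hm
  have hmI : m ∈ Ioo c d := ⟨by linarith, by linarith⟩
  have hh : 0 < d - c := sub_pos.2 hcd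
  have hA20 : 0 ≤ A2 := (abs_nonneg _).trans (hA2 m hmI)
  have hB20 : 0 ≤ B2 := (abs_nonneg _).trans (hB2 m hmI)
  have hA30 : 0 ≤ A3 := (abs_nonneg _).trans (hA3 m hmI)
  have hB30 : 0 ≤ B3 := (abs_nonneg _).trans (hB3 m hmI)
  have hX : ∀ x ∈ Ioo c d, |x - m| ≤ d - c := fun x hx => by
    rw [abs_le]; constructor <;> linarith [hx.1, hx.2]
  -- Split off the affine parts at the midpoint. The product of the slopes gives the same cubic term
  -- on both sides, terms linear in a remainder are compared by `abs_moment_sub_le`, and products of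
  -- two remainders are already of fifth order.
  set φ : ℝ → ℝ := fun x => f x - (f m + f1 m * (x - m)) with hφ
  set ψ : ℝ → ℝ := fun x => g x - (g m + g1 m * (x - m)) with hψ
  set φ1 : ℝ → ℝ := fun x => f1 x - f1 m with hφ1
  set ψ1 : ℝ → ℝ := fun x => g1 x - g1 m with hψ1
  have dφ : ∀ x ∈ Ioo c d, HasDerivAt φ (φ1 x) x := fun z hz => by
    have := (hf z hz).fun_sub ((((hasDerivAt_id z).sub_const m).const_mul (f1 m)).const_add (f m))
    simpa using this
  have dψ : ∀ x ∈ Ioo c d, HasDerivAt ψ (ψ1 x) x := fun z hz => by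
    have := (hg z hz).fun_sub ((((hasDerivAt_id z).sub_const m).const_mul (g1 m)).const_add (g m))
    simpa using this
  have dφ1 : ∀ x ∈ Ioo c d, HasDerivAt φ1 (f2 x) x := fun z hz => (hf1 z hz).sub_const _
  have dψ1 : ∀ x ∈ Ioo c d, HasDerivAt ψ1 (g2 x) x := fun z hz => (hg1 z hz).sub_const _
  have bφ : ∀ x ∈ Ioo c d, |φ x| ≤ A2 * (d - c) ^ 2 :=
    fun x hx => abs_sub_linear_le hf hf1 hA2 hx hmI
  have bψ : ∀ x ∈ Ioo c d, |ψ x| ≤ B2 * (d - c) ^ 2 :=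
    fun x hx => abs_sub_linear_le hg hg1 hB2 hx hmI
  have bφ1 : ∀ x ∈ Ioo c d, |φ1 x| ≤ A2 * (d - c) :=
    fun x hx => abs_sub_le_of_hasDerivAt hf1 hA2 hx hmI
  have bψ1 : ∀ x ∈ Ioo c d, |ψ1 x| ≤ B2 * (d - c) :=
    fun x hx => abs_sub_le_of_hasDerivAt hg1 hB2 hx hmI
  have cφ := continuousOn_Ioo_of_hasDerivAt dφ
  have cψ := continuousOn_Ioo_of_hasDerivAt dψ
  have cφ1 := continuousOn_Ioo_of_hasDerivAt dφ1
  have cψ1 := continuousOn_Ioo_of_hasDerivAt dψ1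
  have cX : ContinuousOn (fun x : ℝ => x - m) (Ioo c d) := by fun_prop
  have iφ := intervalIntegrable_of_bound_Ioo hcd.le cφ bφ
  have iψ := intervalIntegrable_of_bound_Ioo hcd.le cψ bψ
  have iφ1 := intervalIntegrable_of_bound_Ioo hcd.le cφ1 bφ1
  have iψ1 := intervalIntegrable_of_bound_Ioo hcd.le cψ1 bψ1
  have iX : IntervalIntegrable (fun x : ℝ => x - m) volume c d :=
    Continuous.intervalIntegrable (by fun_prop) _ _
  have iX2 : IntervalIntegrable (fun x : ℝ => (x - m) ^ 2) volume c d :=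
    Continuous.intervalIntegrable (by fun_prop) _ _
  have hmulb : ∀ {p p' : ℝ → ℝ} {A B : ℝ}, 0 ≤ A → (∀ x ∈ Ioo c d, |p x| ≤ A) →
      (∀ x ∈ Ioo c d, |p' x| ≤ B) → ∀ x ∈ Ioo c d, |p x * p' x| ≤ A * B :=
    fun hA h h' x hx => by
      rw [abs_mul]; exact mul_le_mul (h x hx) (h' x hx) (abs_nonneg _) hA
  have bφψ := hmulb (by positivity) bφ bψ
  have bφψ1 := hmulb (by positivity) bφ1 bψ1
  have iφψ := intervalIntegrable_of_bound_Ioo hcd.le (cφ.fun_mul cψ) bφψ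
  have iφψ1 := intervalIntegrable_of_bound_Ioo hcd.le (cφ1.fun_mul cψ1) bφψ1
  have iXφ := intervalIntegrable_of_bound_Ioo hcd.le (cX.fun_mul cφ) (hmulb hh.le hX bφ)
  have iXψ := intervalIntegrable_of_bound_Ioo hcd.le (cX.fun_mul cψ) (hmulb hh.le hX bψ)
  have eg : ∫ x in c..d, g x = g m * (d - c) + ∫ x in c..d, ψ x := by
    have : ∀ x, g x = (g m + g1 m * (x - m)) + ψ x := fun x => by simp only [hψ]; ring
    conv_lhs => enter [1, x]; rw [this x]
    rw [integral_add (Continuous.intervalIntegrable (by fun_prop) _ _) iψ,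
      integral_add (Continuous.intervalIntegrable (by fun_prop) _ _)
        (Continuous.intervalIntegrable (by fun_prop) _ _),
      intervalIntegral.integral_const_mul, hm, integral_sub_mid]
    simp; ring
  set J := (d - c)⁻¹ * ∫ x in c..d, ψ x with hJ
  have hD : devIntegral f g c d = f1 m * g1 m * ((d - c) ^ 3 / 12)
      + f1 m * (∫ x in c..d, (x - m) * ψ x) + g1 m * (∫ x in c..d, (x - m) * φ x)
      + (∫ x in c..d, φ x * ψ x) - J * ∫ x in c..d, φ x := by
    unfold devIntegral
    have hmean : (d - c)⁻¹ * ∫ x in c..d, g x = g m + J := by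
      rw [eg, hJ]; field_simp
    rw [hmean]
    have : ∀ x, f x * (g x - (g m + J)) =
        (f m * g1 m - J * f1 m) * (x - m) + (f1 m * g1 m) * (x - m) ^ 2 + (f m) * ψ x
         + f1 m * ((x - m) * ψ x) + g1 m * ((x - m) * φ x) + φ x * ψ x - J * φ x
         - J * f m := fun x => by simp only [hψ, hφ]; ring
    simp_rw [this]
    have j1 := iX.const_mul (f m * g1 m - J * f1 m)
    have j2 := iX2.const_mul (f1 m * g1 m)
    have j3 := iψ.const_mul (f m)
    have j4 := iXψ.const_mul (f1 m)
    have j5 := iXφ.const_mul (g1 m)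
    have j6 := iφ.const_mul J
    rw [integral_sub (((((((j1.add j2).add j3).add j4).add j5).add iφψ)).sub j6)
        intervalIntegrable_const,
      integral_sub (((((j1.add j2).add j3).add j4).add j5).add iφψ) j6,
      integral_add ((((j1.add j2).add j3).add j4).add j5) iφψ,
      integral_add (((j1.add j2).add j3).add j4) j5,
      integral_add ((j1.add j2).add j3) j4,
      integral_add (j1.add j2) j3, integral_add j1 j2]
    simp only [intervalIntegral.integral_const_mul, intervalIntegral.integral_const, smul_eq_mul]
    rw [hm, integral_sub_mid, integral_sub_mid_sq, ← hm]
    have : (∫ x in c..d, ψ x) = J * (d - c) := by rw [hJ]; field_simp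
    rw [this]; ring
  have hP : ∫ x in c..d, f1 x * g1 x = f1 m * g1 m * (d - c) + f1 m * (∫ x in c..d, ψ1 x)
      + g1 m * (∫ x in c..d, φ1 x) + ∫ x in c..d, φ1 x * ψ1 x := by
    have : ∀ x, f1 x * g1 x = f1 m * g1 m + f1 m * ψ1 x + g1 m * φ1 x + φ1 x * ψ1 x :=
      fun x => by simp only [hψ1, hφ1]; ring
    rw [integral_congr_Ioo hcd.le fun x _ => this x]
    have j1 := iψ1.const_mul (f1 m)
    have j2 := iφ1.const_mul (g1 m)
    rw [integral_add ((intervalIntegrable_const.add j1).add j2) iφψ1,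
      integral_add (intervalIntegrable_const.add j1) j2,
      integral_add intervalIntegrable_const j1]
    simp only [intervalIntegral.integral_const_mul, intervalIntegral.integral_const, smul_eq_mul]
    ring
  have mψ := abs_moment_sub_le hcd dψ dψ1 hg2 hB3
  have mφ := abs_moment_sub_le hcd dφ dφ1 hf2 hA3
  rw [← hm] at mψ mφ
  have b1 := abs_integral_le_of_bound_Ioo hcd.le bφψ
  have b2 := abs_integral_le_of_bound_Ioo hcd.le bφψ1
  have b3 := abs_integral_le_of_bound_Ioo hcd.le bφ
  have b4 : |J| ≤ B2 * (d - c) ^ 2 := by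
    have := abs_integral_le_of_bound_Ioo hcd.le bψ
    rw [hJ, abs_mul, abs_of_pos (inv_pos.2 hh), inv_mul_le_iff₀ hh]
    linarith
  rw [hD, hP]
  set a1 := (∫ x in c..d, (x - m) * ψ x) - (d - c) ^ 2 / 12 * ∫ x in c..d, ψ1 x with ha1
  set a2 := (∫ x in c..d, (x - m) * φ x) - (d - c) ^ 2 / 12 * ∫ x in c..d, φ1 x with ha2
  have hkey : f1 m * g1 m * ((d - c) ^ 3 / 12)
      + f1 m * (∫ x in c..d, (x - m) * ψ x) + g1 m * (∫ x in c..d, (x - m) * φ x)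
      + (∫ x in c..d, φ x * ψ x) - J * (∫ x in c..d, φ x)
      - (d - c) ^ 2 / 12 * (f1 m * g1 m * (d - c) + f1 m * (∫ x in c..d, ψ1 x)
      + g1 m * (∫ x in c..d, φ1 x) + ∫ x in c..d, φ1 x * ψ1 x)
      = f1 m * a1 + g1 m * a2 + (∫ x in c..d, φ x * ψ x) - J * (∫ x in c..d, φ x)
        - (d - c) ^ 2 / 12 * ∫ x in c..d, φ1 x * ψ1 x := by
    rw [ha1, ha2]; ring
  rw [hkey]
  have t1 : |f1 m * a1| ≤ A1 * (2 * B3 * (d - c) ^ 5) := by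
    rw [abs_mul]
    exact mul_le_mul (hA1 m hmI) mψ (abs_nonneg _) ((abs_nonneg _).trans (hA1 m hmI))
  have t2 : |g1 m * a2| ≤ B1 * (2 * A3 * (d - c) ^ 5) := by
    rw [abs_mul]
    exact mul_le_mul (hB1 m hmI) mφ (abs_nonneg _) ((abs_nonneg _).trans (hB1 m hmI))
  have t3 : |J * (∫ x in c..d, φ x)| ≤ B2 * (d - c) ^ 2 * (A2 * (d - c) ^ 2 * (d - c)) := by
    rw [abs_mul]
    exact mul_le_mul b4 b3 (abs_nonneg _) (by positivity)
  have t4 : |(d - c) ^ 2 / 12 * ∫ x in c..d, φ1 x * ψ1 x|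
      ≤ (d - c) ^ 2 / 12 * (A2 * (d - c) * (B2 * (d - c)) * (d - c)) := by
    rw [abs_mul, abs_of_nonneg (by positivity : 0 ≤ (d - c) ^ 2 / 12)]
    exact mul_le_mul_of_nonneg_left b2 (by positivity)
  have p1 : 0 ≤ A1 * B3 * (d - c) ^ 5 :=
    mul_nonneg (mul_nonneg ((abs_nonneg _).trans (hA1 m hmI)) hB30) (by positivity)
  have p2 : 0 ≤ A3 * B1 * (d - c) ^ 5 :=
    mul_nonneg (mul_nonneg hA30 ((abs_nonneg _).trans (hB1 m hmI))) (by positivity)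
  have p3 : 0 ≤ A2 * B2 * (d - c) ^ 5 := by positivity
  rw [abs_le] at t1 t2 t3 t4 b1 ⊢
  constructor <;> linarith [t1.1, t1.2, t2.1, t2.2, t3.1, t3.2, t4.1, t4.2, b1.1, b1.2]

/-! ### Sums over graded meshes -/

/-- The nodes of the mesh on `[0, b]` with `n` elements that is graded towards `0`. -/
noncomputable def gradedNode (b q : ℝ) (n i : ℕ) : ℝ := b * ((i : ℝ) / n) ^ q

theorem rpow_sub_rpow_eq {x y : ℝ} (p : ℝ) (hx : 0 < x) (hxy : x < y) :
    ∃ ξ ∈ Ioo x y, y ^ p - x ^ p = p * ξ ^ (p - 1) * (y - x) := by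
  obtain ⟨ξ, hξ, h⟩ := exists_hasDerivAt_eq_slope (fun z => z ^ p) (fun z => p * z ^ (p - 1)) hxy
    (fun z hz => (Real.continuousAt_rpow_const _ _
      (Or.inl (hx.trans_le hz.1).ne')).continuousWithinAt)
    (fun z hz => Real.hasDerivAt_rpow_const (Or.inl (hx.trans hz.1).ne'))
  refine ⟨ξ, hξ, ?_⟩
  rw [h, div_mul_cancel₀ _ (sub_pos.2 hxy).ne']

theorem gradedNode_zero (b : ℝ) {q : ℝ} (n : ℕ) (hq : 0 < q) : gradedNode b q n 0 = 0 := by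
  simp [gradedNode, Real.zero_rpow hq.ne']

theorem gradedNode_self (b q : ℝ) {n : ℕ} (hn : 1 ≤ n) : gradedNode b q n n = b := by
  have : (n : ℝ) ≠ 0 := by positivity
  simp [gradedNode, div_self this]

theorem gradedNode_strictMono {b q : ℝ} {n : ℕ} (hb : 0 < b) (hq : 0 < q) (hn : 1 ≤ n) :
    StrictMono (gradedNode b q n) := fun i j hij => by
  have hn0 : (0 : ℝ) < n := by positivity
  have : (i : ℝ) < j := by exact_mod_cast hij
  unfold gradedNode
  gcongr

theorem gradedNode_pos {b q : ℝ} {n i : ℕ} (hb : 0 < b) (hn : 1 ≤ n) (hi : 1 ≤ i) :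
    0 < gradedNode b q n i := by
  unfold gradedNode; positivity

theorem gradedNode_nonneg {b q : ℝ} {n i : ℕ} (hb : 0 < b) : 0 ≤ gradedNode b q n i := by
  unfold gradedNode; positivity

theorem gradedNode_le {b q : ℝ} {n i : ℕ} (hb : 0 < b) (hq : 0 < q) (hn : 1 ≤ n) (hi : i ≤ n) :
    gradedNode b q n i ≤ b := by
  conv_rhs => rw [← gradedNode_self b q hn]
  exact (gradedNode_strictMono hb hq hn).monotone hi

theorem Ioo_gradedNode_subset {b q : ℝ} {n i : ℕ} (hb : 0 < b) (hq : 0 < q) (hn : 1 ≤ n)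
    (hi : i < n) : Ioo (gradedNode b q n i) (gradedNode b q n (i + 1)) ⊆ Ioo 0 b :=
  Ioo_subset_Ioo (gradedNode_nonneg hb) (gradedNode_le hb hq hn hi)

theorem gradedNode_succ_le {b q : ℝ} {n i : ℕ} (hb : 0 < b) (hq : 0 < q) (hi : 1 ≤ i) :
    gradedNode b q n (i + 1) ≤ 2 ^ q * gradedNode b q n i := by
  unfold gradedNode
  have h1 : (1 : ℝ) ≤ i := by exact_mod_cast hi
  have : ((i + 1 : ℕ) : ℝ) / n ≤ 2 * ((i : ℝ) / n) := by
    rw [← mul_div_assoc]; push_cast; gcongr; linarith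
  calc b * (((i + 1 : ℕ) : ℝ) / n) ^ q ≤ b * (2 * ((i : ℝ) / n)) ^ q := by gcongr
    _ = _ := by rw [Real.mul_rpow (by norm_num) (by positivity)]; ring

/-- Mean value theorem for `x^q`: since `i + 1 ≤ 2 i`, the intermediate point costs at most the
factor `2^q`, and `(i/n)^(q-1)` is `t^(1-1/q)` up to a power of `b`. The element at the origin is
excluded. -/
theorem gradedNode_succ_sub_le {b q : ℝ} {n i : ℕ} (hb : 0 < b) (hq : 1 ≤ q) (hn : 1 ≤ n)
    (hi : 1 ≤ i) : gradedNode b q n (i + 1) - gradedNode b q n i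
      ≤ (q * 2 ^ q * b ^ (1 / q)) * (n : ℝ)⁻¹ * gradedNode b q n i ^ (1 - 1 / q) := by
  have hn0 : (0 : ℝ) < n := by positivity
  have hi0 : (0 : ℝ) < i := by positivity
  have h1 : (1 : ℝ) ≤ i := by exact_mod_cast hi
  have hq0 : 0 < q := by linarith
  set x := (i : ℝ) / n with hx
  have hx0 : 0 < x := by positivity
  set y := ((i + 1 : ℕ) : ℝ) / n with hy
  have hyx : y - x = (n : ℝ)⁻¹ := by rw [hx, hy]; push_cast; field_simp; ring
  have hxy : x < y := by have : 0 < (n : ℝ)⁻¹ := by positivity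
                         linarith
  have hy2 : y ≤ 2 * x := by
    rw [hx, hy, ← mul_div_assoc]; push_cast; gcongr; linarith
  obtain ⟨ξ, hξ, h⟩ := rpow_sub_rpow_eq q hx0 hxy
  have hξ' : ξ ^ (q - 1) ≤ 2 ^ q * x ^ (q - 1) := by
    calc ξ ^ (q - 1) ≤ (2 * x) ^ (q - 1) :=
          Real.rpow_le_rpow (hx0.trans hξ.1).le (hξ.2.le.trans hy2) (by linarith)
      _ = 2 ^ (q - 1) * x ^ (q - 1) := Real.mul_rpow (by norm_num) hx0.le
      _ ≤ _ := by gcongr <;> linarith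
  have hb1 : b = b ^ (1 / q) * b ^ (1 - 1 / q) := by
    rw [← Real.rpow_add hb]; simp
  have hxq : (x ^ q) ^ (1 - 1 / q) = x ^ (q - 1) := by
    rw [← Real.rpow_mul hx0.le]; congr 1; field_simp
  calc gradedNode b q n (i + 1) - gradedNode b q n i = b * (y ^ q - x ^ q) := by
        simp only [gradedNode, ← hx, ← hy]; ring
    _ = b * (q * ξ ^ (q - 1) * (n : ℝ)⁻¹) := by rw [h, hyx]
    _ ≤ b * (q * (2 ^ q * x ^ (q - 1)) * (n : ℝ)⁻¹) := by gcongr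
    _ = _ := by
        simp only [gradedNode, ← hx]
        rw [Real.mul_rpow hb.le (by positivity), hxq]
        conv_lhs => rw [hb1]
        ring

/-- This is a Riemann sum for the integral of `t^(η-1)`; each term is dominated by an increment of
`t^η`, and the increments telescope. -/
theorem exists_sum_gradedNode_le {b q η : ℝ} (hb : 0 < b) (hq : 0 < q) (hη : 0 < η) :
    ∃ C, 0 ≤ C ∧ ∀ n : ℕ, 1 ≤ n → ∑ i ∈ Finset.Ico 1 n,
      (gradedNode b q n (i + 1) - gradedNode b q n i) * gradedNode b q n i ^ (η - 1) ≤ C := by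
  -- `κ` covers both signs of `η - 1`: an intermediate point lies between `t_i` and `2^q t_i`.
  set κ : ℝ := min 1 ((2 ^ q) ^ (η - 1)) with hκ
  have hκ0 : 0 < κ := by positivity
  refine ⟨(η * κ)⁻¹ * b ^ η, by positivity, fun n hn => ?_⟩
  have hmono := gradedNode_strictMono hb hq hn
  have key : ∀ i ∈ Finset.Ico 1 n,
      (gradedNode b q n (i + 1) - gradedNode b q n i) * gradedNode b q n i ^ (η - 1)
      ≤ (η * κ)⁻¹ * (gradedNode b q n (i + 1) ^ η - gradedNode b q n i ^ η) := by
    intro i hi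
    rw [Finset.mem_Ico] at hi
    have ht := gradedNode_pos (q := q) hb hn hi.1
    have hlt := hmono (Nat.lt_succ_self i)
    obtain ⟨ξ, hξ, h⟩ := rpow_sub_rpow_eq η ht hlt
    have hξ1 : κ * gradedNode b q n i ^ (η - 1) ≤ ξ ^ (η - 1) := by
      rcases le_total 0 (η - 1) with h0 | h0
      · calc κ * gradedNode b q n i ^ (η - 1) ≤ 1 * gradedNode b q n i ^ (η - 1) := by
              gcongr; exact min_le_left _ _
          _ ≤ ξ ^ (η - 1) := by
              rw [one_mul]; exact Real.rpow_le_rpow ht.le hξ.1.le h0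
      · calc κ * gradedNode b q n i ^ (η - 1)
              ≤ (2 ^ q) ^ (η - 1) * gradedNode b q n i ^ (η - 1) := by
              gcongr; exact min_le_right _ _
          _ = (2 ^ q * gradedNode b q n i) ^ (η - 1) :=
              (Real.mul_rpow (by positivity) ht.le).symm
          _ ≤ ξ ^ (η - 1) := Real.rpow_le_rpow_of_nonpos (ht.trans hξ.1)
              (hξ.2.le.trans (gradedNode_succ_le hb hq hi.1)) h0
    rw [le_inv_mul_iff₀ (by positivity)]
    erw [h]
    have := sub_pos.2 hlt
    calc η * κ * ((gradedNode b q n (i + 1) - gradedNode b q n i) * gradedNode b q n i ^ (η - 1))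
        = η * (κ * gradedNode b q n i ^ (η - 1)) *
          (gradedNode b q n (i + 1) - gradedNode b q n i) := by ring
      _ ≤ η * ξ ^ (η - 1) * (gradedNode b q n (i + 1) - gradedNode b q n i) := by gcongr
  refine (Finset.sum_le_sum key).trans ?_
  rw [← Finset.mul_sum, Finset.sum_Ico_sub (f := fun i => gradedNode b q n i ^ η) hn,
    gradedNode_self b q hn]
  have : 0 ≤ gradedNode b q n 1 ^ η := Real.rpow_nonneg (gradedNode_nonneg hb) _
  gcongr
  linarith

/-- Summation over a graded mesh. -/
theorem exists_sum_gradedNode_pow_le {b q ξ : ℝ} (m : ℕ) (hb : 0 < b) (hq : 1 ≤ q)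
    (h : 0 < ξ + m + 1 - m / q) :
    ∃ C, 0 ≤ C ∧ ∀ n : ℕ, 1 ≤ n → ∑ i ∈ Finset.Ico 1 n,
      (gradedNode b q n (i + 1) - gradedNode b q n i) ^ (m + 1) * gradedNode b q n i ^ ξ
        ≤ C * ((n : ℝ)⁻¹) ^ m := by
  obtain ⟨C, hC0, hC⟩ := exists_sum_gradedNode_le hb (by linarith : 0 < q) h
  set A := q * 2 ^ q * b ^ (1 / q) with hA
  have hA0 : 0 ≤ A := by positivity
  refine ⟨A ^ m * C, by positivity, fun n hn => ?_⟩
  have hmono := gradedNode_strictMono hb (by linarith : 0 < q) hn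
  -- Of the `m + 1` factors `h_τ`, `m` are replaced by `A n⁻¹ t^(1-1/q)`; the last one is kept as
  -- the weight of the Riemann sum.
  calc _ ≤ ∑ i ∈ Finset.Ico 1 n, (A ^ m * ((n : ℝ)⁻¹) ^ m) *
        ((gradedNode b q n (i + 1) - gradedNode b q n i) *
          gradedNode b q n i ^ (ξ + m + 1 - m / q - 1)) := by
        refine Finset.sum_le_sum fun i hi => ?_
        rw [Finset.mem_Ico] at hi
        have ht := gradedNode_pos (q := q) hb hn hi.1
        have hlt := sub_pos.2 (hmono (Nat.lt_succ_self i))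
        have hw := gradedNode_succ_sub_le hb hq hn hi.1
        set t := gradedNode b q n i
        set w := gradedNode b q n (i + 1) - t
        have e1 : t ^ (ξ + m + 1 - m / q - 1) = (t ^ (1 - 1 / q)) ^ m * t ^ ξ := by
          rw [← Real.rpow_natCast, ← Real.rpow_mul ht.le, ← Real.rpow_add ht]
          congr 1; ring
        rw [e1]
        calc w ^ (m + 1) * t ^ ξ = w ^ m * (w * t ^ ξ) := by ring
          _ ≤ (A * (n : ℝ)⁻¹ * t ^ (1 - 1 / q)) ^ m * (w * t ^ ξ) := by
            gcongr
          _ = _ := by rw [mul_pow, mul_pow]; ring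
    _ ≤ _ := by
        rw [← Finset.mul_sum]
        calc _ ≤ A ^ m * ((n : ℝ)⁻¹) ^ m * C := by gcongr; exact hC n hn
          _ = _ := by ring

/-! ### Bounds of the mean deviation integral, differentiation under the integral -/

/-- Oscillation of a function whose derivative has an integrable power singularity. -/
theorem abs_sub_le_of_deriv_rpow {g g1 : ℝ → ℝ} {d M θ : ℝ} (hθ : 0 < θ)
    (hg : ∀ x ∈ Ioo 0 d, HasDerivAt g (g1 x) x) (hM : ∀ x ∈ Ioo 0 d, |g1 x| ≤ M * x ^ (θ - 1))
    {x y : ℝ} (hx : x ∈ Ioo 0 d) (hy : y ∈ Ioo 0 d) : |g x - g y| ≤ M / θ * d ^ θ := by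
  have hd : 0 < d := hx.1.trans hx.2
  have hM0 : 0 ≤ M := by
    have := (abs_nonneg _).trans (hM x hx)
    exact nonneg_of_mul_nonneg_left this (Real.rpow_pos_of_pos hx.1 _)
  have main : ∀ x ∈ Ioo 0 d, ∀ y ∈ Ioo 0 d, x ≤ y → |g x - g y| ≤ M / θ * d ^ θ := by
    intro x hx y hy hxy
    have hder : ∀ z ∈ Ioo 0 d, HasDerivAt (fun z => M / θ * z ^ θ) (M * z ^ (θ - 1)) z := by
      intro z hz
      refine ((Real.hasDerivAt_rpow_const (Or.inl hz.1.ne')).const_mul (M / θ)).congr_deriv ?_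
      field_simp
    -- Both `M/θ z^θ - g` and `M/θ z^θ + g` are nondecreasing, which bounds the increments of `g`
    -- without integrating its derivative.
    have m1 : MonotoneOn (fun z => M / θ * z ^ θ - g z) (Ioo 0 d) :=
      monotoneOn_of_hasDerivWithinAt_nonneg (convex_Ioo 0 d)
        (fun z hz => ((hder z hz).fun_sub (hg z hz)).continuousAt.continuousWithinAt)
        (fun z hz => by
          rw [interior_Ioo] at hz ⊢
          exact ((hder z hz).fun_sub (hg z hz)).hasDerivWithinAt)
        (fun z hz => by
          rw [interior_Ioo] at hz
          have := (abs_le.1 (hM z hz)).2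
          linarith)
    have m2 : MonotoneOn (fun z => M / θ * z ^ θ + g z) (Ioo 0 d) :=
      monotoneOn_of_hasDerivWithinAt_nonneg (convex_Ioo 0 d)
        (fun z hz => ((hder z hz).fun_add (hg z hz)).continuousAt.continuousWithinAt)
        (fun z hz => by
          rw [interior_Ioo] at hz ⊢
          exact ((hder z hz).fun_add (hg z hz)).hasDerivWithinAt)
        (fun z hz => by
          rw [interior_Ioo] at hz
          have := (abs_le.1 (hM z hz)).1
          linarith)
    have h1 := m1 hx hy hxy
    have h2 := m2 hx hy hxy
    simp only at h1 h2
    have hxp : 0 ≤ M / θ * x ^ θ := by have := hx.1; positivity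
    have hyp : M / θ * y ^ θ ≤ M / θ * d ^ θ := by have := hy.1; have := hy.2; gcongr
    rw [abs_le]; constructor <;> linarith
  rcases le_total x y with h | h
  · exact main x hx y hy h
  · rw [abs_sub_comm]; exact main y hy x hx h

theorem abs_sub_mean_le {g : ℝ → ℝ} {c d M : ℝ} (hcd : c < d)
    (hg : IntervalIntegrable g volume c d)
    (hM : ∀ x ∈ Ioo c d, ∀ y ∈ Ioo c d, |g x - g y| ≤ M) {x : ℝ} (hx : x ∈ Ioo c d) :
    |g x - (d - c)⁻¹ * ∫ y in c..d, g y| ≤ M := by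
  have hh : 0 < d - c := sub_pos.2 hcd
  have e : g x - (d - c)⁻¹ * ∫ y in c..d, g y = (d - c)⁻¹ * ∫ y in c..d, (g x - g y) := by
    rw [intervalIntegral.integral_sub intervalIntegrable_const hg,
      intervalIntegral.integral_const, smul_eq_mul]
    field_simp
  rw [e, abs_mul, abs_of_pos (inv_pos.2 hh), inv_mul_le_iff₀ hh]
  have := abs_integral_le_of_bound_Ioo hcd.le (hM x hx)
  linarith

/-- The deviation of `g` is at most its oscillation, so `f` needs only to be integrable. This serves
the elements at the corners and functions of which only smallness is known. -/
theorem abs_devIntegral_le_of_osc {f g : ℝ → ℝ} {c d M : ℝ} (hcd : c < d)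
    (hf : IntervalIntegrable f volume c d) (hg : IntervalIntegrable g volume c d)
    (hM : ∀ x ∈ Ioo c d, ∀ y ∈ Ioo c d, |g x - g y| ≤ M) :
    |devIntegral f g c d| ≤ M * ∫ x in c..d, |f x| := by
  have hR : M * ∫ x in c..d, |f x| = ∫ x in Ioo c d, M * |f x| := by
    rw [integral_of_le hcd.le, integral_Ioc_eq_integral_Ioo, MeasureTheory.integral_const_mul]
  rw [hR, devIntegral, integral_of_le hcd.le, integral_Ioc_eq_integral_Ioo, ← Real.norm_eq_abs]
  have hf' := (intervalIntegrable_iff_integrableOn_Ioo_of_le hcd.le).1 hf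
  refine MeasureTheory.norm_integral_le_of_norm_le (hf'.abs.const_mul M) ?_
  refine (ae_restrict_iff' measurableSet_Ioo).2 (Eventually.of_forall fun x hx => ?_)
  rw [Real.norm_eq_abs, abs_mul, mul_comm]
  exact mul_le_mul_of_nonneg_right (abs_sub_mean_le hcd hg hM hx) (abs_nonneg _)

/-- The deviation from the mean integrates to zero, so `f` may be replaced by `f - f m`; then both
factors are of first order. -/
theorem abs_devIntegral_le {f g f1 g1 : ℝ → ℝ} {c d A B : ℝ} (hcd : c < d)
    (hf : ∀ x ∈ Ioo c d, HasDerivAt f (f1 x) x) (hg : ∀ x ∈ Ioo c d, HasDerivAt g (g1 x) x)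
    (hA : ∀ x ∈ Ioo c d, |f1 x| ≤ A) (hB : ∀ x ∈ Ioo c d, |g1 x| ≤ B) :
    |devIntegral f g c d| ≤ A * B * (d - c) ^ 3 := by
  have hh : 0 < d - c := sub_pos.2 hcd
  set m := (c + d) / 2 with hm
  have hmI : m ∈ Ioo c d := ⟨by linarith, by linarith⟩
  have hA0 : 0 ≤ A := (abs_nonneg _).trans (hA m hmI)
  have hB0 : 0 ≤ B := (abs_nonneg _).trans (hB m hmI)
  have oscg : ∀ x ∈ Ioo c d, ∀ y ∈ Ioo c d, |g x - g y| ≤ B * (d - c) :=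
    fun x hx y hy => abs_sub_le_of_hasDerivAt hg hB hx hy
  have oscf : ∀ x ∈ Ioo c d, |f x - f m| ≤ A * (d - c) :=
    fun x hx => abs_sub_le_of_hasDerivAt hf hA hx hmI
  have cf := continuousOn_Ioo_of_hasDerivAt hf
  have cg := continuousOn_Ioo_of_hasDerivAt hg
  have ig : IntervalIntegrable g volume c d := by
    have : IntervalIntegrable (fun x => g x - g m) volume c d :=
      intervalIntegrable_of_bound_Ioo hcd.le (cg.sub continuousOn_const)
        (fun x hx => oscg x hx m hmI)
    simpa using this.add (intervalIntegrable_const (c := g m))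
  have if' : IntervalIntegrable (fun x => f x - f m) volume c d :=
    intervalIntegrable_of_bound_Ioo hcd.le (cf.sub continuousOn_const) oscf
  have idev : IntervalIntegrable (fun x => g x - (d - c)⁻¹ * ∫ y in c..d, g y) volume c d :=
    ig.sub intervalIntegrable_const
  have h0 : ∫ x in c..d, (g x - (d - c)⁻¹ * ∫ y in c..d, g y) = 0 := by
    rw [intervalIntegral.integral_sub ig intervalIntegrable_const,
      intervalIntegral.integral_const, smul_eq_mul]
    field_simp; ring
  have bd : ∀ x ∈ Ioo c d, |(f x - f m) * (g x - (d - c)⁻¹ * ∫ y in c..d, g y)|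
      ≤ A * (d - c) * (B * (d - c)) := fun x hx => by
    rw [abs_mul]
    exact mul_le_mul (oscf x hx) (abs_sub_mean_le hcd ig oscg hx) (abs_nonneg _) (by positivity)
  have i1 : IntervalIntegrable
      (fun x => (f x - f m) * (g x - (d - c)⁻¹ * ∫ y in c..d, g y)) volume c d :=
    intervalIntegrable_of_bound_Ioo hcd.le
      ((cf.sub continuousOn_const).mul (cg.sub continuousOn_const)) bd
  have e : devIntegral f g c d
      = ∫ x in c..d, (f x - f m) * (g x - (d - c)⁻¹ * ∫ y in c..d, g y) := by
    unfold devIntegral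
    have : ∀ x, f x * (g x - (d - c)⁻¹ * ∫ y in c..d, g y)
        = (f x - f m) * (g x - (d - c)⁻¹ * ∫ y in c..d, g y)
          + f m * (g x - (d - c)⁻¹ * ∫ y in c..d, g y) := fun x => by ring
    rw [integral_congr_Ioo hcd.le fun x _ => this x,
      intervalIntegral.integral_add i1 (idev.const_mul _), intervalIntegral.integral_const_mul,
      h0, mul_zero, add_zero]
  rw [e]
  have := abs_integral_le_of_bound_Ioo hcd.le bd
  linarith

theorem intervalIntegrable_mul_of_bound {k g : ℝ → ℝ} {c d M : ℝ} (hcd : c ≤ d)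
    (hk : IntervalIntegrable k volume c d) (hg : ContinuousOn g (Ioo c d))
    (hM : ∀ x ∈ Ioo c d, |g x| ≤ M) : IntervalIntegrable (fun x => k x * g x) volume c d := by
  rw [intervalIntegrable_iff_integrableOn_Ioo_of_le hcd] at hk ⊢
  exact Integrable.mul_bdd (c := M) hk (hg.aestronglyMeasurable measurableSet_Ioo)
    ((ae_restrict_iff' measurableSet_Ioo).2 (Eventually.of_forall hM))

theorem devIntegral_add_right {k g g' : ℝ → ℝ} {c d M M' : ℝ} (hcd : c ≤ d)
    (hk : IntervalIntegrable k volume c d) (hg : ContinuousOn g (Ioo c d))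
    (hM : ∀ x ∈ Ioo c d, |g x| ≤ M) (hg' : ContinuousOn g' (Ioo c d))
    (hM' : ∀ x ∈ Ioo c d, |g' x| ≤ M') :
    devIntegral k (fun x => g x + g' x) c d = devIntegral k g c d + devIntegral k g' c d := by
  unfold devIntegral
  have i1 := intervalIntegrable_of_bound_Ioo hcd hg hM
  have i2 := intervalIntegrable_of_bound_Ioo hcd hg' hM'
  have j1 := intervalIntegrable_mul_of_bound hcd hk hg hM
  have j2 := intervalIntegrable_mul_of_bound hcd hk hg' hM'
  have l1 : IntervalIntegrable (fun t => k t * (g t - (d - c)⁻¹ * ∫ x in c..d, g x)) volume c d := by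
    simp_rw [mul_sub]; exact j1.sub (hk.mul_const _)
  have l2 : IntervalIntegrable (fun t => k t * (g' t - (d - c)⁻¹ * ∫ x in c..d, g' x))
      volume c d := by
    simp_rw [mul_sub]; exact j2.sub (hk.mul_const _)
  rw [intervalIntegral.integral_add i1 i2, ← intervalIntegral.integral_add l1 l2]
  exact intervalIntegral.integral_congr fun x _ => by ring

/-- The kernels blow up as `σ → 0`, so uniform bounds are available only for `σ > δ`.
Differentiation is local, and `δ = σ / 2` suffices for a dominating constant. -/
theorem hasDerivAt_integral_param {K K1 : ℝ → ℝ → ℝ} {v : ℝ → ℝ} {b c d V : ℝ} (hcd : c ≤ d)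
    (hv : ContinuousOn v (Ioo c d)) (hV : ∀ τ ∈ Ioo c d, |v τ| ≤ V)
    (hK : ∀ σ ∈ Ioo 0 b, ∀ τ ∈ Ioo c d, HasDerivAt (fun σ => K σ τ) (K1 σ τ) σ)
    (hKc : ∀ σ ∈ Ioo 0 b, ContinuousOn (K σ) (Ioo c d))
    (hK1c : ∀ σ ∈ Ioo 0 b, ContinuousOn (K1 σ) (Ioo c d))
    (hKb : ∀ δ > 0, ∃ M, ∀ σ ∈ Ioo δ b, ∀ τ ∈ Ioo c d, |K σ τ| ≤ M)
    (hK1b : ∀ δ > 0, ∃ M, ∀ σ ∈ Ioo δ b, ∀ τ ∈ Ioo c d, |K1 σ τ| ≤ M)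
    {σ : ℝ} (hσ : σ ∈ Ioo 0 b) :
    HasDerivAt (fun σ => ∫ τ in c..d, K σ τ * v τ) (∫ τ in c..d, K1 σ τ * v τ) σ := by
  have hδ : 0 < σ / 2 := half_pos hσ.1
  have hnhds : Ioo (σ / 2) b ∈ 𝓝 σ := Ioo_mem_nhds (half_lt_self hσ.1) hσ.2
  have hsub : Ioo (σ / 2) b ⊆ Ioo 0 b := Ioo_subset_Ioo_left hδ.le
  obtain ⟨M, hM⟩ := hKb _ hδ
  obtain ⟨M1, hM1⟩ := hK1b _ hδ
  have hint : ∀ x ∈ Ioo (σ / 2) b, IntervalIntegrable (fun τ => K x τ * v τ) volume c d :=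
    fun x hx => intervalIntegrable_of_bound_Ioo hcd ((hKc x (hsub hx)).mul hv) (M := M * V)
      fun τ hτ => by
        rw [abs_mul]
        exact mul_le_mul (hM x hx τ hτ) (hV τ hτ) (abs_nonneg _)
          ((abs_nonneg _).trans (hM x hx τ hτ))
  have hσ' : σ ∈ Ioo (σ / 2) b := ⟨half_lt_self hσ.1, hσ.2⟩
  have hint1 : IntervalIntegrable (fun τ => K1 σ τ * v τ) volume c d :=
    intervalIntegrable_of_bound_Ioo hcd ((hK1c σ hσ).mul hv) (M := M1 * V)
      fun τ hτ => by
        rw [abs_mul]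
        exact mul_le_mul (hM1 σ hσ' τ hτ) (hV τ hτ) (abs_nonneg _)
          ((abs_nonneg _).trans (hM1 σ hσ' τ hτ))
  simp only [integral_of_le hcd, integral_Ioc_eq_integral_Ioo]
  refine (_root_.hasDerivAt_integral_of_dominated_loc_of_deriv_le (bound := fun _ => M1 * V) hnhds
    (F := fun σ τ => K σ τ * v τ) (F' := fun σ τ => K1 σ τ * v τ) (μ := volume.restrict (Ioo c d))
    ?_ ?_ ?_ ?_ ?_ ?_).2
  · filter_upwards [hnhds] with x hx
    exact ((intervalIntegrable_iff_integrableOn_Ioo_of_le hcd).1 (hint x hx)).aestronglyMeasurable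
  · exact (intervalIntegrable_iff_integrableOn_Ioo_of_le hcd).1 (hint σ hσ')
  · exact ((intervalIntegrable_iff_integrableOn_Ioo_of_le hcd).1 hint1).aestronglyMeasurable
  · refine (ae_restrict_iff' measurableSet_Ioo).2 (Eventually.of_forall fun τ hτ x hx => ?_)
    rw [Real.norm_eq_abs, abs_mul]
    exact mul_le_mul (hM1 x hx τ hτ) (hV τ hτ) (abs_nonneg _)
          ((abs_nonneg _).trans (hM1 x hx τ hτ))
  · exact integrable_const _
  · refine (ae_restrict_iff' measurableSet_Ioo).2 (Eventually.of_forall fun τ hτ x hx => ?_)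
    exact (hK x (hsub hx) τ hτ).mul_const _

/-! ### Abstract kernels on a family of graded intervals -/

/-- A finite family of intervals `[0, b p]` with grading exponents `q p` and weights `a p`, and for
every pair of intervals a kernel `K p p' 0 0` with its partial derivatives `K p p' i l` and
estimates for them near the origin. -/
structure GradedKernel (ι : Type) where
  b : ι → ℝ
  q : ι → ℝ
  a : ι → ℝ
  K : ι → ι → ℕ → ℕ → ℝ → ℝ → ℝ
  B : ℝ
  b_pos : ∀ p, 0 < b p
  q_pos : ∀ p, 0 < q p
  a_le_one : ∀ p, a p ≤ 1
  -- For `α = a - 2/q > 0` this is `q > 4/α`.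
  six_lt : ∀ p, 6 < q p * a p
  hasDerivAt_left : ∀ p p' i l, ∀ σ ∈ Ioo 0 (b p), ∀ τ ∈ Ioo 0 (b p'),
    HasDerivAt (fun σ => K p p' i l σ τ) (K p p' (i + 1) l σ τ) σ
  hasDerivAt_right : ∀ p p' i l, ∀ σ ∈ Ioo 0 (b p), ∀ τ ∈ Ioo 0 (b p'),
    HasDerivAt (K p p' i l σ) (K p p' i (l + 1) σ τ) τ
  bound : ∀ p p', ∀ i ≤ 3, ∀ l ≤ 3, ∀ σ ∈ Ioo 0 (b p), ∀ τ ∈ Ioo 0 (b p'),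
    |K p p' i l σ τ| ≤ B * σ ^ (-(1 + i + l) : ℝ)
  -- `θ` moves a part of the singularity from `σ` to `τ`. The larger value serves the inner
  -- estimates of order `h²`, the smaller one those of order `h⁴`.
  bound_mixed : ∀ θ : ι → ℝ, (θ = (fun p => a p / 2 + 1 / q p) ∨ θ = fun p => a p / 2 - 1 / q p) →
    ∀ p p', ∀ i ≤ 3, 1 ≤ i → ∀ l ≤ 3, ∀ σ ∈ Ioo 0 (b p), ∀ τ ∈ Ioo 0 (b p'),
    |K p p' i l σ τ| ≤ B * (σ ^ (θ p - i) * τ ^ (-(1 + l + θ p')))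
  integral_abs_le : ∀ p p', ∀ σ ∈ Ioo 0 (b p), ∫ τ in 0..b p', |K p p' 0 0 σ τ| ≤ 1

namespace GradedKernel

variable {ι : Type} (G : GradedKernel ι)

/-- A function on the family of intervals, `U p i` being its `i`th derivative on the `p`th interval,
with weighted norm at most `N`. -/
structure IsWeighted (N : ℝ) (U : ι → ℕ → ℝ → ℝ) : Prop where
  hasDerivAt : ∀ p, ∀ i ≤ 2, ∀ τ ∈ Ioo 0 (G.b p), HasDerivAt (U p i) (U p (i + 1) τ) τ
  bound_zero : ∀ p, ∀ τ ∈ Ioo 0 (G.b p), |U p 0 τ| ≤ N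
  bound : ∀ p, ∀ i ≤ 3, 1 ≤ i → ∀ τ ∈ Ioo 0 (G.b p), |U p i τ| ≤ N * τ ^ (G.a p - i)

/-- The kernel `k p 0`, with its derivatives, seen from a fixed point. -/
structure IsSection (A : ℝ) (k : ι → ℕ → ℝ → ℝ) : Prop where
  hasDerivAt : ∀ p, ∀ i ≤ 2, ∀ τ ∈ Ioo 0 (G.b p), HasDerivAt (k p i) (k p (i + 1) τ) τ
  bound : ∀ p, ∀ i ≤ 3, 1 ≤ i → ∀ τ ∈ Ioo 0 (G.b p), |k p i τ| ≤ A * τ ^ (-(1 + i) : ℝ)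
  integrable : ∀ p, IntervalIntegrable (k p 0) volume 0 (G.b p)
  integral_abs_le : ∀ p, ∫ τ in 0..G.b p, |k p 0 τ| ≤ 1

/-- The numbers `n p` of elements are positive and the mesh parameter is at most `h`. -/
structure IsMesh (n : ι → ℕ) (h : ℝ) : Prop where
  one_le : ∀ p, 1 ≤ n p
  inv_le : ∀ p, ((n p : ℝ))⁻¹ ≤ h

/-- The nodes of the mesh. -/
noncomputable def node (n : ι → ℕ) (p : ι) (j : ℕ) : ℝ := gradedNode (G.b p) (G.q p) (n p) j

variable {G}

theorem a_pos (p : ι) : 0 < G.a p :=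
  pos_of_mul_pos_right ((by norm_num : (0:ℝ) < 6).trans (G.six_lt p)) (G.q_pos p).le

theorem inv_q_lt (p : ι) : 1 / G.q p < G.a p / 6 := by
  rw [div_lt_iff₀ (G.q_pos p)]
  linarith [G.six_lt p]

theorem inv_q_pos (p : ι) : 0 < 1 / G.q p := one_div_pos.2 (G.q_pos p)

theorem one_le_q (p : ι) : 1 ≤ G.q p := by
  by_contra! h
  have := G.six_lt p
  have h1 := G.a_le_one p
  nlinarith [G.q_pos p, a_pos (G := G) p]

theorem B_nonneg (p : ι) : 0 ≤ G.B := by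
  have hm : G.b p / 2 ∈ Ioo 0 (G.b p) := ⟨half_pos (G.b_pos p), half_lt_self (G.b_pos p)⟩
  have := (abs_nonneg _).trans (G.bound p p 0 (by norm_num) 0 (by norm_num) _ hm _ hm)
  exact nonneg_of_mul_nonneg_left this (Real.rpow_pos_of_pos hm.1 _)

variable {n : ι → ℕ} {h N : ℝ} {U : ι → ℕ → ℝ → ℝ}

theorem IsMesh.pos (hn : IsMesh n h) (p : ι) : 0 < h :=
  lt_of_lt_of_le (by have := hn.one_le p; positivity) (hn.inv_le p)

theorem node_lt (hn : IsMesh n h) (p : ι) (j : ℕ) : G.node n p j < G.node n p (j + 1) :=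
  gradedNode_strictMono (G.b_pos p) (G.q_pos p) (hn.one_le p) (Nat.lt_succ_self j)

theorem node_pos (hn : IsMesh n h) (p : ι) {j : ℕ} (hj : 1 ≤ j) : 0 < G.node n p j :=
  gradedNode_pos (G.b_pos p) (hn.one_le p) hj

theorem node_zero (p : ι) : G.node n p 0 = 0 := gradedNode_zero _ _ (G.q_pos p)

theorem Ioo_node_subset (hn : IsMesh n h) (p : ι) {j : ℕ} (hj : j < n p) :
    Ioo (G.node n p j) (G.node n p (j + 1)) ⊆ Ioo 0 (G.b p) :=
  Ioo_gradedNode_subset (G.b_pos p) (G.q_pos p) (hn.one_le p) hj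

theorem node_nonneg (p : ι) (j : ℕ) : 0 ≤ G.node n p j := gradedNode_nonneg (G.b_pos p)

theorem node_le (hn : IsMesh n h) (p : ι) {j : ℕ} (hj : j ≤ n p) : G.node n p j ≤ G.b p :=
  gradedNode_le (G.b_pos p) (G.q_pos p) (hn.one_le p) hj

theorem exists_sum_node_le (p : ι) (m : ℕ) {ξ : ℝ} (hξ : 0 < ξ + m + 1 - m / G.q p) :
    ∃ C, 0 ≤ C ∧ ∀ (n : ι → ℕ) (h : ℝ), IsMesh n h →
      ∑ j ∈ Finset.Ico 1 (n p), (G.node n p (j + 1) - G.node n p j) ^ (m + 1) * G.node n p j ^ ξ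
        ≤ C * h ^ m := by
  obtain ⟨C, hC0, hC⟩ := exists_sum_gradedNode_pow_le m (G.b_pos p) (one_le_q p) hξ
  refine ⟨C, hC0, fun n h hn => (hC (n p) (hn.one_le p)).trans ?_⟩
  have := hn.one_le p
  have := hn.inv_le p
  gcongr

/-- The first node is `b n^(-q)`: the grading turns the oscillation `t_1^θ` on a corner element into
a power of `h`. -/
theorem node_one_rpow_le (hn : IsMesh n h) (p : ι) {θ : ℝ} {m : ℕ} (hθ : (m : ℝ) ≤ G.q p * θ) :
    G.node n p 1 ^ θ ≤ G.b p ^ θ * h ^ m := by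
  have hn1 := hn.one_le p
  have hn0 : (0 : ℝ) < n p := by positivity
  have hb := G.b_pos p
  unfold node gradedNode
  rw [Real.mul_rpow hb.le (by positivity), ← Real.rpow_mul (by positivity)]
  have : (((1 : ℕ) : ℝ) / n p) ^ (G.q p * θ) ≤ h ^ m := by
    calc (((1 : ℕ) : ℝ) / n p) ^ (G.q p * θ) ≤ (((1 : ℕ) : ℝ) / n p) ^ (m : ℝ) := by
          refine Real.rpow_le_rpow_of_exponent_ge (by positivity) ?_ hθ
          rw [div_le_one hn0]; exact_mod_cast hn1
      _ = ((n p : ℝ)⁻¹) ^ m := by rw [Real.rpow_natCast]; simp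
      _ ≤ h ^ m := by have := hn.inv_le p; gcongr
  gcongr

theorem continuousOn_K_right (p p' : ι) (i l : ℕ) {σ : ℝ} (hσ : σ ∈ Ioo 0 (G.b p)) :
    ContinuousOn (G.K p p' i l σ) (Ioo 0 (G.b p')) :=
  continuousOn_Ioo_of_hasDerivAt (G.hasDerivAt_right p p' i l σ hσ)

theorem exists_K_bound (p p' : ι) {i l : ℕ} (hi : i ≤ 3) (hl : l ≤ 3) :
    ∀ δ > 0, ∃ M, ∀ σ ∈ Ioo δ (G.b p), ∀ τ ∈ Ioo 0 (G.b p'), |G.K p p' i l σ τ| ≤ M := by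
  intro δ hδ
  refine ⟨G.B * δ ^ (-(1 + i + l) : ℝ), fun σ hσ τ hτ => ?_⟩
  refine (G.bound p p' i hi l hl σ ⟨hδ.trans hσ.1, hσ.2⟩ τ hτ).trans ?_
  refine mul_le_mul_of_nonneg_left ?_ (B_nonneg p)
  exact Real.rpow_le_rpow_of_nonpos hδ hσ.1.le (by linarith [(i.cast_nonneg : (0:ℝ) ≤ i),
    (l.cast_nonneg : (0:ℝ) ≤ l)])

theorem intervalIntegrable_K (p p' : ι) {i l : ℕ} (hi : i ≤ 3) (hl : l ≤ 3) {σ : ℝ}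
    (hσ : σ ∈ Ioo 0 (G.b p)) {c d : ℝ} (hc : 0 ≤ c) (hcd : c ≤ d) (hd : d ≤ G.b p') :
    IntervalIntegrable (G.K p p' i l σ) volume c d :=
  intervalIntegrable_of_bound_Ioo hcd
    ((continuousOn_K_right p p' i l hσ).mono (Ioo_subset_Ioo hc hd))
    (fun τ hτ => G.bound p p' i hi l hl σ hσ τ ⟨hc.trans_lt hτ.1, hτ.2.trans_le hd⟩)

theorem integral_mono_Ioo_of_nonneg {f : ℝ → ℝ} {b c d : ℝ} (hf : ∀ x, 0 ≤ f x)
    (hfi : IntervalIntegrable f volume 0 b) (hc : 0 ≤ c) (hcd : c ≤ d) (hd : d ≤ b) :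
    ∫ x in c..d, f x ≤ ∫ x in 0..b, f x :=
  intervalIntegral.integral_mono_interval hc hcd hd (Eventually.of_forall hf) hfi

theorem IsWeighted.continuousOn (hU : G.IsWeighted N U) (p : ι) {i : ℕ} (hi : i ≤ 2) :
    ContinuousOn (U p i) (Ioo 0 (G.b p)) :=
  continuousOn_Ioo_of_hasDerivAt (hU.hasDerivAt p i hi)

theorem IsWeighted.nonneg (hU : G.IsWeighted N U) (p : ι) : 0 ≤ N :=
  (abs_nonneg _).trans
    (hU.bound_zero p (G.b p / 2) ⟨half_pos (G.b_pos p), half_lt_self (G.b_pos p)⟩)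

theorem IsWeighted.intervalIntegrable (hU : G.IsWeighted N U) (hn : IsMesh n h) (p : ι) {j : ℕ}
    (hj : j < n p) : IntervalIntegrable (U p 0) volume (G.node n p j) (G.node n p (j + 1)) :=
  intervalIntegrable_of_bound_Ioo (node_lt hn p j).le
    ((hU.continuousOn p (by norm_num)).mono (Ioo_node_subset hn p hj))
    (fun τ hτ => hU.bound_zero p τ (Ioo_node_subset hn p hj hτ))

/-- The deviation of `U p' 0` does not depend on `σ` and is at most `2 N`, so only the kernel is
differentiated. -/
theorem hasDerivAt_devIntegral_K (hU : G.IsWeighted N U) (hn : IsMesh n h) (p p' : ι) {i j : ℕ}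
    (hi : i ≤ 2) (hj : j < n p') {σ : ℝ} (hσ : σ ∈ Ioo 0 (G.b p)) :
    HasDerivAt
      (fun σ => devIntegral (G.K p p' i 0 σ) (U p' 0) (G.node n p' j) (G.node n p' (j + 1)))
      (devIntegral (G.K p p' (i + 1) 0 σ) (U p' 0) (G.node n p' j) (G.node n p' (j + 1))) σ := by
  have hsub := Ioo_node_subset (G := G) hn p' hj
  have hlt := node_lt (G := G) hn p' j
  refine hasDerivAt_integral_param (V := 2 * N) hlt.le
    (((hU.continuousOn p' (by norm_num)).mono hsub).sub continuousOn_const)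
    (fun τ hτ => ?_) (fun σ hσ τ hτ => G.hasDerivAt_left p p' i 0 σ hσ τ (hsub hτ))
    (fun σ hσ => (continuousOn_K_right p p' i 0 hσ).mono hsub)
    (fun σ hσ => (continuousOn_K_right p p' (i + 1) 0 hσ).mono hsub)
    (fun δ hδ => ?_) (fun δ hδ => ?_) hσ
  · refine abs_sub_mean_le hlt (hU.intervalIntegrable hn p' hj) (fun x hx y hy => ?_) hτ
    have h1 := hU.bound_zero p' x (hsub hx)
    have h2 := hU.bound_zero p' y (hsub hy)
    exact (abs_sub _ _).trans (by linarith)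
  · obtain ⟨M, hM⟩ := exists_K_bound (G := G) p p' (i := i) (l := 0) (by omega) (by omega) δ hδ
    exact ⟨M, fun σ hσ τ hτ => hM σ hσ τ (hsub hτ)⟩
  · obtain ⟨M, hM⟩ := exists_K_bound (G := G) p p' (i := i + 1) (l := 0) (by omega) (by omega) δ hδ
    exact ⟨M, fun σ hσ τ hτ => hM σ hσ τ (hsub hτ)⟩

variable [Fintype ι]

variable (G) in
/-- Contribution of the first elements to the operator `T (I - π)`. -/
noncomputable def cornerPart (n : ι → ℕ) (U : ι → ℕ → ℝ → ℝ) (p : ι) (σ : ℝ) : ℝ :=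
  ∑ p', devIntegral (G.K p p' 0 0 σ) (U p' 0) (G.node n p' 0) (G.node n p' 1)

variable (G) in
/-- Contribution of the elements away from the origin to the `i`th derivative of `T (I - π) U`. -/
noncomputable def regularPart (n : ι → ℕ) (U : ι → ℕ → ℝ → ℝ) (p : ι) (i : ℕ) (σ : ℝ) : ℝ :=
  ∑ p', ∑ j ∈ Finset.Ico 1 (n p'),
    devIntegral (G.K p p' i 0 σ) (U p' 0) (G.node n p' j) (G.node n p' (j + 1))

variable (G) in
/-- The leading term of the derivative of `T (I - π) U`. -/
noncomputable def leadingPart (n : ι → ℕ) (U : ι → ℕ → ℝ → ℝ) (p : ι) (σ : ℝ) : ℝ :=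
  ∑ p', ∑ j ∈ Finset.Ico 1 (n p'), (G.node n p' (j + 1) - G.node n p' j) ^ 2 / 12 *
    ∫ τ in (G.node n p' j)..(G.node n p' (j + 1)), G.K p p' 1 1 σ τ * U p' 1 τ

theorem hasDerivAt_regularPart (hU : G.IsWeighted N U) (hn : IsMesh n h) (p : ι) {i : ℕ}
    (hi : i ≤ 2) {σ : ℝ} (hσ : σ ∈ Ioo 0 (G.b p)) :
    HasDerivAt (G.regularPart n U p i) (G.regularPart n U p (i + 1) σ) σ := by
  unfold regularPart
  refine HasDerivAt.fun_sum fun p' _ => HasDerivAt.fun_sum fun j hj => ?_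
  exact hasDerivAt_devIntegral_K hU hn p p' hi (Finset.mem_Ico.1 hj).2 hσ

theorem continuousOn_cornerPart (hU : G.IsWeighted N U) (hn : IsMesh n h) (p : ι) :
    ContinuousOn (G.cornerPart n U p) (Ioo 0 (G.b p)) := by
  unfold cornerPart
  refine continuousOn_finsetSum _ fun p' _ => ?_
  exact continuousOn_Ioo_of_hasDerivAt fun σ hσ =>
    hasDerivAt_devIntegral_K hU hn p p' (i := 0) (by norm_num) (hn.one_le p') hσ

end GradedKernel

/-! ### Estimates of one application of `T (I - π)` -/

theorem abs_sum_le_of_forall {κ : Type} (s : Finset κ) {f c : κ → ℝ} {X : ℝ}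
    (h : ∀ p ∈ s, |f p| ≤ c p * X) : |∑ p ∈ s, f p| ≤ (∑ p ∈ s, c p) * X := by
  rw [Finset.sum_mul]
  exact (Finset.abs_sum_le_sum_abs _ _).trans (Finset.sum_le_sum h)

namespace GradedKernel

variable {ι : Type} {G : GradedKernel ι} {n : ι → ℕ} {h N A : ℝ} {U k : ι → ℕ → ℝ → ℝ}

theorem le_node (hn : IsMesh n h) (p : ι) {j : ℕ} (hj : 1 ≤ j) {β τ : ℝ} (hβ : β ≤ 0)
    (hτ : τ ∈ Ioo (G.node n p j) (G.node n p (j + 1))) : τ ^ β ≤ G.node n p j ^ β :=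
  Real.rpow_le_rpow_of_nonpos (node_pos hn p hj) hτ.1.le hβ

variable (G) in
/-- The exponent `a / 2 + 1 / q`. -/
noncomputable def upperExp (p : ι) : ℝ := G.a p / 2 + 1 / G.q p

variable (G) in
/-- The exponent `a / 2 - 1 / q`. -/
noncomputable def lowerExp (p : ι) : ℝ := G.a p / 2 - 1 / G.q p

theorem upperExp_pos (p : ι) : 0 < G.upperExp p := by
  unfold upperExp; linarith [a_pos (G := G) p, inv_q_pos (G := G) p]

theorem upperExp_le_one (p : ι) : G.upperExp p ≤ 1 := by
  unfold upperExp; linarith [G.a_le_one p, inv_q_lt (G := G) p]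

theorem lowerExp_pos (p : ι) : 0 < G.lowerExp p := by
  unfold lowerExp; linarith [a_pos (G := G) p, inv_q_lt (G := G) p]

theorem lowerExp_le_one (p : ι) : G.lowerExp p ≤ 1 := by
  unfold lowerExp; linarith [G.a_le_one p, inv_q_pos (G := G) p]

theorem IsWeighted.bound_node (hU : G.IsWeighted N U) (hn : IsMesh n h) (p : ι) {i j : ℕ}
    (hi : i ≤ 3) (hi1 : 1 ≤ i) (hj : j ∈ Finset.Ico 1 (n p)) :
    ∀ τ ∈ Ioo (G.node n p j) (G.node n p (j + 1)), |U p i τ| ≤ N * G.node n p j ^ (G.a p - i) := by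
  intro τ hτ
  rw [Finset.mem_Ico] at hj
  refine (hU.bound p i hi hi1 τ (Ioo_node_subset hn p hj.2 hτ)).trans ?_
  refine mul_le_mul_of_nonneg_left (le_node hn p hj.1 ?_ hτ) (hU.nonneg p)
  have : (1 : ℝ) ≤ i := by exact_mod_cast hi1
  linarith [G.a_le_one p]

theorem IsSection.bound_node (hk : G.IsSection A k) (hA : 0 ≤ A) (hn : IsMesh n h) (p : ι)
    {i j : ℕ} (hi : i ≤ 3) (hi1 : 1 ≤ i) (hj : j ∈ Finset.Ico 1 (n p)) :
    ∀ τ ∈ Ioo (G.node n p j) (G.node n p (j + 1)),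
      |k p i τ| ≤ A * G.node n p j ^ (-(1 + i) : ℝ) := by
  intro τ hτ
  rw [Finset.mem_Ico] at hj
  refine (hk.bound p i hi hi1 τ (Ioo_node_subset hn p hj.2 hτ)).trans ?_
  refine mul_le_mul_of_nonneg_left (le_node hn p hj.1 ?_ hτ) hA
  linarith [(i.cast_nonneg : (0:ℝ) ≤ i)]

theorem K_bound_node {θ : ι → ℝ} (hθ : θ = G.upperExp ∨ θ = G.lowerExp) (hn : IsMesh n h)
    (p p' : ι) {i l j : ℕ} (hi : i ≤ 3) (hi1 : 1 ≤ i) (hl : l ≤ 3) (hj : j ∈ Finset.Ico 1 (n p'))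
    {σ : ℝ} (hσ : σ ∈ Ioo 0 (G.b p)) :
    ∀ τ ∈ Ioo (G.node n p' j) (G.node n p' (j + 1)),
      |G.K p p' i l σ τ| ≤ G.B * (σ ^ (θ p - i) * G.node n p' j ^ (-(1 + l + θ p'))) := by
  intro τ hτ
  rw [Finset.mem_Ico] at hj
  refine (G.bound_mixed θ hθ p p' i hi hi1 l hl σ hσ τ (Ioo_node_subset hn p' hj.2 hτ)).trans ?_
  refine mul_le_mul_of_nonneg_left (mul_le_mul_of_nonneg_left (le_node hn p' hj.1 ?_ hτ)
    (Real.rpow_nonneg hσ.1.le _)) (B_nonneg p)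
  have : 0 ≤ θ p' := by
    rcases hθ with rfl | rfl
    · exact (upperExp_pos p').le
    · exact (lowerExp_pos p').le
  linarith [(l.cast_nonneg : (0:ℝ) ≤ l)]

theorem abs_sum_node_le {p : ι} {m : ℕ} {ξ C M : ℝ} {F : ℕ → ℝ} (hM : 0 ≤ M)
    (hC : ∑ j ∈ Finset.Ico 1 (n p),
      (G.node n p (j + 1) - G.node n p j) ^ (m + 1) * G.node n p j ^ ξ ≤ C * h ^ m)
    (hF : ∀ j ∈ Finset.Ico 1 (n p), |F j| ≤
      M * ((G.node n p (j + 1) - G.node n p j) ^ (m + 1) * G.node n p j ^ ξ)) :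
    |∑ j ∈ Finset.Ico 1 (n p), F j| ≤ M * (C * h ^ m) := by
  refine (Finset.abs_sum_le_sum_abs _ _).trans ((Finset.sum_le_sum hF).trans ?_)
  rw [← Finset.mul_sum]
  exact mul_le_mul_of_nonneg_left hC hM

section
variable [Fintype ι]

-- On a corner element `U` oscillates by at most `(N/a) t_1^a`, which is `O(N h⁶)` because `q a >
-- 6`. The kernel enters only through its `L¹` norm, so nothing is lost as `σ → 0`.
variable (G) in
theorem exists_cornerPart_le : ∃ C, 0 ≤ C ∧ ∀ (n : ι → ℕ) (h N : ℝ) (U : ι → ℕ → ℝ → ℝ),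
    IsMesh n h → G.IsWeighted N U → ∀ p, ∀ σ ∈ Ioo 0 (G.b p),
      |G.cornerPart n U p σ| ≤ C * (N * h ^ 6) := by
  refine ⟨∑ p, G.b p ^ G.a p / G.a p, Finset.sum_nonneg fun p _ => ?_, ?_⟩
  · have := G.b_pos p; have := a_pos (G := G) p; positivity
  intro n h N U hn hU p σ hσ
  unfold cornerPart
  refine abs_sum_le_of_forall _ fun p' _ => ?_
  have ha := a_pos (G := G) p'
  have hN := hU.nonneg p'
  have hn1 := hn.one_le p'
  have hlt := node_lt (G := G) hn p' 0
  have hsub := Ioo_node_subset (G := G) hn p' (j := 0) hn1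
  have hle := node_le (G := G) hn p' hn1
  have hosc : ∀ x ∈ Ioo (G.node n p' 0) (G.node n p' 1), ∀ y ∈ Ioo (G.node n p' 0) (G.node n p' 1),
      |U p' 0 x - U p' 0 y| ≤ N / G.a p' * G.node n p' 1 ^ G.a p' := by
    intro x hx y hy
    rw [node_zero] at hx hy hsub
    refine abs_sub_le_of_deriv_rpow ha (fun z hz => hU.hasDerivAt p' 0 (by norm_num) z (hsub hz))
      (fun z hz => ?_) hx hy
    simpa using hU.bound p' 1 (by norm_num) le_rfl z (hsub hz)
  have hKi := intervalIntegrable_K (G := G) p p' (i := 0) (l := 0) (by norm_num) (by norm_num) hσ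
    (node_nonneg p' 0) hlt.le hle
  have h1 := abs_devIntegral_le_of_osc hlt hKi (hU.intervalIntegrable hn p' hn1) hosc
  have h2 : ∫ x in (G.node n p' 0)..(G.node n p' 1), |G.K p p' 0 0 σ x| ≤ 1 :=
    (integral_mono_Ioo_of_nonneg (fun _ => abs_nonneg _)
      (intervalIntegrable_K (G := G) p p' (i := 0) (l := 0) (by norm_num) (by norm_num) hσ
        le_rfl (G.b_pos p').le le_rfl).abs (node_nonneg p' 0) hlt.le hle).trans
      (G.integral_abs_le p p' σ hσ)
  have h3 : G.node n p' 1 ^ G.a p' ≤ G.b p' ^ G.a p' * h ^ 6 :=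
    node_one_rpow_le hn p' (by have := G.six_lt p'; push_cast; linarith)
  have h4 : 0 ≤ N / G.a p' * G.node n p' 1 ^ G.a p' := by
    have := node_nonneg (G := G) (n := n) p' 1; positivity
  calc _ ≤ N / G.a p' * G.node n p' 1 ^ G.a p' * 1 :=
        h1.trans (mul_le_mul_of_nonneg_left h2 h4)
    _ ≤ N / G.a p' * (G.b p' ^ G.a p' * h ^ 6) := by rw [mul_one]; gcongr
    _ = _ := by ring

-- An element contributes at most a constant times `σ^(θ-i) h_τ³ t^(a-3-θ)`, `θ = upperExp`. Two
-- powers of `h` are gained since `a - θ - 2/q = a/2 - 3/q > 0`. The exponent of `σ` is then large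
-- enough for the second application of the operator.
variable (G) in
theorem exists_regularPart_le : ∃ C, 0 ≤ C ∧ ∀ (n : ι → ℕ) (h N : ℝ) (U : ι → ℕ → ℝ → ℝ),
    IsMesh n h → G.IsWeighted N U → ∀ p, ∀ i ≤ 3, 1 ≤ i → ∀ σ ∈ Ioo 0 (G.b p),
      |G.regularPart n U p i σ| ≤ C * (N * h ^ 2 * σ ^ (G.upperExp p - i)) := by
  have hex : ∀ p : ι, _ := fun p => exists_sum_node_le (G := G) p 2
    (ξ := G.a p - 3 - G.upperExp p) (by
      unfold upperExp; have := inv_q_lt (G := G) p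
      rw [show ((2 : ℕ) : ℝ) / G.q p = 2 * (1 / G.q p) by push_cast; ring]
      push_cast; linarith)
  choose c hc0 hc using hex
  refine ⟨∑ p, G.B * c p, Finset.sum_nonneg fun p _ => mul_nonneg (B_nonneg p) (hc0 p), ?_⟩
  intro n h N U hn hU p i hi hi1 σ hσ
  unfold regularPart
  refine abs_sum_le_of_forall _ fun p' _ => ?_
  have hσp := Real.rpow_nonneg hσ.1.le (G.upperExp p - i)
  have hN := hU.nonneg p'
  have hB := B_nonneg (G := G) p'
  refine (abs_sum_node_le (M := G.B * σ ^ (G.upperExp p - i) * N) (by positivity)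
    (hc p' n h hn) fun j hj => ?_).trans_eq (by ring)
  have hlt := node_lt (G := G) hn p' j
  have hj' := Finset.mem_Ico.1 hj
  have hsub := Ioo_node_subset (G := G) hn p' hj'.2
  refine (abs_devIntegral_le hlt
    (fun τ hτ => G.hasDerivAt_right p p' i 0 σ hσ τ (hsub hτ))
    (fun τ hτ => hU.hasDerivAt p' 0 (by norm_num) τ (hsub hτ))
    (K_bound_node (Or.inl rfl) hn p p' hi hi1 (by norm_num) hj hσ)
    (hU.bound_node hn p' (by norm_num) le_rfl hj)).trans_eq ?_
  have hx := node_pos (G := G) hn p' hj'.1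
  have e : G.node n p' j ^ (G.a p' - 3 - G.upperExp p') =
      G.node n p' j ^ (-(1 + ((0 + 1 : ℕ) : ℝ) + G.upperExp p')) *
        G.node n p' j ^ (G.a p' - ((0 + 1 : ℕ) : ℝ)) := by
    rw [← Real.rpow_add hx]; congr 1; push_cast; ring
  rw [e]; ring

-- The remainder of the expansion on an element is of size `h_τ⁵ t^(a-5-θ)`, and gaining four powers
-- of `h` needs `a - θ - 4/q > 0`. This calls for the smaller exponent `lowerExp`, for which the
-- left side is again `a/2 - 3/q`.
variable (G) in
theorem exists_regularPart_sub_le : ∃ C, 0 ≤ C ∧ ∀ (n : ι → ℕ) (h N : ℝ) (U : ι → ℕ → ℝ → ℝ),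
    IsMesh n h → G.IsWeighted N U → ∀ p, ∀ σ ∈ Ioo 0 (G.b p),
      |G.regularPart n U p 1 σ - G.leadingPart n U p σ|
        ≤ C * (N * h ^ 4 * σ ^ (G.lowerExp p - 1)) := by
  have hex : ∀ p : ι, _ := fun p => exists_sum_node_le (G := G) p 4
    (ξ := G.a p - 5 - G.lowerExp p) (by
      unfold lowerExp; have := inv_q_lt (G := G) p
      rw [show ((4 : ℕ) : ℝ) / G.q p = 4 * (1 / G.q p) by push_cast; ring]
      push_cast; linarith)
  choose c hc0 hc using hex
  refine ⟨∑ p, 12 * G.B * c p, Finset.sum_nonneg fun p _ =>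
    mul_nonneg (mul_nonneg (by norm_num) (B_nonneg p)) (hc0 p), ?_⟩
  intro n h N U hn hU p σ hσ
  unfold regularPart leadingPart
  simp_rw [← Finset.sum_sub_distrib]
  refine abs_sum_le_of_forall _ fun p' _ => ?_
  have hσp := Real.rpow_nonneg hσ.1.le (G.lowerExp p - 1)
  have hN := hU.nonneg p'
  have hB := B_nonneg (G := G) p'
  refine (abs_sum_node_le (M := 12 * G.B * σ ^ (G.lowerExp p - 1) * N) (by positivity)
    (hc p' n h hn) fun j hj => ?_).trans_eq (by ring)
  have hlt := node_lt (G := G) hn p' j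
  have hj' := Finset.mem_Ico.1 hj
  have hsub := Ioo_node_subset (G := G) hn p' hj'.2
  have hx := node_pos (G := G) hn p' hj'.1
  -- In each of the three products `l` derivatives fall on the kernel and `4 - l` on `U`, so the
  -- power of the node is always the same.
  have e : ∀ l : ℝ, G.node n p' j ^ (-(1 + l + G.lowerExp p')) *
        G.node n p' j ^ (G.a p' - (4 - l)) = G.node n p' j ^ (G.a p' - 5 - G.lowerExp p') := by
    intro l
    rw [← Real.rpow_add hx]; congr 1; ring
  have e1 := e 1
  have e2 := e 2
  have e3 := e 3
  norm_num only at e1 e2 e3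
  have kb := fun l (hl : l ≤ 3) => K_bound_node (G := G) (θ := G.lowerExp) (Or.inr rfl) hn p p'
    (i := 1) (l := l) (by norm_num) le_rfl hl hj hσ
  refine (abs_devIntegral_sub_le hlt
    (fun τ hτ => G.hasDerivAt_right p p' 1 0 σ hσ τ (hsub hτ))
    (fun τ hτ => G.hasDerivAt_right p p' 1 1 σ hσ τ (hsub hτ))
    (fun τ hτ => G.hasDerivAt_right p p' 1 2 σ hσ τ (hsub hτ))
    (fun τ hτ => hU.hasDerivAt p' 0 (by norm_num) τ (hsub hτ))
    (fun τ hτ => hU.hasDerivAt p' 1 (by norm_num) τ (hsub hτ))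
    (fun τ hτ => hU.hasDerivAt p' 2 (by norm_num) τ (hsub hτ))
    (kb 1 (by norm_num)) (kb 2 (by norm_num)) (kb 3 (by norm_num))
    (hU.bound_node hn p' (by norm_num) (by norm_num) hj)
    (hU.bound_node hn p' (by norm_num) (by norm_num) hj)
    (hU.bound_node hn p' (by norm_num) (by norm_num) hj)).trans_eq ?_
  norm_num only [Nat.cast_ofNat, Nat.cast_one, zero_add]
  linear_combination (4 * (G.node n p' (j + 1) - G.node n p' j) ^ 5 * G.B * N *
    σ ^ (G.lowerExp p - 1)) * (e1 + e2 + e3)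

variable (G) in
theorem exists_leadingPart_le : ∃ C, 0 ≤ C ∧ ∀ (n : ι → ℕ) (h N : ℝ) (U : ι → ℕ → ℝ → ℝ),
    IsMesh n h → G.IsWeighted N U → ∀ p, ∀ σ ∈ Ioo 0 (G.b p),
      |G.leadingPart n U p σ| ≤ C * (N * h ^ 2 * σ ^ (G.upperExp p - 1)) := by
  have hex : ∀ p : ι, _ := fun p => exists_sum_node_le (G := G) p 2
    (ξ := G.a p - 3 - G.upperExp p) (by
      unfold upperExp; have := inv_q_lt (G := G) p
      rw [show ((2 : ℕ) : ℝ) / G.q p = 2 * (1 / G.q p) by push_cast; ring]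
      push_cast; linarith)
  choose c hc0 hc using hex
  refine ⟨∑ p, G.B / 12 * c p, Finset.sum_nonneg fun p _ =>
    mul_nonneg (div_nonneg (B_nonneg p) (by norm_num)) (hc0 p), ?_⟩
  intro n h N U hn hU p σ hσ
  unfold leadingPart
  refine abs_sum_le_of_forall _ fun p' _ => ?_
  have hσp := Real.rpow_nonneg hσ.1.le (G.upperExp p - 1)
  have hN := hU.nonneg p'
  have hB := B_nonneg (G := G) p'
  refine (abs_sum_node_le (M := G.B / 12 * σ ^ (G.upperExp p - 1) * N) (by positivity)
    (hc p' n h hn) fun j hj => ?_).trans_eq (by ring)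
  have hlt := node_lt (G := G) hn p' j
  have hj' := Finset.mem_Ico.1 hj
  have hx := node_pos (G := G) hn p' hj'.1
  have e : G.node n p' j ^ (G.a p' - 3 - G.upperExp p') =
      G.node n p' j ^ (-(1 + ((1 : ℕ) : ℝ) + G.upperExp p')) *
        G.node n p' j ^ (G.a p' - ((1 : ℕ) : ℝ)) := by
    rw [← Real.rpow_add hx]; congr 1; push_cast; ring
  have kb := K_bound_node (G := G) (θ := G.upperExp) (Or.inl rfl) hn p p'
    (i := 1) (l := 1) (by norm_num) le_rfl (by norm_num) hj hσ
  have ub := hU.bound_node hn p' (i := 1) (by norm_num) (by norm_num) hj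
  have hI := abs_integral_le_of_bound_Ioo (f := fun τ => G.K p p' 1 1 σ τ * U p' 1 τ) hlt.le
    (fun τ hτ => by
      rw [abs_mul]
      exact mul_le_mul (kb τ hτ) (ub τ hτ) (abs_nonneg _) ((abs_nonneg _).trans (kb τ hτ)))
  rw [abs_mul, abs_of_nonneg (by positivity : (0:ℝ) ≤ (G.node n p' (j + 1) - G.node n p' j) ^ 2 / 12)]
  refine (mul_le_mul_of_nonneg_left hI (by positivity)).trans_eq ?_
  rw [e]; push_cast; ring

end

end GradedKernel

/-! ### The expansion of two applications of `T (I - π)` -/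

namespace GradedKernel

variable {ι : Type} {G : GradedKernel ι} {n : ι → ℕ} {h N A : ℝ} {U k : ι → ℕ → ℝ → ℝ}

theorem IsSection.intervalIntegrable (hk : G.IsSection A k) (hn : IsMesh n h) (p : ι) {j : ℕ}
    (hj : j < n p) : IntervalIntegrable (k p 0) volume (G.node n p j) (G.node n p (j + 1)) := by
  refine (hk.integrable p).mono_set ?_
  rw [uIcc_of_le (node_lt hn p j).le, uIcc_of_le (G.b_pos p).le]
  exact Icc_subset_Icc (node_nonneg p j) (node_le hn p hj)

theorem IsSection.continuousOn (hk : G.IsSection A k) (p : ι) {i : ℕ} (hi : i ≤ 2) :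
    ContinuousOn (k p i) (Ioo 0 (G.b p)) :=
  continuousOn_Ioo_of_hasDerivAt (hk.hasDerivAt p i hi)

theorem IsSection.sum_integral_le (hk : G.IsSection A k) (hn : IsMesh n h) (p : ι) :
    ∑ j ∈ Finset.range (n p), ∫ τ in (G.node n p j)..(G.node n p (j + 1)), |k p 0 τ| ≤ 1 := by
  rw [intervalIntegral.sum_integral_adjacent_intervals
    fun j hj => (hk.intervalIntegrable hn p hj).abs, node_zero]
  have : G.node n p (n p) = G.b p := gradedNode_self _ _ (hn.one_le p)
  rw [this]
  exact hk.integral_abs_le p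

/-- The mean deviation integrals against a bounded function. -/
theorem abs_sum_devIntegral_le_of_bound (hk : G.IsSection A k) (hn : IsMesh n h) (p : ι)
    {g : ℝ → ℝ} {M : ℝ} (hg : ContinuousOn g (Ioo 0 (G.b p)))
    (hM : ∀ σ ∈ Ioo 0 (G.b p), |g σ| ≤ M) (hM0 : 0 ≤ M) :
    |∑ j ∈ Finset.range (n p), devIntegral (k p 0) g (G.node n p j) (G.node n p (j + 1))|
      ≤ 2 * M := by
  calc _ ≤ ∑ j ∈ Finset.range (n p),
        2 * M * ∫ τ in (G.node n p j)..(G.node n p (j + 1)), |k p 0 τ| := by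
        refine (Finset.abs_sum_le_sum_abs _ _).trans (Finset.sum_le_sum fun j hj => ?_)
        rw [Finset.mem_range] at hj
        have hsub := Ioo_node_subset (G := G) hn p hj
        have hlt := node_lt (G := G) hn p j
        refine abs_devIntegral_le_of_osc hlt (hk.intervalIntegrable hn p hj)
          (intervalIntegrable_of_bound_Ioo hlt.le (hg.mono hsub) fun x hx => hM x (hsub hx))
          fun x hx y hy => ?_
        exact (abs_sub _ _).trans (by linarith [hM x (hsub hx), hM y (hsub hy)])
    _ ≤ 2 * M * 1 := by
        rw [← Finset.mul_sum]
        exact mul_le_mul_of_nonneg_left (hk.sum_integral_le hn p) (by positivity)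
    _ = 2 * M := mul_one _

/-- Weighted sum of integrals against a function with a power singularity. -/
theorem exists_sum_integral_le (p : ι) {A θ : ℝ} (hA : 0 ≤ A) (hθ : 2 / G.q p < θ) (hθ1 : θ ≤ 1) :
    ∃ C, 0 ≤ C ∧ ∀ (n : ι → ℕ) (h M : ℝ) (k : ι → ℕ → ℝ → ℝ) (F : ℝ → ℝ),
      IsMesh n h → G.IsSection A k → 0 ≤ M →
      (∀ σ ∈ Ioo 0 (G.b p), |F σ| ≤ M * σ ^ (θ - 1)) →
      |∑ j ∈ Finset.Ico 1 (n p), (G.node n p (j + 1) - G.node n p j) ^ 2 / 12 *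
            ∫ σ in (G.node n p j)..(G.node n p (j + 1)), k p 1 σ * F σ| ≤ C * (M * h ^ 2) := by
  obtain ⟨c, hc0, hc⟩ := exists_sum_node_le (G := G) p 2 (ξ := θ - 3) (by
      push_cast; linarith)
  refine ⟨A * c, by positivity, fun n h M k F hn hk hM hF => ?_⟩
  refine (abs_sum_node_le (M := A * M) (by positivity)
    (hc n h hn) fun j hj => ?_).trans_eq (by ring)
  have hlt := node_lt (G := G) hn p j
  have hj' := Finset.mem_Ico.1 hj
  have hsub := Ioo_node_subset (G := G) hn p hj'.2
  have hx := node_pos (G := G) hn p hj'.1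
  have kb := hk.bound_node hA hn p (i := 1) (by norm_num) le_rfl hj
  have hI := abs_integral_le_of_bound_Ioo (f := fun σ => k p 1 σ * F σ) hlt.le
    (M := A * G.node n p j ^ (-(1 + ((1 : ℕ) : ℝ))) * (M * G.node n p j ^ (θ - 1)))
    (fun σ hσ => by
      rw [abs_mul]
      refine mul_le_mul (kb σ hσ) ((hF σ (hsub hσ)).trans ?_) (abs_nonneg _)
        ((abs_nonneg _).trans (kb σ hσ))
      exact mul_le_mul_of_nonneg_left (le_node hn p hj'.1 (by linarith) hσ) hM)
  rw [abs_mul, abs_of_nonneg (by positivity : (0:ℝ) ≤ (G.node n p (j + 1) - G.node n p j) ^ 2 / 12)]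
  refine (mul_le_mul_of_nonneg_left hI (by positivity)).trans ?_
  have e : G.node n p j ^ (-(1 + ((1 : ℕ) : ℝ))) * G.node n p j ^ (θ - 1)
      = G.node n p j ^ (θ - 3) := by
    rw [← Real.rpow_add hx]; congr 1; push_cast; ring
  have hw := sub_pos.2 hlt
  calc _ = A * M * (G.node n p (j + 1) - G.node n p j) ^ 3 / 12 *
        (G.node n p j ^ (-(1 + ((1 : ℕ) : ℝ))) * G.node n p j ^ (θ - 1)) := by ring
    _ = (1 / 12) * (A * M * ((G.node n p (j + 1) - G.node n p j) ^ 3 *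
          G.node n p j ^ (θ - 3))) := by rw [e]; ring
    _ ≤ 1 * (A * M * ((G.node n p (j + 1) - G.node n p j) ^ 3 *
          G.node n p j ^ (θ - 3))) := by gcongr; norm_num
    _ = _ := by rw [one_mul]

theorem two_div_q_lt_upperExp (p : ι) : 2 / G.q p < G.upperExp p := by
  unfold upperExp
  rw [show 2 / G.q p = 2 * (1 / G.q p) by ring]
  linarith [inv_q_lt (G := G) p, inv_q_pos (G := G) p]

theorem two_div_q_lt_lowerExp (p : ι) : 2 / G.q p < G.lowerExp p := by
  unfold lowerExp
  rw [show 2 / G.q p = 2 * (1 / G.q p) by ring]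
  linarith [inv_q_lt (G := G) p, inv_q_pos (G := G) p]

theorem intervalIntegrable_section_mul (hk : G.IsSection A k) (hA : 0 ≤ A) (hn : IsMesh n h) (p : ι)
    {F : ℝ → ℝ} {M θ : ℝ} (hM : 0 ≤ M) (hθ1 : θ ≤ 1) (hFc : ContinuousOn F (Ioo 0 (G.b p)))
    (hF : ∀ σ ∈ Ioo 0 (G.b p), |F σ| ≤ M * σ ^ (θ - 1)) {j : ℕ} (hj : j ∈ Finset.Ico 1 (n p)) :
    IntervalIntegrable (fun σ => k p 1 σ * F σ) volume (G.node n p j) (G.node n p (j + 1)) := by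
  have hj' := Finset.mem_Ico.1 hj
  have hsub := Ioo_node_subset (G := G) hn p hj'.2
  refine intervalIntegrable_mul_of_bound (node_lt hn p j).le
    (intervalIntegrable_of_bound_Ioo (node_lt hn p j).le
      ((hk.continuousOn p (by norm_num)).mono hsub)
      (hk.bound_node hA hn p (by norm_num) le_rfl hj)) (hFc.mono hsub)
      (M := M * G.node n p j ^ (θ - 1)) fun σ hσ => (hF σ (hsub hσ)).trans ?_
  exact mul_le_mul_of_nonneg_left (le_node hn p hj'.1 (by linarith) hσ) hM

theorem continuousOn_leadingIntegral (hU : G.IsWeighted N U) (hn : IsMesh n h) (p p' : ι) {j : ℕ}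
    (hj : j ∈ Finset.Ico 1 (n p')) : ContinuousOn (fun σ =>
      ∫ τ in (G.node n p' j)..(G.node n p' (j + 1)), G.K p p' 1 1 σ τ * U p' 1 τ)
      (Ioo 0 (G.b p)) := by
  have hj' := Finset.mem_Ico.1 hj
  have hsub := Ioo_node_subset (G := G) hn p' hj'.2
  refine continuousOn_Ioo_of_hasDerivAt fun σ hσ => hasDerivAt_integral_param
    (K := G.K p p' 1 1) (K1 := G.K p p' 2 1) (node_lt hn p' j).le
    ((hU.continuousOn p' (i := 1) (by norm_num)).mono hsub)
    (hU.bound_node hn p' (by norm_num) le_rfl hj)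
    (fun σ hσ τ hτ => G.hasDerivAt_left p p' 1 1 σ hσ τ (hsub hτ))
    (fun σ hσ => (continuousOn_K_right p p' 1 1 hσ).mono hsub)
    (fun σ hσ => (continuousOn_K_right p p' 2 1 hσ).mono hsub)
    (fun δ hδ => ?_) (fun δ hδ => ?_) hσ
  · obtain ⟨M, hM⟩ := exists_K_bound (G := G) p p' (i := 1) (l := 1) (by omega) (by omega) δ hδ
    exact ⟨M, fun σ hσ τ hτ => hM σ hσ τ (hsub hτ)⟩
  · obtain ⟨M, hM⟩ := exists_K_bound (G := G) p p' (i := 2) (l := 1) (by omega) (by omega) δ hδ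
    exact ⟨M, fun σ hσ τ hτ => hM σ hσ τ (hsub hτ)⟩

variable [Fintype ι]

variable (G) in
/-- The operator `T (I - π)` applied twice, in local coordinates. -/
noncomputable def total (n : ι → ℕ) (U k : ι → ℕ → ℝ → ℝ) : ℝ :=
  ∑ p, ∑ j ∈ Finset.range (n p),
    devIntegral (k p 0) (fun σ => G.cornerPart n U p σ + G.regularPart n U p 0 σ)
      (G.node n p j) (G.node n p (j + 1))

variable (G) in
/-- The leading term of `total`. -/
noncomputable def leading (n : ι → ℕ) (U k : ι → ℕ → ℝ → ℝ) : ℝ :=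
  ∑ p, ∑ j ∈ Finset.Ico 1 (n p), (G.node n p (j + 1) - G.node n p j) ^ 2 / 12 *
    ∫ σ in (G.node n p j)..(G.node n p (j + 1)), k p 1 σ * G.leadingPart n U p σ

theorem continuousOn_leadingPart (hU : G.IsWeighted N U) (hn : IsMesh n h) (p : ι) :
    ContinuousOn (G.leadingPart n U p) (Ioo 0 (G.b p)) := by
  unfold leadingPart
  exact continuousOn_finsetSum _ fun p' _ => continuousOn_finsetSum _ fun j hj =>
    continuousOn_const.mul (continuousOn_leadingIntegral hU hn p p' hj)

-- On the first element `regularPart` oscillates by at most a constant times `N h² t_1^θ`, `θ =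
-- upperExp`, and `q θ = q a / 2 + 1 > 4` yields the other `h⁴`. The non-uniform bound `M` only
-- guarantees integrability where the sum with `cornerPart` is split.
variable (G) in
theorem exists_devIntegral_regularPart_zero_le (p : ι) :
    ∃ C, 0 ≤ C ∧ ∀ (n : ι → ℕ) (h N A : ℝ) (U k : ι → ℕ → ℝ → ℝ),
      IsMesh n h → G.IsWeighted N U → G.IsSection A k →
      |devIntegral (k p 0) (G.regularPart n U p 0) (G.node n p 0) (G.node n p 1)|
        ≤ C * (N * h ^ 6) ∧ ∃ M, ∀ σ ∈ Ioo 0 (G.b p), |G.regularPart n U p 0 σ| ≤ M := by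
  obtain ⟨C, hC0, hC⟩ := exists_regularPart_le G
  have he := upperExp_pos (G := G) p
  have hb := G.b_pos p
  refine ⟨C / G.upperExp p * G.b p ^ G.upperExp p, by positivity, ?_⟩
  intro n h N A U k hn hU hk
  have hlt := node_lt (G := G) hn p 0
  have hn1 := hn.one_le p
  have hle := node_le (G := G) hn p hn1
  have hN := hU.nonneg p
  have hh := hn.pos p
  have hder : ∀ x ∈ Ioo 0 (G.b p),
      HasDerivAt (G.regularPart n U p 0) (G.regularPart n U p 1 x) x :=
    fun x hx => hasDerivAt_regularPart hU hn p (by norm_num) hx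
  have hbd : ∀ x ∈ Ioo 0 (G.b p),
      |G.regularPart n U p 1 x| ≤ C * N * h ^ 2 * x ^ (G.upperExp p - 1) := fun x hx => by
    have := hC n h N U hn hU p 1 (by norm_num) le_rfl x hx
    push_cast at this
    linarith
  have hm : G.b p / 2 ∈ Ioo 0 (G.b p) := ⟨half_pos (G.b_pos p), half_lt_self (G.b_pos p)⟩
  have hbdd : ∀ σ ∈ Ioo 0 (G.b p), |G.regularPart n U p 0 σ|
      ≤ C * N * h ^ 2 / G.upperExp p * G.b p ^ G.upperExp p
        + |G.regularPart n U p 0 (G.b p / 2)| := fun σ hσ => by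
    have := abs_sub_le_of_deriv_rpow he hder hbd hσ hm
    linarith [abs_sub_abs_le_abs_sub (G.regularPart n U p 0 σ) (G.regularPart n U p 0 (G.b p / 2))]
  refine ⟨?_, _, hbdd⟩
  have hsub := Ioo_node_subset (G := G) hn p (j := 0) hn1
  have hosc : ∀ x ∈ Ioo (G.node n p 0) (G.node n p 1), ∀ y ∈ Ioo (G.node n p 0) (G.node n p 1),
      |G.regularPart n U p 0 x - G.regularPart n U p 0 y|
        ≤ C * N * h ^ 2 / G.upperExp p * G.node n p 1 ^ G.upperExp p := by
    intro x hx y hy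
    rw [node_zero] at hx hy hsub
    exact abs_sub_le_of_deriv_rpow he (fun z hz => hder z (hsub hz))
      (fun z hz => hbd z (hsub hz)) hx hy
  have hg : IntervalIntegrable (G.regularPart n U p 0) volume (G.node n p 0) (G.node n p 1) :=
    intervalIntegrable_of_bound_Ioo hlt.le
      ((continuousOn_Ioo_of_hasDerivAt hder).mono hsub) (fun x hx => hbdd x (hsub hx))
  have h1 := abs_devIntegral_le_of_osc hlt (hk.intervalIntegrable hn p hn1) hg hosc
  have h2 : ∫ x in (G.node n p 0)..(G.node n p 1), |k p 0 x| ≤ 1 :=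
    (integral_mono_Ioo_of_nonneg (fun _ => abs_nonneg _) (hk.integrable p).abs
      (node_nonneg p 0) hlt.le hle).trans (hk.integral_abs_le p)
  have h3 : G.node n p 1 ^ G.upperExp p ≤ G.b p ^ G.upperExp p * h ^ 4 := by
    refine node_one_rpow_le hn p ?_
    unfold upperExp
    have := G.six_lt p
    have : G.q p * (1 / G.q p) = 1 := mul_one_div_cancel (G.q_pos p).ne'
    rw [mul_add, this]; push_cast; linarith
  have h4 : 0 ≤ C * N * h ^ 2 / G.upperExp p * G.node n p 1 ^ G.upperExp p := by
    have := node_nonneg (G := G) (n := n) p 1; positivity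
  calc _ ≤ C * N * h ^ 2 / G.upperExp p * G.node n p 1 ^ G.upperExp p * 1 :=
        h1.trans (mul_le_mul_of_nonneg_left h2 h4)
    _ ≤ C * N * h ^ 2 / G.upperExp p * (G.b p ^ G.upperExp p * h ^ 4) := by
        rw [mul_one]; gcongr
    _ = _ := by ring

-- The expansion on an element once more, with the bounds `h² σ^(θ-i)` of `regularPart` in the role
-- of those of `U`. Four further powers of `h` need `θ - 4/q > 0`, which for `θ = upperExp` is again
-- `a/2 - 3/q > 0`.
variable (G) in
theorem exists_devIntegral_regularPart_sub_le (p : ι) {A : ℝ} (hA : 0 ≤ A) :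
    ∃ C, 0 ≤ C ∧ ∀ (n : ι → ℕ) (h N : ℝ) (U k : ι → ℕ → ℝ → ℝ),
      IsMesh n h → G.IsWeighted N U → G.IsSection A k →
      |∑ j ∈ Finset.Ico 1 (n p),
        (devIntegral (k p 0) (G.regularPart n U p 0) (G.node n p j) (G.node n p (j + 1)) -
          (G.node n p (j + 1) - G.node n p j) ^ 2 / 12 *
            ∫ σ in (G.node n p j)..(G.node n p (j + 1)), k p 1 σ * G.regularPart n U p 1 σ)|
        ≤ C * (N * h ^ 6) := by
  obtain ⟨C, hC0, hC⟩ := exists_regularPart_le G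
  obtain ⟨c, hc0, hc⟩ := exists_sum_node_le (G := G) p 4 (ξ := G.upperExp p - 5) (by
      unfold upperExp; have := inv_q_lt (G := G) p
      rw [show ((4 : ℕ) : ℝ) / G.q p = 4 * (1 / G.q p) by push_cast; ring]
      push_cast; linarith)
  refine ⟨12 * A * C * c, by positivity, fun n h N U k hn hU hk => ?_⟩
  have hN := hU.nonneg p
  have hh := hn.pos p
  refine (abs_sum_node_le (M := 12 * A * C * N * h ^ 2) (by positivity)
    (hc n h hn) fun j hj => ?_).trans_eq (by ring)
  have hlt := node_lt (G := G) hn p j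
  have hj' := Finset.mem_Ico.1 hj
  have hsub := Ioo_node_subset (G := G) hn p hj'.2
  have hx := node_pos (G := G) hn p hj'.1
  have rb : ∀ i ≤ 3, 1 ≤ i → ∀ σ ∈ Ioo (G.node n p j) (G.node n p (j + 1)),
      |G.regularPart n U p i σ| ≤ C * (N * h ^ 2 * G.node n p j ^ (G.upperExp p - i)) := by
    intro i hi hi1 σ hσ
    refine (hC n h N U hn hU p i hi hi1 σ (hsub hσ)).trans ?_
    have : σ ^ (G.upperExp p - i) ≤ G.node n p j ^ (G.upperExp p - i) := by
      refine le_node hn p hj'.1 ?_ hσ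
      have : (1 : ℝ) ≤ i := by exact_mod_cast hi1
      linarith [upperExp_le_one (G := G) p]
    gcongr
  have e : ∀ l : ℝ, G.node n p j ^ (-(1 + l)) *
        G.node n p j ^ (G.upperExp p - (4 - l)) = G.node n p j ^ (G.upperExp p - 5) := by
    intro l
    rw [← Real.rpow_add hx]; congr 1; ring
  have e1 := e 1
  have e2 := e 2
  have e3 := e 3
  norm_num only at e1 e2 e3
  have kb := fun i (hi : i ≤ 3) (hi1 : 1 ≤ i) => hk.bound_node hA hn p hi hi1 hj
  refine (abs_devIntegral_sub_le hlt
    (fun τ hτ => hk.hasDerivAt p 0 (by norm_num) τ (hsub hτ))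
    (fun τ hτ => hk.hasDerivAt p 1 (by norm_num) τ (hsub hτ))
    (fun τ hτ => hk.hasDerivAt p 2 (by norm_num) τ (hsub hτ))
    (fun τ hτ => hasDerivAt_regularPart hU hn p (by norm_num) (hsub hτ))
    (fun τ hτ => hasDerivAt_regularPart hU hn p (by norm_num) (hsub hτ))
    (fun τ hτ => hasDerivAt_regularPart hU hn p (by norm_num) (hsub hτ))
    (kb 1 (by norm_num) (by norm_num)) (kb 2 (by norm_num) (by norm_num))
    (kb 3 (by norm_num) (by norm_num))
    (rb 1 (by norm_num) (by norm_num)) (rb 2 (by norm_num) (by norm_num))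
    (rb 3 (by norm_num) (by norm_num))).trans_eq ?_
  norm_num only [Nat.cast_ofNat, Nat.cast_one, zero_add]
  linear_combination (4 * (G.node n p (j + 1) - G.node n p j) ^ 5 * A * C * N * h ^ 2) *
    (e1 + e2 + e3)

variable (G) in
/-- The expansion of `T (I - π) T (I - π)` in local coordinates. -/
theorem exists_total_sub_leading_le {A : ℝ} (hA : 0 ≤ A) :
    ∃ C, 0 ≤ C ∧ ∀ (n : ι → ℕ) (h N : ℝ) (U k : ι → ℕ → ℝ → ℝ),
      IsMesh n h → G.IsWeighted N U → G.IsSection A k →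
      |G.total n U k - G.leading n U k| ≤ C * (N * h ^ 6) ∧
      |G.leading n U k| ≤ C * (N * h ^ 4) := by
  obtain ⟨C₀, hC₀0, hC₀⟩ := exists_cornerPart_le G
  obtain ⟨C₁, hC₁0, hC₁⟩ := exists_regularPart_le G
  obtain ⟨C₂, hC₂0, hC₂⟩ := exists_regularPart_sub_le G
  obtain ⟨C₃, hC₃0, hC₃⟩ := exists_leadingPart_le G
  choose D₀ hD₀0 hD₀ using exists_devIntegral_regularPart_zero_le G
  choose D₁ hD₁0 hD₁ using fun p => exists_devIntegral_regularPart_sub_le G p hA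
  choose D₂ hD₂0 hD₂ using fun p => exists_sum_integral_le (G := G) p hA
    (two_div_q_lt_lowerExp p) (lowerExp_le_one p)
  choose D₃ hD₃0 hD₃ using fun p => exists_sum_integral_le (G := G) p hA
    (two_div_q_lt_upperExp p) (upperExp_le_one p)
  have hS1 : 0 ≤ ∑ p, (2 * C₀ + D₀ p + D₁ p + D₂ p * C₂) :=
    Finset.sum_nonneg fun p _ => by
      have := hD₀0 p; have := hD₁0 p; have := hD₂0 p; positivity
  have hS2 : 0 ≤ ∑ p, D₃ p * C₃ :=
    Finset.sum_nonneg fun p _ => by have := hD₃0 p; positivity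
  -- In this order: `cornerPart` (the `2` is the cost of `I - π` on a bounded function),
  -- `regularPart` on the corner elements, its expansion on the others, the replacement of its
  -- derivative by `leadingPart`. The last sum bounds the leading term.
  refine ⟨(∑ p, (2 * C₀ + D₀ p + D₁ p + D₂ p * C₂)) + ∑ p, D₃ p * C₃, by positivity, ?_⟩
  intro n h N U k hn hU hk
  -- `0 ≤ N` can be read off only at some index; without indices all sums are empty.
  rcases isEmpty_or_nonempty ι with hι | ⟨⟨p₀⟩⟩
  · simp [total, leading]
  have hN := hU.nonneg p₀
  have hh := hn.pos p₀
  have hL : |G.leading n U k| ≤ (∑ p, D₃ p * C₃) * (N * h ^ 4) := by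
    unfold leading
    refine abs_sum_le_of_forall _ fun p _ => ?_
    refine (hD₃ p n h (C₃ * (N * h ^ 2)) k (G.leadingPart n U p) hn hk (by positivity)
      fun σ hσ => ?_).trans_eq (by ring)
    exact (hC₃ n h N U hn hU p σ hσ).trans_eq (by ring)
  have hR : |G.total n U k - G.leading n U k|
      ≤ (∑ p, (2 * C₀ + D₀ p + D₁ p + D₂ p * C₂)) * (N * h ^ 6) := by
    unfold total leading
    rw [← Finset.sum_sub_distrib]
    refine abs_sum_le_of_forall _ fun p _ => ?_
    have hn1 := hn.one_le p
    obtain ⟨hz, M, hM⟩ := hD₀ p n h N A U k hn hU hk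
    have hcc := continuousOn_cornerPart hU hn p
    have hcb := hC₀ n h N U hn hU p
    have hrc : ∀ i ≤ 2, ContinuousOn (G.regularPart n U p i) (Ioo 0 (G.b p)) := fun i hi =>
      continuousOn_Ioo_of_hasDerivAt fun σ hσ => hasDerivAt_regularPart hU hn p hi hσ
    have hlc := continuousOn_leadingPart hU hn p
    have s1 : ∀ j ∈ Finset.range (n p),
        devIntegral (k p 0) (fun σ => G.cornerPart n U p σ + G.regularPart n U p 0 σ)
          (G.node n p j) (G.node n p (j + 1)) =
        devIntegral (k p 0) (G.cornerPart n U p) (G.node n p j) (G.node n p (j + 1)) +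
        devIntegral (k p 0) (G.regularPart n U p 0) (G.node n p j) (G.node n p (j + 1)) := by
      intro j hj
      rw [Finset.mem_range] at hj
      have hsub := Ioo_node_subset (G := G) hn p hj
      exact devIntegral_add_right (node_lt hn p j).le (hk.intervalIntegrable hn p hj)
        (hcc.mono hsub) (fun σ hσ => hcb σ (hsub hσ)) ((hrc 0 (by norm_num)).mono hsub)
        (fun σ hσ => hM σ (hsub hσ))
    -- The element expansion produces the derivative of `regularPart`; its difference from
    -- `leadingPart` is split off here and is estimated by `hD₂`.
    have s2 : ∀ j ∈ Finset.Ico 1 (n p),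
        (∫ σ in (G.node n p j)..(G.node n p (j + 1)), k p 1 σ * G.leadingPart n U p σ) =
        (∫ σ in (G.node n p j)..(G.node n p (j + 1)), k p 1 σ * G.regularPart n U p 1 σ) -
        ∫ σ in (G.node n p j)..(G.node n p (j + 1)),
          k p 1 σ * (G.regularPart n U p 1 σ - G.leadingPart n U p σ) := by
      intro j hj
      have j1 := intervalIntegrable_section_mul hk hA hn p (M := C₁ * (N * h ^ 2))
        (θ := G.upperExp p) (by positivity) (upperExp_le_one p) (hrc 1 (by norm_num))
        (fun σ hσ => by
          have := hC₁ n h N U hn hU p 1 (by norm_num) le_rfl σ hσ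
          push_cast at this; linarith) hj
      have j2 := intervalIntegrable_section_mul hk hA hn p (M := C₃ * (N * h ^ 2))
        (θ := G.upperExp p) (by positivity) (upperExp_le_one p) hlc
        (fun σ hσ => by
          have := hC₃ n h N U hn hU p σ hσ
          linarith) hj
      simp_rw [mul_sub]
      rw [intervalIntegral.integral_sub j1 j2]
      ring
    have s3 : ∑ j ∈ Finset.Ico 1 (n p), (G.node n p (j + 1) - G.node n p j) ^ 2 / 12 *
        (∫ σ in (G.node n p j)..(G.node n p (j + 1)), k p 1 σ * G.leadingPart n U p σ) =
        (∑ j ∈ Finset.Ico 1 (n p), (G.node n p (j + 1) - G.node n p j) ^ 2 / 12 *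
        ∫ σ in (G.node n p j)..(G.node n p (j + 1)), k p 1 σ * G.regularPart n U p 1 σ) -
        ∑ j ∈ Finset.Ico 1 (n p), (G.node n p (j + 1) - G.node n p j) ^ 2 / 12 *
        ∫ σ in (G.node n p j)..(G.node n p (j + 1)),
          k p 1 σ * (G.regularPart n U p 1 σ - G.leadingPart n U p σ) := by
      rw [← Finset.sum_sub_distrib]
      exact Finset.sum_congr rfl fun j hj => by rw [s2 j hj, mul_sub]
    have s4 := Finset.sum_eq_sum_Ico_succ_bot (f := fun j =>
        devIntegral (k p 0) (G.regularPart n U p 0) (G.node n p j) (G.node n p (j + 1))) hn1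
    rw [← Finset.range_eq_Ico] at s4
    simp only [zero_add] at s4
    rw [Finset.sum_congr rfl s1, Finset.sum_add_distrib, s3, s4]
    have t1 := abs_sum_devIntegral_le_of_bound hk hn p hcc hcb (by positivity)
    have t2 := hD₁ p n h N U k hn hU hk
    have t3 := hD₂ p n h (C₂ * (N * h ^ 4)) k
      (fun σ => G.regularPart n U p 1 σ - G.leadingPart n U p σ) hn hk (by positivity)
      (fun σ hσ => (hC₂ n h N U hn hU p σ hσ).trans_eq (by ring))
    rw [Finset.sum_sub_distrib] at t2
    rw [abs_le] at t1 t2 t3 hz ⊢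
    constructor <;>
      linarith [t1.1, t1.2, t2.1, t2.2, t3.1, t3.2, hz.1, hz.2]
  refine ⟨hR.trans ?_, hL.trans ?_⟩
  · gcongr; linarith
  · gcongr; linarith

end GradedKernel

/-! ### Geometry of the polygon: pieces, edges and their distances -/

/-- The point of the complex plane with the same coordinates. -/
noncomputable def toComplex (v : Plane) : ℂ := ⟨v 0, v 1⟩

theorem toComplex_add (v w : Plane) : toComplex (v + w) = toComplex v + toComplex w := by
  apply Complex.ext <;> simp [toComplex]

theorem toComplex_smul (c : ℝ) (v : Plane) : toComplex (c • v) = c * toComplex v := by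
  apply Complex.ext <;> simp [toComplex]

theorem norm_toComplex (v : Plane) : ‖toComplex v‖ = ‖v‖ := by
  rw [EuclideanSpace.norm_eq, Complex.norm_def, Complex.normSq_apply]
  simp [toComplex, Fin.sum_univ_two, sq]

theorem toComplex_injective : Function.Injective toComplex := fun v w h => by
  have h0 := congrArg Complex.re h
  have h1 := congrArg Complex.im h
  ext i; fin_cases i
  · exact h0
  · exact h1

namespace PolygonBoundary

variable (P : PolygonBoundary)

theorem r_pos : 0 < P.r := lt_of_lt_of_le (by norm_num) P.three_le_r

theorem mem_idx {j : ℕ} : j ∈ P.idx ↔ 1 ≤ j ∧ j ≤ P.r := Finset.mem_Icc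

variable {P}

theorem γ_pred_lt_s {j : ℕ} (hj : j ∈ P.idx) : P.γ (j - 1) < P.s j := by
  rw [mem_idx] at hj
  have := P.γ_lt_s (j - 1) (by omega)
  rwa [Nat.sub_add_cancel hj.1] at this

theorem s_lt_γ_self {j : ℕ} (hj : j ∈ P.idx) : P.s j < P.γ j := by
  rw [mem_idx] at hj
  rcases hj.2.lt_or_eq with h | h
  · exact P.s_lt_γ j h
  · rw [h, P.γ_last]
    linarith [P.s_lt_γ 0 P.r_pos]

theorem γ_pred_lt {j : ℕ} (hj : j ∈ P.idx) : P.γ (j - 1) < P.γ j :=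
  (γ_pred_lt_s hj).trans (s_lt_γ_self hj)

theorem γ_lt_γ {i j : ℕ} (hij : i < j) (hj : j ≤ P.r) : P.γ i < P.γ j := by
  induction j with
  | zero => omega
  | succ j ih =>
    have h1 : P.γ j < P.γ (j + 1) := by
      simpa using γ_pred_lt (P := P) (j := j + 1) ((mem_idx P).2 ⟨by omega, hj⟩)
    rcases Nat.lt_succ_iff_lt_or_eq.1 hij with h | h
    · exact (ih h (by omega)).trans h1
    · rw [h]; exact h1

theorem γ_le_γ {i j : ℕ} (hij : i ≤ j) (hj : j ≤ P.r) : P.γ i ≤ P.γ j := by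
  rcases hij.lt_or_eq with h | h
  · exact (γ_lt_γ h hj).le
  · rw [h]

variable (P) in
/-- The unit tangent of the `j`th edge. -/
noncomputable def dir (j : ℕ) : Plane := (P.edge (j % P.r) (Nat.mod_lt _ P.r_pos)).choose

theorem norm_dir (j : ℕ) : ‖P.dir j‖ = 1 :=
  (P.edge (j % P.r) (Nat.mod_lt _ P.r_pos)).choose_spec.1

theorem x_edge {j : ℕ} (hj : j < P.r) {t : ℝ} (ht : t ∈ Icc (P.s j) (P.s (j + 1))) :
    P.x t = P.x (P.s j) + (t - P.s j) • P.dir j := by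
  have h : P.x t = P.x (P.s (j % P.r)) + (t - P.s (j % P.r)) • P.dir j :=
    (P.edge (j % P.r) (Nat.mod_lt _ P.r_pos)).choose_spec.2 t
    (by rw [Nat.mod_eq_of_lt hj]; exact ht)
  rw [Nat.mod_eq_of_lt hj] at h
  exact h

theorem x_sub_period (t : ℝ) : P.x (t - (P.s P.r - P.s 0)) = P.x t := P.periodic.sub_eq t

theorem x_s_last : P.x (P.s P.r) = P.x (P.s 0) := by
  rw [← x_sub_period (P.s P.r)]; congr 1; ring

theorem s_lt_s_succ {j : ℕ} (hj : j < P.r) : P.s j < P.s (j + 1) :=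
  (P.s_lt_γ j hj).trans (P.γ_lt_s j hj)

theorem γ_zero_lt_s_last : P.γ 0 < P.s P.r := by
  have h := γ_le_γ (P := P) (i := 0) (j := P.r - 1) (by omega) (by omega)
  have := γ_pred_lt_s (P := P) (j := P.r) ((mem_idx P).2 ⟨P.r_pos, le_rfl⟩)
  linarith

theorem x_right {j : ℕ} (hj : j ∈ P.idx) {t : ℝ} (ht : t ∈ Icc (P.s j) (P.γ j)) :
    P.x t = P.x (P.s j) + (t - P.s j) • P.dir j := by
  rw [mem_idx] at hj
  rcases hj.2.lt_or_eq with h | h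
  · exact x_edge h ⟨ht.1, ht.2.trans (P.γ_lt_s j h).le⟩
  -- Behind the last corner the curve runs along edge `0` again; periodicity moves the parameter
  -- back.
  · subst h
    have h1 := P.γ_last
    have hd : P.dir P.r = P.dir 0 := by unfold dir; congr! 2; simp
    rw [← x_sub_period t, x_edge (j := 0) P.r_pos ⟨by linarith [ht.1], ?_⟩, x_s_last, hd]
    · congr 2; ring
    · linarith [ht.2, P.γ_lt_s 0 P.r_pos]

theorem x_left {j : ℕ} (hj : j ∈ P.idx) {t : ℝ} (ht : t ∈ Icc (P.γ (j - 1)) (P.s j)) :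
    P.x t = P.x (P.s j) + (t - P.s j) • P.dir (j - 1) := by
  have hj' := (mem_idx P).1 hj
  obtain ⟨i, rfl⟩ : ∃ i, j = i + 1 := ⟨j - 1, by omega⟩
  simp only [Nat.add_sub_cancel] at ht ⊢
  have hi : i < P.r := by omega
  rw [x_edge hi ⟨(P.s_lt_γ i hi).le.trans ht.1, ht.2⟩,
    x_edge hi (t := P.s (i + 1)) ⟨(s_lt_s_succ hi).le, le_rfl⟩, add_assoc, ← add_smul]
  congr 2; ring

/-- Injectivity is given on `[s_0, s_r)`, whereas `Γ` starts at `γ_0`: parameters from `s_r` on are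
moved back by one period. The exception is the point where `Γ` closes up. -/
theorem eq_or_of_x_eq {t t' : ℝ} (ht : t ∈ P.bdry) (ht' : t' ∈ P.bdry) (h : P.x t = P.x t') :
    t = t' ∨ (t = P.γ 0 ∧ t' = P.γ P.r) ∨ (t = P.γ P.r ∧ t' = P.γ 0) := by
  have h1 := P.γ_last
  have h2 := P.s_lt_γ 0 P.r_pos
  have h3 := γ_zero_lt_s_last (P := P)
  obtain ⟨a1, a2⟩ := ht
  obtain ⟨b1, b2⟩ := ht'
  rcases lt_or_ge t (P.s P.r) with c | c <;> rcases lt_or_ge t' (P.s P.r) with d | d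
  · exact Or.inl (P.injOn ⟨by linarith, c⟩ ⟨by linarith, d⟩ h)
  · rw [← x_sub_period t'] at h
    have := P.injOn ⟨by linarith, c⟩ ⟨by linarith, by linarith⟩ h
    exact Or.inr (Or.inl ⟨by linarith, by linarith⟩)
  · rw [← x_sub_period t] at h
    have := P.injOn ⟨by linarith, by linarith⟩ ⟨by linarith, d⟩ h
    exact Or.inr (Or.inr ⟨by linarith, by linarith⟩)
  · rw [← x_sub_period t, ← x_sub_period t'] at h
    have := P.injOn ⟨by linarith, by linarith⟩ ⟨by linarith, by linarith⟩ h
    exact Or.inl (by linarith)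

variable (P) in
/-- The pieces of the boundary: each segment `Γ_j` is divided by its corner into a left and a right
part. -/
abbrev Piece : Type := {j // j ∈ P.idx} × Bool

namespace Piece

/-- The orientation: `1` to the right of the corner, `-1` to the left. -/
def sgn (p : P.Piece) : ℝ := if p.2 then 1 else -1

/-- The parameter at distance `τ` from the corner. -/
def pt (p : P.Piece) (τ : ℝ) : ℝ := P.s p.1 + p.sgn * τ

/-- The length. -/
def width (p : P.Piece) : ℝ := if p.2 then P.γ p.1 - P.s p.1 else P.s p.1 - P.γ (p.1 - 1)

/-- The index of the edge that contains the piece. -/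
def edge (p : P.Piece) : ℕ := (if p.2 then (p.1 : ℕ) else p.1 - 1) % P.r

/-- The corner. -/
noncomputable def corner (p : P.Piece) : ℂ := toComplex (P.x (P.s p.1))

/-- The unit vector that points away from the corner. -/
noncomputable def away (p : P.Piece) : ℂ := p.sgn * toComplex (P.dir p.edge)

/-- The point of the boundary at distance `τ` from the corner. -/
noncomputable def point (p : P.Piece) (τ : ℝ) : ℂ := p.corner + τ * p.away

theorem sgn_mul_self (p : P.Piece) : p.sgn * p.sgn = 1 := by
  unfold sgn; split_ifs <;> norm_num

theorem abs_sgn (p : P.Piece) : |p.sgn| = 1 := by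
  unfold sgn; split_ifs <;> norm_num

theorem width_pos (p : P.Piece) : 0 < p.width := by
  unfold width; split_ifs
  · exact sub_pos.2 (s_lt_γ_self p.1.2)
  · exact sub_pos.2 (γ_pred_lt_s p.1.2)

theorem dir_edge_right {j : ℕ} (hj : j ∈ P.idx) : P.dir (edge (P := P) (⟨j, hj⟩, true)) = P.dir j := by
  unfold dir; congr! 2; simp [edge]

theorem dir_edge_left {j : ℕ} (hj : j ∈ P.idx) :
    P.dir (edge (P := P) (⟨j, hj⟩, false)) = P.dir (j - 1) := by
  unfold dir; congr! 2; simp [edge]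

theorem norm_away (p : P.Piece) : ‖p.away‖ = 1 := by
  rw [away, norm_mul, norm_toComplex, norm_dir, Complex.norm_real, Real.norm_eq_abs, abs_sgn, one_mul]

theorem x_pt (p : P.Piece) {τ : ℝ} (hτ : τ ∈ Icc 0 p.width) :
    P.x (p.pt τ) = P.x (P.s p.1) + (p.sgn * τ) • P.dir p.edge := by
  rcases p with ⟨⟨j, hj⟩, _ | _⟩
  · simp only [width, Bool.false_eq_true, if_false, mem_Icc] at hτ
    rw [dir_edge_left, x_left hj]
    · simp [pt, sgn]
    · simp only [pt, sgn, Bool.false_eq_true, if_false, mem_Icc]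
      constructor <;> linarith [hτ.1, hτ.2]
  · simp only [width, if_true, mem_Icc] at hτ
    rw [dir_edge_right, x_right hj]
    · simp [pt, sgn]
    · simp only [pt, sgn, if_true, mem_Icc]
      constructor <;> linarith [hτ.1, hτ.2]

theorem toComplex_x_pt (p : P.Piece) {τ : ℝ} (hτ : τ ∈ Icc 0 p.width) :
    toComplex (P.x (p.pt τ)) = p.point τ := by
  rw [x_pt p hτ, toComplex_add, toComplex_smul, point, corner, away]
  push_cast; ring

theorem pt_mem_seg (p : P.Piece) {τ : ℝ} (hτ : τ ∈ Icc 0 p.width) : p.pt τ ∈ P.seg p.1 := by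
  rcases p with ⟨⟨j, hj⟩, _ | _⟩
  · simp only [width, Bool.false_eq_true, if_false, mem_Icc] at hτ
    simp only [pt, sgn, seg, Bool.false_eq_true, if_false, mem_Icc]
    constructor <;> linarith [hτ.1, hτ.2, s_lt_γ_self hj]
  · simp only [width, if_true, mem_Icc] at hτ
    simp only [pt, sgn, seg, if_true, mem_Icc]
    constructor <;> linarith [hτ.1, hτ.2, γ_pred_lt_s hj]

theorem seg_subset_bdry {j : ℕ} (hj : j ∈ P.idx) : P.seg j ⊆ P.bdry := by
  rw [mem_idx] at hj
  exact Icc_subset_Icc (γ_le_γ (by omega) (by omega)) (γ_le_γ hj.2 le_rfl)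

theorem pt_mem_bdry (p : P.Piece) {τ : ℝ} (hτ : τ ∈ Icc 0 p.width) : p.pt τ ∈ P.bdry :=
  seg_subset_bdry p.1.2 (pt_mem_seg p hτ)

theorem exists_pt_eq {t : ℝ} (ht : t ∈ P.bdry) :
    ∃ (p : P.Piece) (τ : ℝ), τ ∈ Icc 0 p.width ∧ p.pt τ = t := by
  have hex : ∃ j ∈ P.idx, t ∈ P.seg j := by
    have h : ∃ j, 1 ≤ j ∧ t ≤ P.γ j := ⟨P.r, P.r_pos, ht.2⟩
    classical
    have h1 := Nat.find_spec h
    have hle : Nat.find h ≤ P.r := Nat.find_min' h ⟨P.r_pos, ht.2⟩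
    refine ⟨Nat.find h, (mem_idx P).2 ⟨h1.1, hle⟩, ?_, h1.2⟩
    rcases h1.1.lt_or_eq with h2 | h2
    · have := Nat.find_min h (m := Nat.find h - 1) (by omega)
      simp only [not_and, not_le] at this
      exact (this (by omega)).le
    · rw [← h2]; exact ht.1
  obtain ⟨j, hj, h1, h2⟩ := hex
  rcases le_total t (P.s j) with h | h
  · refine ⟨(⟨j, hj⟩, false), P.s j - t, ?_, ?_⟩
    · simp only [width, Bool.false_eq_true, if_false, mem_Icc]
      constructor <;> linarith
    · simp [pt, sgn]
  · refine ⟨(⟨j, hj⟩, true), t - P.s j, ?_, ?_⟩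
    · simp only [width, if_true, mem_Icc]
      constructor <;> linarith
    · simp [pt, sgn]

/-- Two pieces at different corners can only meet if they lie on the same edge. -/
theorem edge_eq_of_x_eq {p p' : P.Piece} (hne : p.1 ≠ p'.1) {σ τ : ℝ} (hσ : σ ∈ Icc 0 p.width)
    (hτ : τ ∈ Icc 0 p'.width) (h : P.x (p.pt σ) = P.x (p'.pt τ)) : p.edge = p'.edge := by
  have hright : ∀ (p : P.Piece) {σ : ℝ}, σ ∈ Icc 0 p.width → p.pt σ = P.γ p.1 → p.2 = true := by
    rintro ⟨⟨j, hj⟩, _ | _⟩ σ hσ h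
    · simp only [pt, sgn, Bool.false_eq_true, if_false] at h
      linarith [hσ.1, s_lt_γ_self hj]
    · rfl
  have hleft : ∀ (p : P.Piece) {σ : ℝ}, σ ∈ Icc 0 p.width → p.pt σ = P.γ (p.1 - 1) →
      p.2 = false := by
    rintro ⟨⟨j, hj⟩, _ | _⟩ σ hσ h
    · rfl
    · simp only [pt, sgn, if_true] at h
      linarith [hσ.1, γ_pred_lt_s hj]
  -- Pieces at different corners share a parameter only at a division point `γ_j`, which is interior
  -- to the edge joining consecutive corners.
  have key : ∀ (p p' : P.Piece) {σ τ : ℝ}, σ ∈ Icc 0 p.width → τ ∈ Icc 0 p'.width →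
      p.pt σ = p'.pt τ → (p.1 : ℕ) < p'.1 → p.edge = p'.edge := by
    intro p p' σ τ hσ hτ h hlt
    have h1 := (pt_mem_seg p hσ).2
    have h2 := (pt_mem_seg p' hτ).1
    have hr := ((mem_idx P).1 p'.1.2).2
    have h3 : P.γ p.1 ≤ P.γ (p'.1 - 1) := γ_le_γ (by omega) (by omega)
    have h4 : (p.1 : ℕ) = p'.1 - 1 := by
      by_contra hc
      have := γ_lt_γ (P := P) (i := p.1) (j := p'.1 - 1) (by omega) (by omega)
      linarith
    have e1 := hright p hσ (by linarith)
    have e2 := hleft p' hτ (by linarith)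
    simp [edge, e1, e2, h4]
  -- The two ends of `Γ` are one point of edge `0`: there the piece before `s_1` meets the piece
  -- behind `s_r`, whose edge index `r` is reduced modulo `r`.
  have key2 : ∀ (p p' : P.Piece) {σ τ : ℝ}, σ ∈ Icc 0 p.width → τ ∈ Icc 0 p'.width →
      p.pt σ = P.γ 0 → p'.pt τ = P.γ P.r → p.edge = p'.edge := by
    intro p p' σ τ hσ hτ h h'
    have h1 := (pt_mem_seg p hσ).1
    have h2 := (pt_mem_seg p' hτ).2
    have m := (mem_idx P).1 p.1.2
    have m' := (mem_idx P).1 p'.1.2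
    have h3 : (p.1 : ℕ) - 1 = 0 := by
      by_contra hc
      have := γ_lt_γ (P := P) (i := 0) (j := p.1 - 1) (by omega) (by omega)
      linarith
    have h4 : (p'.1 : ℕ) = P.r := by
      by_contra hc
      have := γ_lt_γ (P := P) (i := p'.1) (j := P.r) (by omega) le_rfl
      linarith
    have e1 := hleft p hσ (by rw [h3, h])
    have e2 := hright p' hτ (by rw [h4, h'])
    simp [edge, e1, e2, h3, h4]
  rcases eq_or_of_x_eq (pt_mem_bdry p hσ) (pt_mem_bdry p' hτ) h with h1 | ⟨h1, h2⟩ | ⟨h1, h2⟩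
  · rcases lt_trichotomy (p.1 : ℕ) p'.1 with hl | hl | hl
    · exact key p p' hσ hτ h1 hl
    · exact absurd (Subtype.ext hl) hne
    · exact (key p' p hτ hσ h1.symm hl).symm
  · exact key2 p p' hσ hτ h1 h2
  · exact (key2 p' p hτ hσ h2 h1).symm

/-- With equal directions the two pieces would run along a common segment from the corner, against
injectivity. -/
theorem away_ne {p p' : P.Piece} (h1 : p.1 = p'.1) (hne : p.edge ≠ p'.edge) :
    p.away ≠ p'.away := by
  intro h
  have h2 : p.2 ≠ p'.2 := fun h2 => hne (by rw [Prod.ext h1 h2])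
  set δ := min p.width p'.width with hδ
  have hδ0 : 0 < δ := lt_min p.width_pos p'.width_pos
  have m : δ ∈ Icc 0 p.width := ⟨hδ0.le, min_le_left _ _⟩
  have m' : δ ∈ Icc 0 p'.width := ⟨hδ0.le, min_le_right _ _⟩
  have hx : ∀ c ∈ Icc 0 δ, P.x (p.pt c) = P.x (p'.pt c) := fun c hc => by
    apply toComplex_injective
    rw [toComplex_x_pt p ⟨hc.1, hc.2.trans m.2⟩, toComplex_x_pt p' ⟨hc.1, hc.2.trans m'.2⟩,
      point, point, corner, corner, h, h1]
  -- Half the common length stays clear of the ends of `Γ`, where distinct parameters may give the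
  -- same point.
  have mm : δ / 2 ∈ Icc 0 p.width := ⟨by linarith, by linarith [m.2]⟩
  have mm' : δ / 2 ∈ Icc 0 p'.width := ⟨by linarith, by linarith [m'.2]⟩
  have hpt : p.pt (δ / 2) ≠ p'.pt (δ / 2) := by
    rcases p with ⟨j, _ | _⟩ <;> rcases p' with ⟨j', _ | _⟩ <;> simp at h1 h2 <;> subst h1 <;>
      simp [pt, sgn] <;> intro h <;> linarith
  have hlt : ∀ (p : P.Piece) (c : ℝ), 0 < c → c < p.width → p.pt c ≠ P.γ 0 ∧ p.pt c ≠ P.γ P.r := by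
    rintro ⟨⟨j, hj⟩, _ | _⟩ c hc hc'
    · have hj' := (mem_idx P).1 hj
      have a1 := γ_le_γ (P := P) (i := 0) (j := j - 1) (by omega) (by omega)
      have a2 := γ_le_γ (P := P) (i := j) (j := P.r) (by omega) (by omega)
      have a3 := s_lt_γ_self hj
      simp only [width, pt, sgn, Bool.false_eq_true, if_false] at hc' ⊢
      constructor <;> intro h <;> linarith
    · have hj' := (mem_idx P).1 hj
      have a1 := γ_le_γ (P := P) (i := 0) (j := j - 1) (by omega) (by omega)
      have a2 := γ_le_γ (P := P) (i := j) (j := P.r) (by omega) (by omega)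
      have a3 := γ_pred_lt_s hj
      simp only [width, pt, sgn, if_true] at hc' ⊢
      constructor <;> intro h <;> linarith
  have hn := hlt p (δ / 2) (by linarith) (by linarith [m.2])
  rcases eq_or_of_x_eq (pt_mem_bdry p mm) (pt_mem_bdry p' mm')
    (hx _ ⟨by linarith, by linarith⟩) with h3 | ⟨h3, -⟩ | ⟨h3, -⟩
  · exact hpt h3
  · exact hn.1 h3
  · exact hn.2 h3

end Piece

end PolygonBoundary

/-- For unit vectors `|τ b - σ a|² = (σ + τ)² |b - a|²/4 + (τ - σ)² |b + a|²/4`; the second term is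
dropped. -/
theorem Complex.add_mul_norm_sub_le {a b : ℂ} (ha : ‖a‖ = 1) (hb : ‖b‖ = 1) (σ τ : ℝ) :
    (σ + τ) * (‖b - a‖ / 2) ≤ ‖τ * b - σ * a‖ := by
  refine le_of_sq_le_sq ?_ (norm_nonneg _)
  have ha' : a.re * a.re + a.im * a.im = 1 := by
    rw [← Complex.normSq_apply, Complex.normSq_eq_norm_sq, ha]; norm_num
  have hb' : b.re * b.re + b.im * b.im = 1 := by
    rw [← Complex.normSq_apply, Complex.normSq_eq_norm_sq, hb]; norm_num
  rw [mul_pow, div_pow, ← Complex.normSq_eq_norm_sq, ← Complex.normSq_eq_norm_sq,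
    Complex.normSq_apply, Complex.normSq_apply]
  simp only [Complex.sub_re, Complex.sub_im, Complex.mul_re, Complex.mul_im, Complex.ofReal_re,
    Complex.ofReal_im, zero_mul, sub_zero, add_zero]
  have : (τ * b.re - σ * a.re) * (τ * b.re - σ * a.re) +
      (τ * b.im - σ * a.im) * (τ * b.im - σ * a.im) =
      (σ + τ) ^ 2 * (((b.re - a.re) * (b.re - a.re) + (b.im - a.im) * (b.im - a.im)) / 2 ^ 2) +
      (τ - σ) ^ 2 / 4 * ((b.re + a.re) ^ 2 + (b.im + a.im) ^ 2) := by
    linear_combination ((σ ^ 2 - τ ^ 2) / 2) * (ha' - hb')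
  rw [this]
  have : 0 ≤ (τ - σ) ^ 2 / 4 * ((b.re + a.re) ^ 2 + (b.im + a.im) ^ 2) := by positivity
  linarith

namespace PolygonBoundary.Piece

variable {P : PolygonBoundary}

/-- The distance of two pieces on different edges. -/
theorem exists_le_norm_sub (p p' : P.Piece) (hne : p.edge ≠ p'.edge) :
    ∃ c > 0, ∀ σ ∈ Icc 0 p.width, ∀ τ ∈ Icc 0 p'.width,
      (p.1 = p'.1 → c * (σ + τ) ≤ ‖p'.point τ - p.point σ‖) ∧
      (p.1 ≠ p'.1 → c ≤ ‖p'.point τ - p.point σ‖) := by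
  by_cases h : p.1 = p'.1
  · refine ⟨‖p'.away - p.away‖ / 2,
      half_pos (norm_pos_iff.2 (sub_ne_zero.2 (away_ne h hne).symm)),
      fun σ hσ τ hτ => ⟨fun _ => ?_, fun h' => absurd h h'⟩⟩
    have e : p'.point τ - p.point σ = τ * p'.away - σ * p.away := by
      simp only [point, corner, h]; ring
    rw [e, mul_comm]
    exact Complex.add_mul_norm_sub_le p.norm_away p'.norm_away σ τ
  -- At different corners the distance attains its minimum on a compact set, and a zero minimum
  -- would put both pieces on one edge.
  · have hc : ContinuousOn (fun z : ℝ × ℝ => ‖p'.point z.2 - p.point z.1‖)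
        (Icc 0 p.width ×ˢ Icc 0 p'.width) := by
      unfold point
      refine Continuous.continuousOn ?_
      fun_prop
    obtain ⟨z, hz, hmin⟩ := (isCompact_Icc.prod isCompact_Icc).exists_isMinOn
      ⟨(0, 0), ⟨⟨le_rfl, p.width_pos.le⟩, ⟨le_rfl, p'.width_pos.le⟩⟩⟩ hc
    refine ⟨‖p'.point z.2 - p.point z.1‖, ?_, fun σ hσ τ hτ => ⟨fun h' => absurd h' h, fun _ =>
      hmin (a := (σ, τ)) ⟨hσ, hτ⟩⟩⟩
    refine norm_pos_iff.2 (sub_ne_zero.2 fun h' => hne ?_)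
    rw [← toComplex_x_pt p' hz.2, ← toComplex_x_pt p hz.1] at h'
    exact edge_eq_of_x_eq h hz.1 hz.2 (toComplex_injective h').symm

end PolygonBoundary.Piece

/-! ### The double layer kernel between two pieces -/

/-- Up to sign the integrand is the derivative of the angle under which the segment is seen from
`z`, and this angle is at most `π`. For real `z` the integrand vanishes. -/
theorem Complex.intervalIntegrable_im_inv (z : ℂ) (b : ℝ) :
    IntervalIntegrable (fun τ : ℝ => ((τ - z)⁻¹ : ℂ).im) volume 0 b ∧
      ∫ τ in 0..b, |((τ - z)⁻¹ : ℂ).im| ≤ Real.pi := by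
  have e : ∀ τ : ℝ, ((τ - z)⁻¹ : ℂ).im = z.im / ((τ - z.re) ^ 2 + z.im ^ 2) := fun τ => by
    rw [Complex.inv_im, Complex.normSq_apply]; simp [sq]
  simp_rw [e]
  rcases eq_or_ne z.im 0 with h | h
  · simp [h, Real.pi_pos.le]
  have hy : 0 < |z.im| := abs_pos.2 h
  have hpos : ∀ τ : ℝ, 0 < (τ - z.re) ^ 2 + z.im ^ 2 := fun τ => by positivity
  have hc : Continuous fun τ : ℝ => z.im / ((τ - z.re) ^ 2 + z.im ^ 2) :=
    continuous_const.div (by fun_prop) fun τ => (hpos τ).ne'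
  refine ⟨hc.intervalIntegrable _ _, ?_⟩
  have hder : ∀ τ : ℝ, HasDerivAt (fun τ => Real.arctan ((τ - z.re) / |z.im|))
      |z.im / ((τ - z.re) ^ 2 + z.im ^ 2)| τ := fun τ => by
    refine ((((hasDerivAt_id τ).sub_const z.re).div_const |z.im|).arctan).congr_deriv ?_
    rw [abs_div, abs_of_pos (hpos τ), ← sq_abs z.im]
    have := hpos τ
    rw [← sq_abs z.im] at this
    simp only [id]
    field_simp
    ring
  rw [integral_eq_sub_of_hasDerivAt (fun τ _ => hder τ) (hc.abs.intervalIntegrable _ _)]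
  have h1 := Real.arctan_lt_pi_div_two ((b - z.re) / |z.im|)
  have h2 := Real.neg_pi_div_two_lt_arctan ((0 - z.re) / |z.im|)
  linarith

namespace PolygonBoundary.Piece

variable {P : PolygonBoundary}

/-- The double layer kernel between two pieces of the boundary and its derivatives, of order `i`
with respect to the first and `l` with respect to the second argument. -/
noncomputable def kern (p p' : P.Piece) (i l : ℕ) (σ τ : ℝ) : ℝ :=
  -- On one edge `y - x` is perpendicular to the normal, so the kernel is zero there.
  if p.edge = p'.edge then 0 else p'.sgn / Real.pi *
    ((-1) ^ l * (i + l).factorial * p'.away ^ (l + 1) * p.away ^ i *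
      ((p'.point τ - p.point σ)⁻¹) ^ (i + l + 1) : ℂ).im

theorem hasDerivAt_point (p : P.Piece) (τ : ℝ) : HasDerivAt p.point p.away τ := by
  unfold point
  simpa using ((hasDerivAt_id τ).ofReal_comp.mul_const p.away).const_add p.corner

theorem hasDerivAt_inv_pow {f : ℝ → ℂ} {f' : ℂ} {x : ℝ} (m : ℕ) (hf : HasDerivAt f f' x)
    (h0 : f x ≠ 0) :
    HasDerivAt (fun x => ((f x)⁻¹) ^ (m + 1)) (-(m + 1) * f' * ((f x)⁻¹) ^ (m + 2)) x := by
  refine ((hf.fun_inv h0).fun_pow (m + 1)).congr_deriv ?_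
  rw [Nat.add_sub_cancel, div_eq_mul_inv, ← inv_pow]
  push_cast; ring

theorem _root_.HasDerivAt.complex_im {f : ℝ → ℂ} {f' : ℂ} {x : ℝ} (hf : HasDerivAt f f' x) :
    HasDerivAt (fun x => (f x).im) f'.im x :=
  Complex.imCLM.hasFDerivAt.comp_hasDerivAt x hf

theorem hasDerivAt_kern_left (p p' : P.Piece) (i l : ℕ) {σ τ : ℝ}
    (h0 : p.edge ≠ p'.edge → p'.point τ - p.point σ ≠ 0) :
    HasDerivAt (fun σ => kern p p' i l σ τ) (kern p p' (i + 1) l σ τ) σ := by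
  unfold kern
  split_ifs with h
  · exact hasDerivAt_const _ _
  have h1 := hasDerivAt_inv_pow (i + l) ((p.hasDerivAt_point σ).const_sub (p'.point τ)) (h0 h)
  refine (((h1.const_mul _).complex_im).const_mul _).congr_deriv ?_
  congr 2
  rw [show i + 1 + l = i + l + 1 by ring, Nat.factorial_succ]
  push_cast; ring

theorem hasDerivAt_kern_right (p p' : P.Piece) (i l : ℕ) {σ τ : ℝ}
    (h0 : p.edge ≠ p'.edge → p'.point τ - p.point σ ≠ 0) :
    HasDerivAt (kern p p' i l σ) (kern p p' i (l + 1) σ τ) τ := by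
  unfold kern
  split_ifs with h
  · exact hasDerivAt_const _ _
  have h1 := hasDerivAt_inv_pow (i + l) ((p'.hasDerivAt_point τ).sub_const (p.point σ)) (h0 h)
  refine (((h1.const_mul _).complex_im).const_mul _).congr_deriv ?_
  congr 2
  rw [show i + (l + 1) = i + l + 1 by ring, Nat.factorial_succ]
  push_cast; ring

theorem abs_kern_le (p p' : P.Piece) {i l : ℕ} (hi : i ≤ 3) (hl : l ≤ 3) (σ τ : ℝ) :
    |kern p p' i l σ τ| ≤ if p.edge = p'.edge then 0 else
      720 * (‖p'.point τ - p.point σ‖⁻¹) ^ (i + l + 1) := by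
  unfold kern
  split_ifs with h
  · simp
  rw [abs_mul, abs_div, abs_sgn, abs_of_pos Real.pi_pos]
  have hπ : 1 / Real.pi ≤ 1 := by
    rw [div_le_one Real.pi_pos]; linarith [Real.pi_gt_three]
  have hfac : ((i + l).factorial : ℝ) ≤ 720 := by
    have : (i + l).factorial ≤ (6).factorial := Nat.factorial_le (by omega)
    exact_mod_cast this.trans_eq (by decide)
  calc _ ≤ 1 * ‖((-1) ^ l * (i + l).factorial * p'.away ^ (l + 1) * p.away ^ i *
      ((p'.point τ - p.point σ)⁻¹) ^ (i + l + 1) : ℂ)‖ := by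
        gcongr; exact Complex.abs_im_le_norm _
    _ = (i + l).factorial * (‖p'.point τ - p.point σ‖⁻¹) ^ (i + l + 1) := by
        simp [norm_away]
    _ ≤ _ := by gcongr

/-- Division by the direction of the second piece gives the form `1/(τ - z)` with real `τ`, to which
the arctangent integral applies. -/
theorem kern_zero_zero (p p' : P.Piece) (σ τ : ℝ) : kern p p' 0 0 σ τ =
    if p.edge = p'.edge then 0 else p'.sgn / Real.pi *
      ((τ - (p.point σ - p'.corner) / p'.away)⁻¹ : ℂ).im := by
  unfold kern
  have ha : p'.away ≠ 0 := norm_ne_zero_iff.1 (by rw [norm_away]; norm_num)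
  split_ifs with h
  · rfl
  · congr 2
    have : (τ - (p.point σ - p'.corner) / p'.away : ℂ)
        = (p'.point τ - p.point σ) / p'.away := by
      rw [point, point]; field_simp; ring
    rw [this, inv_div]
    simp [div_eq_mul_inv]

theorem intervalIntegrable_kern (p p' : P.Piece) (σ : ℝ) :
    IntervalIntegrable (kern p p' 0 0 σ) volume 0 p'.width := by
  have : kern p p' 0 0 σ = fun τ => kern p p' 0 0 σ τ := rfl
  rw [this]
  simp_rw [kern_zero_zero]
  split_ifs
  · simp
  · exact (Complex.intervalIntegrable_im_inv _ _).1.const_mul _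

theorem integral_abs_kern_le (p p' : P.Piece) (σ : ℝ) :
    ∫ τ in 0..p'.width, |kern p p' 0 0 σ τ| ≤ 1 := by
  simp_rw [kern_zero_zero]
  split_ifs
  · simp
  · simp_rw [abs_mul, abs_div, abs_sgn, abs_of_pos Real.pi_pos]
    rw [intervalIntegral.integral_const_mul, one_div, inv_mul_le_iff₀ Real.pi_pos, mul_one]
    exact (Complex.intervalIntegrable_im_inv _ _).2

variable (P) in
theorem exists_separation : ∃ c M : ℝ, 0 < c ∧ c ≤ 1 ∧ 1 ≤ M ∧ (∀ p : P.Piece, p.width ≤ M) ∧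
    ∀ p p' : P.Piece, p.edge ≠ p'.edge → ∀ σ ∈ Icc 0 p.width, ∀ τ ∈ Icc 0 p'.width,
      (p.1 = p'.1 → c * (σ + τ) ≤ ‖p'.point τ - p.point σ‖) ∧
      (p.1 ≠ p'.1 → c ≤ ‖p'.point τ - p.point σ‖) := by
  have hex : ∀ z : P.Piece × P.Piece, ∃ c > 0, z.1.edge ≠ z.2.edge →
      ∀ σ ∈ Icc 0 z.1.width, ∀ τ ∈ Icc 0 z.2.width,
      (z.1.1 = z.2.1 → c * (σ + τ) ≤ ‖z.2.point τ - z.1.point σ‖) ∧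
      (z.1.1 ≠ z.2.1 → c ≤ ‖z.2.point τ - z.1.point σ‖) := fun z => by
    by_cases h : z.1.edge = z.2.edge
    · exact ⟨1, one_pos, fun h' => absurd h h'⟩
    · obtain ⟨c, hc, hc'⟩ := exists_le_norm_sub z.1 z.2 h
      exact ⟨c, hc, fun _ => hc'⟩
  choose c hc0 hc using hex
  have : Nonempty P.Piece := ⟨⟨⟨1, (mem_idx P).2 ⟨le_rfl, P.r_pos⟩⟩, true⟩⟩
  obtain ⟨z₀, hz₀⟩ := Finite.exists_min c
  obtain ⟨p₀, hp₀⟩ := Finite.exists_max (width (P := P))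
  refine ⟨min 1 (c z₀), max 1 p₀.width, lt_min one_pos (hc0 z₀), min_le_left _ _,
    le_max_left _ _, fun p => (hp₀ p).trans (le_max_right _ _), ?_⟩
  intro p p' hne σ hσ τ hτ
  have hm : min 1 (c z₀) ≤ c (p, p') := (min_le_right _ _).trans (hz₀ _)
  obtain ⟨h1, h2⟩ := hc (p, p') hne σ hσ τ hτ
  refine ⟨fun h => le_trans ?_ (h1 h), fun h => hm.trans (h2 h)⟩
  have : 0 ≤ σ + τ := add_nonneg hσ.1 hτ.1
  gcongr

theorem norm_sub_pos {p p' : P.Piece} (hne : p.edge ≠ p'.edge) {σ τ : ℝ}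
    (hσ : σ ∈ Icc 0 p.width) (hτ : τ ∈ Icc 0 p'.width) (h : 0 < σ + τ) :
    p'.point τ - p.point σ ≠ 0 := by
  obtain ⟨c, M, hc, -, -, -, hsep⟩ := exists_separation P
  obtain ⟨h1, h2⟩ := hsep p p' hne σ hσ τ hτ
  refine norm_pos_iff.1 ?_
  by_cases hp : p.1 = p'.1
  · exact lt_of_lt_of_le (by positivity) (h1 hp)
  · exact hc.trans_le (h2 hp)

/-- The exponents that occur are `i + l + 1 ≤ 7`; `R^8` serves as one constant for all of them. -/
theorem inv_pow_le_rpow {D R x : ℝ} {m : ℕ} (hR : 1 ≤ R) (hx : 0 < x) (h : R⁻¹ * x ≤ D)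
    (hm : m ≤ 8) : (D⁻¹) ^ m ≤ R ^ 8 * x ^ (-(m : ℝ)) := by
  have hR0 : 0 < R := by linarith
  have hx' : 0 < R⁻¹ * x := by positivity
  have hD : 0 < D := hx'.trans_le h
  calc (D⁻¹) ^ m ≤ ((R⁻¹ * x)⁻¹) ^ m := by gcongr
    _ = R ^ m * x ^ (-(m : ℝ)) := by
      rw [mul_inv, inv_inv, mul_pow, Real.rpow_neg hx.le, Real.rpow_natCast, inv_pow]
    _ ≤ _ := by gcongr

variable (P) in
/-- The estimates of the kernel near the corners. -/
theorem exists_kern_bounds : ∃ B : ℝ, 0 ≤ B ∧ ∀ (p p' : P.Piece), ∀ i ≤ 3, ∀ l ≤ 3,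
    (∀ σ ∈ Ioo 0 p.width, ∀ τ ∈ Icc 0 p'.width,
      |kern p p' i l σ τ| ≤ B * σ ^ (-(1 + i + l) : ℝ)) ∧
    (∀ σ ∈ Icc 0 p.width, ∀ τ ∈ Ioo 0 p'.width,
      |kern p p' i l σ τ| ≤ B * τ ^ (-(1 + i + l) : ℝ)) ∧
    ∀ θ : P.Piece → ℝ, (∀ p, 0 ≤ θ p) → (∀ p, θ p ≤ 1) → (∀ p p', p.1 = p'.1 → θ p = θ p') →
      1 ≤ i → ∀ σ ∈ Ioo 0 p.width, ∀ τ ∈ Ioo 0 p'.width,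
      |kern p p' i l σ τ| ≤ B * (σ ^ (θ p - i) * τ ^ (-(1 + l + θ p'))) := by
  obtain ⟨c, M, hc0, hc1, hM, hwidth, hsep⟩ := exists_separation P
  -- `R⁻¹ ≤ c` covers pieces at a common corner; for different corners `σ ≤ M` gives `R⁻¹ σ ≤ c`. So
  -- `R⁻¹ σ` and `R⁻¹ τ` always bound the distance from below.
  set R := M / c with hR
  have hR1 : 1 ≤ R := by rw [hR, one_le_div hc0]; linarith
  have hR0 : 0 < R := by linarith
  have hRi : R⁻¹ = c / M := by rw [hR, inv_div]
  have hRc : R⁻¹ ≤ c := by rw [hRi]; exact div_le_self hc0.le hM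
  have hlow : ∀ (p p' : P.Piece), p.edge ≠ p'.edge → ∀ σ ∈ Icc 0 p.width, ∀ τ ∈ Icc 0 p'.width,
      R⁻¹ * σ ≤ ‖p'.point τ - p.point σ‖ ∧ R⁻¹ * τ ≤ ‖p'.point τ - p.point σ‖ := by
    intro p p' hne σ hσ τ hτ
    obtain ⟨h1, h2⟩ := hsep p p' hne σ hσ τ hτ
    have hσ0 := hσ.1
    have hτ0 := hτ.1
    by_cases hp : p.1 = p'.1
    · constructor
      · calc R⁻¹ * σ ≤ c * (σ + τ) := by gcongr; linarith
          _ ≤ _ := h1 hp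
      · calc R⁻¹ * τ ≤ c * (σ + τ) := by gcongr; linarith
          _ ≤ _ := h1 hp
    · have : ∀ x, x ≤ M → R⁻¹ * x ≤ c := fun x hx => by
        rw [hRi, div_mul_eq_mul_div, div_le_iff₀ (by linarith)]; gcongr
      exact ⟨(this σ (hσ.2.trans (hwidth p))).trans (h2 hp),
        (this τ (hτ.2.trans (hwidth p'))).trans (h2 hp)⟩
  refine ⟨720 * R ^ 8, by positivity, fun p p' i hi l hl => ⟨?_, ?_, ?_⟩⟩
  · intro σ hσ τ hτ
    refine (abs_kern_le p p' hi hl σ τ).trans ?_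
    split_ifs with h
    · have := hσ.1; positivity
    · have := inv_pow_le_rpow (m := i + l + 1) hR1 hσ.1
        (hlow p p' h σ ⟨hσ.1.le, hσ.2.le⟩ τ hτ).1 (by omega)
      rw [show (-((i + l + 1 : ℕ) : ℝ)) = -(1 + i + l) by push_cast; ring] at this
      linarith
  · intro σ hσ τ hτ
    refine (abs_kern_le p p' hi hl σ τ).trans ?_
    split_ifs with h
    · have := hτ.1; positivity
    · have := inv_pow_le_rpow (m := i + l + 1) hR1 hτ.1
        (hlow p p' h σ hσ τ ⟨hτ.1.le, hτ.2.le⟩).2 (by omega)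
      rw [show (-((i + l + 1 : ℕ) : ℝ)) = -(1 + i + l) by push_cast; ring] at this
      linarith
  · intro θ hθ0 hθ1 hθ hi1 σ hσ τ hτ
    refine (abs_kern_le p p' hi hl σ τ).trans ?_
    have hσ0 := hσ.1
    have hτ0 := hτ.1
    have hi1' : (1 : ℝ) ≤ i := by exact_mod_cast hi1
    have hl0 : (0 : ℝ) ≤ l := l.cast_nonneg
    have t1 := hθ0 p'
    have t2 := hθ1 p
    split_ifs with h
    · positivity
    obtain ⟨h1, h2⟩ := hlow p p' h σ ⟨hσ.1.le, hσ.2.le⟩ τ ⟨hτ.1.le, hτ.2.le⟩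
    set D := ‖p'.point τ - p.point σ‖
    have hD : 0 < D := lt_of_lt_of_le (by positivity) h1
    rw [mul_assoc]
    refine mul_le_mul_of_nonneg_left ?_ (by norm_num)
    by_cases hp : p.1 = p'.1
    -- At a common corner `θ p = θ p'`, so the power of `D` splits into two factors; both exponents
    -- are nonpositive as `θ ≤ 1 ≤ i`, and one factor is estimated by `σ`, the other by `τ`.
    · have e : (D⁻¹) ^ (i + l + 1) = D ^ (θ p - i) * D ^ (-(1 + l + θ p')) := by
        rw [← Real.rpow_add hD, hθ p p' hp, inv_pow, ← Real.rpow_natCast, ← Real.rpow_neg hD.le]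
        congr 1; push_cast; ring
      rw [e]
      have b1 : D ^ (θ p - i) ≤ R ^ (i - θ p) * σ ^ (θ p - i) := by
        calc D ^ (θ p - i) ≤ (R⁻¹ * σ) ^ (θ p - i) :=
              Real.rpow_le_rpow_of_nonpos (by positivity) h1 (by linarith)
          _ = _ := by
              rw [Real.mul_rpow (by positivity) hσ0.le, Real.inv_rpow hR0.le, ← Real.rpow_neg hR0.le,
                neg_sub]
      have b2 : D ^ (-(1 + l + θ p')) ≤ R ^ (1 + l + θ p') * τ ^ (-(1 + l + θ p')) := by
        calc D ^ (-(1 + l + θ p')) ≤ (R⁻¹ * τ) ^ (-(1 + l + θ p')) :=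
              Real.rpow_le_rpow_of_nonpos (by positivity) h2 (by linarith)
          _ = _ := by
              rw [Real.mul_rpow (by positivity) hτ0.le, Real.inv_rpow hR0.le, ← Real.rpow_neg hR0.le,
                neg_neg]
      have b3 : R ^ (i - θ p) * R ^ (1 + l + θ p') ≤ R ^ 8 := by
        rw [← Real.rpow_add hR0, ← Real.rpow_natCast]
        refine Real.rpow_le_rpow_of_exponent_le hR1 ?_
        rw [hθ p p' hp]
        have : (i : ℝ) ≤ 3 := by exact_mod_cast hi
        have : (l : ℝ) ≤ 3 := by exact_mod_cast hl
        push_cast; linarith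
      calc _ ≤ (R ^ (i - θ p) * σ ^ (θ p - i)) * (R ^ (1 + l + θ p') * τ ^ (-(1 + l + θ p'))) := by
            gcongr
        _ = (R ^ (i - θ p) * R ^ (1 + l + θ p')) * (σ ^ (θ p - i) * τ ^ (-(1 + l + θ p'))) := by ring
        _ ≤ _ := by gcongr
    -- At different corners the kernel is bounded, and the powers on the right are bounded below
    -- because `σ, τ ≤ M`; their exponents sum to at least `-8`, which explains `M ^ 8`.
    · have hDc := (hsep p p' h σ ⟨hσ.1.le, hσ.2.le⟩ τ ⟨hτ.1.le, hτ.2.le⟩).2 hp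
      have hM0 : 0 < M := by linarith
      have b0 : (D⁻¹) ^ (i + l + 1) ≤ (c⁻¹) ^ 8 := by
        calc (D⁻¹) ^ (i + l + 1) ≤ (c⁻¹) ^ (i + l + 1) := by gcongr
          _ ≤ (c⁻¹) ^ 8 := by
            refine pow_le_pow_right₀ ((one_le_inv₀ hc0).2 hc1) (by omega)
      have b1 : M ^ (θ p - i) ≤ σ ^ (θ p - i) :=
        Real.rpow_le_rpow_of_nonpos hσ0 (hσ.2.le.trans (hwidth p)) (by linarith)
      have b2 : M ^ (-(1 + l + θ p')) ≤ τ ^ (-(1 + l + θ p')) :=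
        Real.rpow_le_rpow_of_nonpos hτ0 (hτ.2.le.trans (hwidth p')) (by linarith)
      have b3 : 1 ≤ M ^ 8 * (M ^ (θ p - i) * M ^ (-(1 + l + θ p'))) := by
        rw [← Real.rpow_add hM0, ← Real.rpow_natCast M 8, ← Real.rpow_add hM0]
        refine Real.one_le_rpow hM ?_
        have : (i : ℝ) ≤ 3 := by exact_mod_cast hi
        have : (l : ℝ) ≤ 3 := by exact_mod_cast hl
        have := hθ1 p'
        have := hθ0 p
        push_cast; linarith
      calc (D⁻¹) ^ (i + l + 1) ≤ (c⁻¹) ^ 8 * 1 := by rw [mul_one]; exact b0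
        _ ≤ (c⁻¹) ^ 8 * (M ^ 8 * (σ ^ (θ p - i) * τ ^ (-(1 + l + θ p')))) := by
            gcongr
            refine b3.trans ?_
            gcongr
        _ = _ := by rw [hR, div_eq_mul_inv, mul_pow]; ring

end PolygonBoundary.Piece

/-! ### Kernel and functions in local coordinates -/

theorem lineDeriv_log_norm_sub (X y v : Plane) (hv : ‖v‖ = 1) :
    lineDeriv ℝ (fun y : Plane => Real.log ‖X - y‖) y v =
      ((y 0 - X 0) * v 0 + (y 1 - X 1) * v 1) / ((y 0 - X 0) ^ 2 + (y 1 - X 1) ^ 2) := by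
  unfold lineDeriv
  -- At `X = y` both sides have the default value `0`: the function along the line is `log |t|`, and
  -- the right side is `0 / 0`.
  rcases eq_or_ne X y with rfl | h
  · have : (fun t : ℝ => Real.log ‖X - (X + t • v)‖) = Real.log := by
      funext t
      rw [sub_add_cancel_left, norm_neg, norm_smul, hv, mul_one, Real.norm_eq_abs, Real.log_abs]
    rw [this]; simp
  have hpos : 0 < (y 0 - X 0) ^ 2 + (y 1 - X 1) ^ 2 := by
    by_contra! hc
    apply h
    ext i; fin_cases i
    · simp only [Fin.zero_eta]; nlinarith [sq_nonneg (y 0 - X 0), sq_nonneg (y 1 - X 1)]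
    · simp only [Fin.mk_one]; nlinarith [sq_nonneg (y 0 - X 0), sq_nonneg (y 1 - X 1)]
  have e : (fun t : ℝ => Real.log ‖X - (y + t • v)‖) = fun t : ℝ =>
      Real.log ((y 0 + t * v 0 - X 0) ^ 2 + (y 1 + t * v 1 - X 1) ^ 2) / 2 := by
    funext t
    rw [EuclideanSpace.norm_eq, Fin.sum_univ_two, Real.log_sqrt (by positivity)]
    simp only [PiLp.sub_apply, PiLp.add_apply, PiLp.smul_apply, smul_eq_mul, Real.norm_eq_abs,
      sq_abs]
    congr 2; ring
  rw [e]
  have hlin : ∀ c d : ℝ, HasDerivAt (fun t : ℝ => (c + t * d)) d 0 := fun c d => by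
    simpa using ((hasDerivAt_id (0 : ℝ)).mul_const d).const_add c
  have h1 := (((hlin (y 0) (v 0)).sub_const (X 0)).fun_pow 2).fun_add
    (((hlin (y 1) (v 1)).sub_const (X 1)).fun_pow 2)
  have h2 := (h1.log (by simpa using hpos.ne')).div_const 2
  rw [h2.deriv]
  simp only [zero_mul, add_zero]
  push_cast
  field_simp

namespace PolygonBoundary.Piece

variable {P : PolygonBoundary}

theorem exists_corner_eq (p : P.Piece) : ∃ c : ℝ,
    p.corner = toComplex (P.x (P.s p.edge)) + c * toComplex (P.dir p.edge) := by
  rcases p with ⟨⟨j, hj⟩, _ | _⟩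
  · have hj' := (mem_idx P).1 hj
    have he : edge (P := P) (⟨j, hj⟩, false) = j - 1 := by
      simp [edge, Nat.mod_eq_of_lt (show j - 1 < P.r by omega)]
    rw [he]
    refine ⟨P.s j - P.s (j - 1), ?_⟩
    have h1 : j - 1 < P.r := by omega
    have := x_edge h1 (t := P.s j) (by
      rw [Nat.sub_add_cancel hj'.1]
      refine ⟨?_, le_rfl⟩
      have := s_lt_s_succ h1
      rw [Nat.sub_add_cancel hj'.1] at this
      exact this.le)
    simp only [corner]
    rw [this, toComplex_add, toComplex_smul]
  · have hj' := (mem_idx P).1 hj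
    refine ⟨0, ?_⟩
    simp only [corner, Complex.ofReal_zero, zero_mul, add_zero]
    congr 1
    rcases hj'.2.lt_or_eq with h | h
    · simp [edge, Nat.mod_eq_of_lt h]
    · subst h; simp [edge, x_s_last]

/-- Both points lie on the line of the common edge, so their difference is a real multiple of the
tangent; if it is zero, so is the quotient by convention. -/
theorem im_div_eq_zero_of_edge_eq {p p' : P.Piece} (h : p.edge = p'.edge) (σ τ : ℝ) :
    (toComplex (P.dir p'.edge) / (p'.point τ - p.point σ)).im = 0 := by
  obtain ⟨c, hc⟩ := exists_corner_eq p
  obtain ⟨c', hc'⟩ := exists_corner_eq p'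
  have hd : toComplex (P.dir p'.edge) ≠ 0 :=
    norm_ne_zero_iff.1 (by rw [norm_toComplex, norm_dir]; norm_num)
  have : p'.point τ - p.point σ =
      ((c' + τ * p'.sgn - c - σ * p.sgn : ℝ) : ℂ) * toComplex (P.dir p'.edge) := by
    rw [point, point, away, away, hc, hc', h]; push_cast; ring
  rw [this, mul_comm, ← div_div, div_self hd, one_div, ← Complex.ofReal_inv, Complex.ofReal_im]

/-- Derivatives pass from the local coordinate to arc length: the open piece is a neighbourhood of
the point, and the sign, being its own inverse, gives the inverse coordinate change. -/
theorem hasDerivAt_of_comp_pt {E : Type} [NormedAddCommGroup E] [NormedSpace ℝ E] (p : P.Piece)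
    {F G : ℝ → E} {G' : E} {τ : ℝ} (hτ : τ ∈ Ioo 0 p.width)
    (h : ∀ τ ∈ Ioo 0 p.width, F (p.pt τ) = G τ) (hG : HasDerivAt G G' τ) :
    HasDerivAt F (p.sgn • G') (p.pt τ) := by
  have hs := p.sgn_mul_self
  set c : ℝ → ℝ := fun t => p.sgn * (t - P.s p.1) with hc
  have hcp : ∀ t, p.pt (c t) = t := fun t => by
    simp only [pt, hc]; rw [← mul_assoc, hs]; ring
  have hpc : c (p.pt τ) = τ := by
    simp only [pt, hc]; rw [add_sub_cancel_left, ← mul_assoc, hs, one_mul]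
  have hcd : HasDerivAt c p.sgn (p.pt τ) := by
    simpa using ((hasDerivAt_id (p.pt τ)).sub_const (P.s p.1)).const_mul p.sgn
  have h1 : HasDerivAt (fun t => G (c t)) (p.sgn • G') (p.pt τ) :=
    HasDerivAt.scomp (p.pt τ) (by rw [hpc]; exact hG) hcd
  refine h1.congr_of_eventuallyEq ?_
  have : c ⁻¹' Ioo 0 p.width ∈ 𝓝 (p.pt τ) :=
    hcd.continuousAt.preimage_mem_nhds (by rw [hpc]; exact Ioo_mem_nhds hτ.1 hτ.2)
  filter_upwards [this] with t ht
  rw [← h (c t) ht, hcp]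

theorem hasDerivAt_x (p : P.Piece) {τ : ℝ} (hτ : τ ∈ Ioo 0 p.width) :
    HasDerivAt P.x (P.dir p.edge) (p.pt τ) := by
  have := hasDerivAt_of_comp_pt p (F := P.x) hτ
    (fun τ hτ => p.x_pt ⟨hτ.1.le, hτ.2.le⟩)
    ((((hasDerivAt_id τ).const_mul p.sgn).smul_const (P.dir p.edge)).const_add (P.x (P.s p.1)))
  simpa [smul_smul, p.sgn_mul_self] using this

/-- With tangent `d`, normal `n = -i d` and `w = y - x`, the product `w · n` is the imaginary part
of `d` times the conjugate of `w`, so `w · n / |w|²` is that of `d / w`. -/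
theorem k_eq (p : P.Piece) (s : ℝ) {τ : ℝ} (hτ : τ ∈ Ioo 0 p.width) :
    P.k s (p.pt τ) = 1 / Real.pi *
      (toComplex (P.dir p.edge) / (p.point τ - toComplex (P.x s))).im := by
  unfold k normal
  rw [(p.hasDerivAt_x hτ).deriv, lineDeriv_log_norm_sub]
  · rw [← p.toComplex_x_pt ⟨hτ.1.le, hτ.2.le⟩, Complex.div_im, Complex.normSq_apply]
    simp only [toComplex, Complex.sub_re, Complex.sub_im]
    simp only [Matrix.cons_val_zero, Matrix.cons_val_one, Matrix.cons_val_fin_one]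
    ring
  · have := P.norm_dir p.edge
    rw [EuclideanSpace.norm_eq, Fin.sum_univ_two] at this ⊢
    simpa [add_comm] using this

theorem k_eq_kern (p p' : P.Piece) {σ τ : ℝ} (hσ : σ ∈ Icc 0 p.width) (hτ : τ ∈ Ioo 0 p'.width) :
    P.k (p.pt σ) (p'.pt τ) = kern p p' 0 0 σ τ := by
  rw [k_eq p' _ hτ, toComplex_x_pt p hσ]
  unfold kern
  split_ifs with h
  · rw [im_div_eq_zero_of_edge_eq h, mul_zero]
  · have : toComplex (P.dir p'.edge) = p'.sgn * p'.away := by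
      rw [away, ← mul_assoc, ← Complex.ofReal_mul, sgn_mul_self]; simp
    rw [this, mul_div_assoc, Complex.im_ofReal_mul]
    simp [div_eq_mul_inv]; ring

theorem hasDerivAt_kern_left' (p p' : P.Piece) (i l : ℕ) {σ τ : ℝ} (hσ : σ ∈ Ioo 0 p.width)
    (hτ : τ ∈ Icc 0 p'.width) :
    HasDerivAt (fun σ => kern p p' i l σ τ) (kern p p' (i + 1) l σ τ) σ :=
  hasDerivAt_kern_left p p' i l fun h =>
    norm_sub_pos h ⟨hσ.1.le, hσ.2.le⟩ hτ (add_pos_of_pos_of_nonneg hσ.1 hτ.1)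

theorem hasDerivAt_kern_right' (p p' : P.Piece) (i l : ℕ) {σ τ : ℝ} (hσ : σ ∈ Icc 0 p.width)
    (hτ : τ ∈ Ioo 0 p'.width) :
    HasDerivAt (kern p p' i l σ) (kern p p' i (l + 1) σ τ) τ :=
  hasDerivAt_kern_right p p' i l fun h =>
    norm_sub_pos h hσ ⟨hτ.1.le, hτ.2.le⟩ (add_pos_of_nonneg_of_pos hσ.1 hτ.1)

/-- Every derivative in arc length brings the sign of its piece. In the leading term each sign
occurs twice, once more through `dtdsk` or `deriv u`, and disappears. -/
theorem dtk_eq_kern (p p' : P.Piece) {σ τ : ℝ} (hσ : σ ∈ Icc 0 p.width)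
    (hτ : τ ∈ Ioo 0 p'.width) :
    P.dtk (p.pt σ) (p'.pt τ) = p'.sgn * kern p p' 0 1 σ τ :=
  (hasDerivAt_of_comp_pt p' hτ (fun _ hτ => k_eq_kern p p' hσ hτ)
    (hasDerivAt_kern_right' p p' 0 0 hσ hτ)).deriv

theorem dtdsk_eq_kern (p p' : P.Piece) {σ τ : ℝ} (hσ : σ ∈ Ioo 0 p.width)
    (hτ : τ ∈ Ioo 0 p'.width) :
    P.dtdsk (p.pt σ) (p'.pt τ) = p.sgn * p'.sgn * kern p p' 1 1 σ τ := by
  have h1 : ∀ τ ∈ Ioo 0 p'.width, deriv (fun s' => P.k s' (p'.pt τ)) (p.pt σ)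
      = p.sgn * kern p p' 1 0 σ τ := fun τ hτ =>
    (hasDerivAt_of_comp_pt p (F := fun s' => P.k s' (p'.pt τ)) hσ
      (fun σ hσ => k_eq_kern p p' ⟨hσ.1.le, hσ.2.le⟩ hτ)
      (hasDerivAt_kern_left' p p' 0 0 hσ ⟨hτ.1.le, hτ.2.le⟩)).deriv
  have h2 := (hasDerivAt_of_comp_pt p'
    (F := fun t' => deriv (fun s' => P.k s' t') (p.pt σ)) hτ h1
    ((hasDerivAt_kern_right' p p' 1 0 ⟨hσ.1.le, hσ.2.le⟩ hτ).const_mul p.sgn)).deriv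
  rw [dtdsk, h2, smul_eq_mul]; ring

theorem abs_pt_sub (p : P.Piece) {τ : ℝ} (hτ : 0 ≤ τ) : |p.pt τ - P.s p.1| = τ := by
  rw [pt, add_sub_cancel_left, abs_mul, abs_sgn, one_mul, abs_of_nonneg hτ]

theorem pt_mem_punctured (p : P.Piece) {τ : ℝ} (hτ : τ ∈ Ioo 0 p.width) :
    p.pt τ ∈ P.seg p.1 \ {P.s p.1} := by
  refine ⟨p.pt_mem_seg ⟨hτ.1.le, hτ.2.le⟩, fun h => ?_⟩
  have h1 := p.abs_pt_sub hτ.1.le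
  rw [mem_singleton_iff.1 h, sub_self, abs_zero] at h1
  exact hτ.1.ne h1

theorem punctured_mem_nhds (p : P.Piece) {τ : ℝ} (hτ : τ ∈ Ioo 0 p.width) :
    P.seg p.1 \ {P.s p.1} ∈ 𝓝 (p.pt τ) := by
  have h1 : P.seg p.1 ∈ 𝓝 (p.pt τ) := by
    rcases p with ⟨⟨j, hj⟩, _ | _⟩
    · simp only [width, Bool.false_eq_true, if_false, mem_Ioo] at hτ
      refine Icc_mem_nhds ?_ ?_ <;> simp only [pt, sgn, Bool.false_eq_true, if_false] <;>
        linarith [hτ.1, hτ.2, s_lt_γ_self hj]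
    · simp only [width, if_true, mem_Ioo] at hτ
      refine Icc_mem_nhds ?_ ?_ <;> simp only [pt, sgn, if_true] <;>
        linarith [hτ.1, hτ.2, γ_pred_lt_s hj]
  exact inter_mem h1 (isOpen_compl_singleton.mem_nhds (p.pt_mem_punctured hτ).2)

/-- The derivatives of a function on the boundary in the local coordinate of a piece. -/
noncomputable def pull (u : ℝ → ℝ) (p : P.Piece) (i : ℕ) (τ : ℝ) : ℝ :=
  p.sgn ^ i * iteratedDerivWithin i u (P.seg p.1 \ {P.s p.1}) (p.pt τ)

theorem pull_zero (u : ℝ → ℝ) (p : P.Piece) (τ : ℝ) : pull u p 0 τ = u (p.pt τ) := by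
  simp [pull]

theorem uniqueDiffOn_punctured {j : ℕ} (hj : j ∈ P.idx) :
    UniqueDiffOn ℝ (P.seg j \ {P.s j}) :=
  (uniqueDiffOn_Icc (γ_pred_lt hj)).inter isOpen_compl_singleton

theorem hasDerivAt_pull {u : ℝ → ℝ} (p : P.Piece)
    (hu : ContDiffOn ℝ 4 u (P.seg p.1 \ {P.s p.1})) {i : ℕ} (hi : i ≤ 3) {τ : ℝ}
    (hτ : τ ∈ Ioo 0 p.width) : HasDerivAt (pull u p i) (pull u p (i + 1) τ) τ := by
  have hm := p.pt_mem_punctured hτ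
  have h1 : DifferentiableOn ℝ (iteratedDerivWithin i u (P.seg p.1 \ {P.s p.1}))
      (P.seg p.1 \ {P.s p.1}) :=
    hu.differentiableOn_iteratedDerivWithin
      (by exact_mod_cast (show i < 4 by omega)) (uniqueDiffOn_punctured p.1.2)
  have h2 := (h1 _ hm).hasDerivWithinAt.hasDerivAt (p.punctured_mem_nhds hτ)
  rw [← iteratedDerivWithin_succ] at h2
  have h3 : HasDerivAt p.pt p.sgn τ := by
    unfold pt
    exact (((hasDerivAt_id τ).const_mul p.sgn).const_add (P.s p.1)).congr_deriv (mul_one _)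
  refine ((h2.comp τ h3).const_mul (p.sgn ^ i)).congr_deriv ?_
  rw [pull, pow_succ]; ring

theorem deriv_pt {u : ℝ → ℝ} (p : P.Piece)
    (hu : ContDiffOn ℝ 4 u (P.seg p.1 \ {P.s p.1})) {τ : ℝ}
    (hτ : τ ∈ Ioo 0 p.width) : deriv u (p.pt τ) = p.sgn * pull u p 1 τ :=
  (hasDerivAt_of_comp_pt p hτ (fun τ _ => (pull_zero u p τ).symm)
    (hasDerivAt_pull p hu (by norm_num) hτ)).deriv

theorem abs_pull_le {a : ℕ → ℝ} {u : ℝ → ℝ} (hu : P.wnorm 4 a u < ⊤) (p : P.Piece) {i : ℕ}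
    (hi : i ≤ 3) {τ : ℝ} (hτ : τ ∈ Ioo 0 p.width) :
    τ ^ (max ((i : ℝ) - a p.1) 0) * |pull u p i τ| ≤ (P.wnorm 4 a u).toReal := by
  have h : ENNReal.ofReal (|p.pt τ - P.s p.1| ^ (max ((i : ℝ) - a p.1) 0) *
      |iteratedDerivWithin i u (P.seg p.1 \ {P.s p.1}) (p.pt τ)|) ≤ P.wnorm 4 a u := by
    unfold wnorm
    refine le_trans ?_ (le_iSup₂ (f := fun j (_ : j ∈ P.idx) => ⨆ i ∈ Finset.range (4 + 1),
      ⨆ s ∈ P.seg j \ {P.s j}, ENNReal.ofReal (|s - P.s j| ^ (max ((i : ℝ) - a j) 0) *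
      |iteratedDerivWithin i u (P.seg j \ {P.s j}) s|)) (p.1 : ℕ) p.1.2)
    refine le_trans ?_ (le_iSup₂ (f := fun i (_ : i ∈ Finset.range (4 + 1)) =>
      ⨆ s ∈ P.seg p.1 \ {P.s p.1}, ENNReal.ofReal (|s - P.s p.1| ^ (max ((i : ℝ) - a p.1) 0) *
      |iteratedDerivWithin i u (P.seg p.1 \ {P.s p.1}) s|)) i (Finset.mem_range.2 (by omega)))
    exact le_iSup₂ (f := fun s (_ : s ∈ P.seg p.1 \ {P.s p.1}) =>
      ENNReal.ofReal (|s - P.s p.1| ^ (max ((i : ℝ) - a p.1) 0) *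
      |iteratedDerivWithin i u (P.seg p.1 \ {P.s p.1}) s|)) (p.pt τ) (p.pt_mem_punctured hτ)
  rw [ENNReal.ofReal_le_iff_le_toReal hu.ne, abs_pt_sub p hτ.1.le] at h
  rw [pull, abs_mul, abs_pow, abs_sgn, one_pow, one_mul]
  exact h

end PolygonBoundary.Piece

namespace PolygonBoundary

open Piece

variable (P : PolygonBoundary)

theorem exists_gradedKernel (q a : ℕ → ℝ) (hq : ∀ j ∈ P.idx, 0 < q j) (ha : ∀ j ∈ P.idx, a j ≤ 1)
    (h6 : ∀ j ∈ P.idx, 6 < q j * a j) : ∃ G : GradedKernel P.Piece, G.b = width ∧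
      G.q = (fun p => q p.1) ∧ G.a = (fun p => a p.1) ∧ G.K = kern := by
  obtain ⟨B, hB0, hB⟩ := exists_kern_bounds P
  have hinv : ∀ p : P.Piece, 0 < 1 / q p.1 ∧ 1 / q p.1 < a p.1 / 6 := fun p => by
    have h0 := hq p.1 p.1.2
    refine ⟨one_div_pos.2 h0, ?_⟩
    rw [div_lt_iff₀ h0]; linarith [h6 p.1 p.1.2]
  refine ⟨{ b := width, q := fun p => q p.1, a := fun p => a p.1, K := kern, B := B
            b_pos := width_pos
            q_pos := fun p => hq p.1 p.1.2
            a_le_one := fun p => ha p.1 p.1.2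
            six_lt := fun p => h6 p.1 p.1.2
            hasDerivAt_left := fun p p' i l σ hσ τ hτ =>
              hasDerivAt_kern_left' p p' i l hσ ⟨hτ.1.le, hτ.2.le⟩
            hasDerivAt_right := fun p p' i l σ hσ τ hτ =>
              hasDerivAt_kern_right' p p' i l ⟨hσ.1.le, hσ.2.le⟩ hτ
            bound := fun p p' i hi l hl σ hσ τ hτ =>
              (hB p p' i hi l hl).1 σ hσ τ ⟨hτ.1.le, hτ.2.le⟩
            bound_mixed := fun θ hθ p p' i hi hi1 l hl σ hσ τ hτ => ?_
            integral_abs_le := fun p p' σ _ => integral_abs_kern_le p p' σ }, rfl, rfl, rfl, rfl⟩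
  -- Both exponents lie in `[0, 1]`, since `1/q < a/6` and `a ≤ 1`, and depend only on the corner.
  refine (hB p p' i hi l hl).2.2 θ ?_ ?_ ?_ hi1 σ hσ τ hτ
  · rcases hθ with rfl | rfl <;> intro p <;> linarith [hinv p]
  · rcases hθ with rfl | rfl <;> intro p <;> linarith [hinv p, ha p.1 p.1.2]
  · rcases hθ with rfl | rfl <;> intro p p' h <;> simp only [h]

end PolygonBoundary

/-! ### Mesh, projection and leading term in local coordinates -/

namespace GradedKernel

variable {ι : Type} [Fintype ι] {G : GradedKernel ι} {n : ι → ℕ} {h N A : ℝ}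
  {U k : ι → ℕ → ℝ → ℝ}

theorem sum_devIntegral_eq (hn : IsMesh n h) (p : ι) (σ : ℝ) :
    ∑ p', ∑ j ∈ Finset.range (n p'),
      devIntegral (G.K p p' 0 0 σ) (U p' 0) (G.node n p' j) (G.node n p' (j + 1)) =
    G.cornerPart n U p σ + G.regularPart n U p 0 σ := by
  unfold cornerPart regularPart
  rw [← Finset.sum_add_distrib]
  refine Finset.sum_congr rfl fun p' _ => ?_
  rw [Finset.range_eq_Ico, Finset.sum_eq_sum_Ico_succ_bot (hn.one_le p')]

/-- The inner sums are drawn out of the outer integral, which requires integrability of every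
summand; the two factors `1/12` combine to `1/144`. -/
theorem leading_eq_sum (hU : G.IsWeighted N U) (hn : IsMesh n h) (hk : G.IsSection A k)
    (hA : 0 ≤ A) : G.leading n U k = 1 / 144 * ∑ p, ∑ p',
      ∑ j ∈ Finset.Ico 1 (n p), ∑ j' ∈ Finset.Ico 1 (n p'),
        (G.node n p (j + 1) - G.node n p j) ^ 2 * (G.node n p' (j' + 1) - G.node n p' j') ^ 2 *
        ∫ σ in (G.node n p j)..(G.node n p (j + 1)), k p 1 σ *
          ∫ τ in (G.node n p' j')..(G.node n p' (j' + 1)), G.K p p' 1 1 σ τ * U p' 1 τ := by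
  unfold leading
  rw [Finset.mul_sum]
  refine Finset.sum_congr rfl fun p _ => ?_
  rw [Finset.sum_comm, Finset.mul_sum]
  refine Finset.sum_congr rfl fun j hj => ?_
  have hj' := Finset.mem_Ico.1 hj
  have hlt := node_lt (G := G) hn p j
  have hsub := Ioo_node_subset (G := G) hn p hj'.2
  have hpos := node_pos (G := G) hn p hj'.1
  have hint : ∀ p', ∀ j' ∈ Finset.Ico 1 (n p'), IntervalIntegrable (fun σ => k p 1 σ *
      ∫ τ in (G.node n p' j')..(G.node n p' (j' + 1)), G.K p p' 1 1 σ τ * U p' 1 τ) volume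
      (G.node n p j) (G.node n p (j + 1)) := by
    intro p' j' hj2
    have hj2' := Finset.mem_Ico.1 hj2
    have hsub' := Ioo_node_subset (G := G) hn p' hj2'.2
    obtain ⟨M, hM⟩ := exists_K_bound (G := G) p p' (i := 1) (l := 1) (by omega) (by omega) _ hpos
    have ub := hU.bound_node hn p' (i := 1) (by norm_num) le_rfl hj2
    refine intervalIntegrable_mul_of_bound hlt.le
      (M := M * (N * G.node n p' j' ^ (G.a p' - (1 : ℕ))) * (G.node n p' (j' + 1) - G.node n p' j'))
      (intervalIntegrable_of_bound_Ioo hlt.le ((hk.continuousOn p (by norm_num)).mono hsub)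
        (hk.bound_node hA hn p (by norm_num) le_rfl hj))
      ((continuousOn_leadingIntegral hU hn p p' hj2).mono hsub) fun σ hσ => ?_
    refine abs_integral_le_of_bound_Ioo (node_lt hn p' j').le fun τ hτ => ?_
    have hσM := hM σ ⟨hσ.1, (hsub hσ).2⟩ τ (hsub' hτ)
    rw [abs_mul]
    exact mul_le_mul hσM (ub τ hτ) (abs_nonneg _) ((abs_nonneg _).trans hσM)
  have e : ∫ σ in (G.node n p j)..(G.node n p (j + 1)), k p 1 σ * G.leadingPart n U p σ =
      ∑ p', ∑ j' ∈ Finset.Ico 1 (n p'), (G.node n p' (j' + 1) - G.node n p' j') ^ 2 / 12 *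
        ∫ σ in (G.node n p j)..(G.node n p (j + 1)), k p 1 σ *
          ∫ τ in (G.node n p' j')..(G.node n p' (j' + 1)), G.K p p' 1 1 σ τ * U p' 1 τ := by
    have hs : ∀ p', ∀ j' ∈ Finset.Ico 1 (n p'), IntervalIntegrable (fun σ =>
        (G.node n p' (j' + 1) - G.node n p' j') ^ 2 / 12 * (k p 1 σ *
        ∫ τ in (G.node n p' j')..(G.node n p' (j' + 1)), G.K p p' 1 1 σ τ * U p' 1 τ)) volume
        (G.node n p j) (G.node n p (j + 1)) := fun p' j' hj2 => (hint p' j' hj2).const_mul _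
    rw [Finset.sum_congr rfl fun p' _ =>
      (Finset.sum_congr rfl fun j' _ => (intervalIntegral.integral_const_mul _ _).symm).trans
      (intervalIntegral.integral_finsetSum (hs p')).symm,
      ← intervalIntegral.integral_finsetSum fun p' _ => by
        simpa only [Finset.sum_fn] using IntervalIntegrable.sum _ (hs p')]
    refine intervalIntegral.integral_congr fun σ _ => ?_
    simp only [leadingPart, Finset.mul_sum]
    refine Finset.sum_congr rfl fun p' _ => Finset.sum_congr rfl fun j' _ => ?_
    ring
  rw [e, Finset.mul_sum, Finset.mul_sum]
  refine Finset.sum_congr rfl fun p' _ => ?_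
  rw [Finset.mul_sum, Finset.mul_sum]
  refine Finset.sum_congr rfl fun j' _ => ?_
  ring

end GradedKernel

/-- The first half is reversed so that the elements on both sides of a corner are counted away from
it. -/
theorem sum_range_two_mul {M : Type} [AddCommMonoid M] (f : ℕ → M) (N : ℕ) :
    ∑ i ∈ Finset.range (2 * N), f i =
      ∑ j ∈ Finset.range N, f (N + j) + ∑ j ∈ Finset.range N, f (N - 1 - j) := by
  rw [two_mul, Finset.sum_range_add, Finset.sum_range_reflect, add_comm]

namespace PolygonBoundary

open Piece

variable {P : PolygonBoundary} {q : ℕ → ℝ} {n : ℕ → ℕ}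

theorem sum_piece {M : Type} [AddCommMonoid M] (f : P.Piece → M) (g : ℕ → M)
    (h : ∀ j (hj : j ∈ P.idx), g j = f (⟨j, hj⟩, true) + f (⟨j, hj⟩, false)) :
    ∑ j ∈ P.idx, g j = ∑ p, f p := by
  rw [Fintype.sum_prod_type, ← Finset.sum_coe_sort]
  exact Finset.sum_congr rfl fun j _ => by rw [h j.1 j.2, Fintype.sum_bool]

theorem node_zero {j : ℕ} (hn : 1 ≤ n j) : P.node q n j 0 = P.γ (j - 1) := by
  have : (n j : ℝ) ≠ 0 := by positivity
  simp [node, div_self this]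

theorem node_two_mul {j : ℕ} (hn : 1 ≤ n j) : P.node q n j (2 * n j) = P.γ j := by
  have : (n j : ℝ) ≠ 0 := by positivity
  have h2 : (2 * n j : ℝ) - n j = n j := by ring
  simp [node, show ¬ (2 * n j ≤ n j) by omega, h2, div_self this]

theorem node_add {j : ℕ} (hj : j ∈ P.idx) (hq : 0 < q j) (i : ℕ) :
    P.node q n j (n j + i) =
      pt (P := P) (⟨j, hj⟩, true) (gradedNode (width (P := P) (⟨j, hj⟩, true)) (q j) (n j) i) := by
  unfold node
  split_ifs with h
  -- The corner node falls under the left-hand formula of `node`; both formulas give `s_j`, as `0 ^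
  -- q = 0`.
  · obtain rfl : i = 0 := by omega
    rw [gradedNode_zero _ _ hq]
    simp [pt, Real.zero_rpow hq.ne']
  · simp [pt, sgn, width, gradedNode, mul_comm]

theorem node_sub {j : ℕ} (hj : j ∈ P.idx) {i : ℕ} (hi : i ≤ n j) :
    P.node q n j (n j - i) =
      pt (P := P) (⟨j, hj⟩, false)
        (gradedNode (width (P := P) (⟨j, hj⟩, false)) (q j) (n j) i) := by
  unfold node
  rw [if_pos (by omega)]
  simp [pt, sgn, width, gradedNode, Nat.cast_sub hi]
  ring

theorem node_monotone {j : ℕ} (hj : j ∈ P.idx) (hq : 0 < q j) (hn : 1 ≤ n j) :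
    Monotone (P.node q n j) := by
  have hb : ∀ c : Bool, 0 < width (P := P) (⟨j, hj⟩, c) := fun c => width_pos _
  refine monotone_nat_of_le_succ fun i => ?_
  rcases lt_or_ge i (n j) with h | h
  · obtain ⟨m, hm⟩ : ∃ m, n j = i + 1 + m := ⟨n j - (i + 1), by omega⟩
    have e1 := node_sub (q := q) hj (i := m + 1) (show m + 1 ≤ n j by omega)
    have e2 := node_sub (q := q) hj (i := m) (show m ≤ n j by omega)
    rw [show n j - (m + 1) = i by omega] at e1
    rw [show n j - m = i + 1 by omega] at e2
    rw [e1, e2]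
    have := gradedNode_strictMono (hb false) hq hn (Nat.lt_succ_self m)
    simp only [pt, sgn, Bool.false_eq_true, if_false]
    simp only [Nat.succ_eq_add_one] at this
    linarith
  · obtain ⟨m, rfl⟩ := Nat.exists_eq_add_of_le h
    rw [add_assoc, node_add hj hq, node_add hj hq]
    have := gradedNode_strictMono (hb true) hq hn (Nat.lt_succ_self m)
    simp only [pt, sgn, if_true]
    simp only [Nat.succ_eq_add_one] at this
    linarith

variable (n) in
/-- The index, in the mesh on `Γ_j`, of the `j`th element of a piece, counted from the corner. -/
def elementIndex (p : P.Piece) (j : ℕ) : ℕ := if p.2 then n p.1 + j else n p.1 - 1 - j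

variable (q n) in
/-- The nodes of a piece in the local coordinate. -/
noncomputable def localNode (p : P.Piece) (j : ℕ) : ℝ := gradedNode p.width (q p.1) (n p.1) j

theorem node_elementIndex (p : P.Piece) (hq : 0 < q p.1) {j : ℕ} (hj : j < n p.1) :
    P.node q n p.1 (elementIndex n p j) =
        (if p.2 then p.pt (localNode q n p j) else p.pt (localNode q n p (j + 1))) ∧
      P.node q n p.1 (elementIndex n p j + 1) =
        (if p.2 then p.pt (localNode q n p (j + 1)) else p.pt (localNode q n p j)) := by
  rcases p with ⟨⟨k, hk⟩, _ | _⟩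
  · simp only [elementIndex, Bool.false_eq_true, if_false] at hq hj ⊢
    have e1 := node_sub (q := q) hk (i := j + 1) hj
    have e2 := node_sub (q := q) hk (i := j) hj.le
    rw [show n k - (j + 1) = n k - 1 - j by omega] at e1
    rw [show n k - j = n k - 1 - j + 1 by omega] at e2
    exact ⟨e1, e2⟩
  · simp only [elementIndex, if_true] at hq hj ⊢
    exact ⟨node_add hk hq j, node_add hk hq (j + 1)⟩

theorem integral_element (p : P.Piece) (hq : 0 < q p.1) {j : ℕ} (hj : j < n p.1) (f : ℝ → ℝ) :
    ∫ t in (P.node q n p.1 (elementIndex n p j))..(P.node q n p.1 (elementIndex n p j + 1)), f t =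
      ∫ τ in (localNode q n p j)..(localNode q n p (j + 1)), f (p.pt τ) := by
  obtain ⟨h1, h2⟩ := node_elementIndex p hq hj
  rw [h1, h2]
  rcases p with ⟨⟨k, hk⟩, _ | _⟩
  · simp only [pt, sgn, Bool.false_eq_true, if_false, neg_mul, one_mul, ← sub_eq_add_neg]
    rw [intervalIntegral.integral_comp_sub_left]
  · simp only [pt, sgn, if_true, one_mul]
    rw [intervalIntegral.integral_comp_add_left]

theorem len_element (p : P.Piece) (hq : 0 < q p.1) {j : ℕ} (hj : j < n p.1) :
    P.len q n p.1 (elementIndex n p j) = localNode q n p (j + 1) - localNode q n p j := by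
  obtain ⟨h1, h2⟩ := node_elementIndex p hq hj
  rw [len, h1, h2]
  rcases p with ⟨⟨k, hk⟩, _ | _⟩
  · simp only [pt, sgn, Bool.false_eq_true, if_false]; ring
  · simp only [pt, sgn, if_true]; ring

theorem localNode_lt (p : P.Piece) (hq : 0 < q p.1) (hn : 1 ≤ n p.1) (j : ℕ) :
    localNode q n p j < localNode q n p (j + 1) :=
  gradedNode_strictMono p.width_pos hq hn (Nat.lt_succ_self j)

theorem pt_mem_element (p : P.Piece) (hq : 0 < q p.1) {j : ℕ} (hj : j < n p.1) {τ : ℝ}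
    (hτ : τ ∈ Ioo (localNode q n p j) (localNode q n p (j + 1))) :
    p.pt τ ∈ Ioo (P.node q n p.1 (elementIndex n p j))
      (P.node q n p.1 (elementIndex n p j + 1)) := by
  obtain ⟨h1, h2⟩ := node_elementIndex p hq hj
  rw [h1, h2]
  rcases p with ⟨⟨k, hk⟩, _ | _⟩
  · simp only [pt, sgn, Bool.false_eq_true, if_false]
    constructor <;> linarith [hτ.1, hτ.2]
  · simp only [pt, sgn, if_true]
    constructor <;> linarith [hτ.1, hτ.2]

/-- Only the elements numbered `0` on either side touch the corner, so on each piece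
`regularElements` becomes the range `1 ≤ j`. -/
theorem corner_notMem_element_iff (p : P.Piece) (hq : 0 < q p.1) {j : ℕ} (hj : j < n p.1) :
    P.s p.1 ∉ Icc (P.node q n p.1 (elementIndex n p j))
      (P.node q n p.1 (elementIndex n p j + 1)) ↔ 1 ≤ j := by
  obtain ⟨h1, h2⟩ := node_elementIndex p hq hj
  have hn : 1 ≤ n p.1 := by omega
  have hlt := localNode_lt p hq hn j
  have h0 : 0 ≤ localNode q n p j := gradedNode_nonneg p.width_pos
  have hz : localNode q n p 0 = 0 := gradedNode_zero _ _ hq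
  have key : P.s p.1 ∈ Icc (P.node q n p.1 (elementIndex n p j))
      (P.node q n p.1 (elementIndex n p j + 1)) ↔ localNode q n p j = 0 := by
    rw [h1, h2, mem_Icc]
    rcases p with ⟨⟨k, hk⟩, _ | _⟩
    · simp only [pt, sgn, Bool.false_eq_true, if_false]
      constructor
      · intro h; linarith [h.2]
      · intro h; constructor <;> linarith
    · simp only [pt, sgn, if_true]
      constructor
      · intro h; linarith [h.1]
      · intro h; constructor <;> linarith
  rw [key, Nat.one_le_iff_ne_zero, not_iff_not]
  constructor
  · intro h
    by_contra hc
    have : 0 < localNode q n p j := gradedNode_pos p.width_pos hn (Nat.one_le_iff_ne_zero.2 hc)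
    exact this.ne' h
  · rintro rfl; exact hz

theorem sum_elements {M : Type} [AddCommMonoid M] (n : ℕ → ℕ) (f : ℕ → ℕ → M) :
    ∑ j ∈ P.idx, ∑ i ∈ Finset.range (2 * n j), f j i =
      ∑ p : P.Piece, ∑ j ∈ Finset.range (n p.1), f p.1 (elementIndex n p j) := by
  refine sum_piece _ _ fun j hj => ?_
  rw [sum_range_two_mul]
  rfl

theorem sum_regularElements {M : Type} [AddCommMonoid M] (hq : ∀ j ∈ P.idx, 0 < q j)
    (f : ℕ → ℕ → M) :
    ∑ j ∈ P.idx, ∑ i ∈ P.regularElements q n j, f j i =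
      ∑ p : P.Piece, ∑ j ∈ Finset.Ico 1 (n p.1), f p.1 (elementIndex n p j) := by
  classical
  unfold regularElements
  simp_rw [Finset.sum_filter]
  rw [sum_elements]
  refine Finset.sum_congr rfl fun p _ => ?_
  have : ∀ j ∈ Finset.range (n p.1), (if P.s p.1 ∉ Icc (P.node q n p.1 (elementIndex n p j))
      (P.node q n p.1 (elementIndex n p j + 1)) then f p.1 (elementIndex n p j) else 0) =
      if 1 ≤ j then f p.1 (elementIndex n p j) else 0 := fun j hj => by
    simp only [corner_notMem_element_iff p (hq p.1 p.1.2) (Finset.mem_range.1 hj)]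
  rw [Finset.sum_congr rfl this, ← Finset.sum_filter]
  refine Finset.sum_congr ?_ fun _ _ => rfl
  ext j; simp [and_comm]

theorem elementIndex_lt (p : P.Piece) {j : ℕ} (hj : j < n p.1) :
    elementIndex n p j < 2 * n p.1 := by
  unfold elementIndex; split_ifs <;> omega

/-- One indicator survives: within `Γ_j` the nodes are monotone, and the elements of different `Γ_j`
lie in segments without common interior points. -/
theorem proj_pt (hq : ∀ j ∈ P.idx, 0 < q j) (hn : ∀ j ∈ P.idx, 1 ≤ n j) (u : ℝ → ℝ) (p : P.Piece)
    {j : ℕ} (hj : j < n p.1) {τ : ℝ}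
    (hτ : τ ∈ Ioo (localNode q n p j) (localNode q n p (j + 1))) :
    P.proj q n u (p.pt τ) = (localNode q n p (j + 1) - localNode q n p j)⁻¹ *
      ∫ τ in (localNode q n p j)..(localNode q n p (j + 1)), u (p.pt τ) := by
  have hqp := hq p.1 p.1.2
  have hmem := pt_mem_element p hqp hj hτ
  have hmono := node_monotone p.1.2 hqp (hn p.1 p.1.2)
  have hlt2 := elementIndex_lt p hj
  unfold proj
  rw [Finset.sum_eq_single (p.1 : ℕ), Finset.sum_eq_single (elementIndex n p j),
    indicator_of_mem (Ioo_subset_Ico_self hmem), len_element p hqp hj, integral_element p hqp hj,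
    one_div]
  · intro i _ hi
    refine indicator_of_notMem (fun h => ?_) _
    rcases lt_or_gt_of_ne hi with h1 | h1
    · exact absurd (h.2.trans_le (hmono (show i + 1 ≤ elementIndex n p j by omega)))
        (not_lt.2 hmem.1.le)
    · exact absurd ((hmem.2.trans_le (hmono (show elementIndex n p j + 1 ≤ i by omega))))
        (not_lt.2 h.1)
  · intro h; exact absurd (Finset.mem_range.2 hlt2) h
  · intro k hk hkp
    refine Finset.sum_eq_zero fun i hi => indicator_of_notMem (fun h => ?_) _
    rw [Finset.mem_range] at hi
    have hmk := node_monotone hk (hq k hk) (hn k hk)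
    have hk' := (mem_idx P).1 hk
    have hp' := (mem_idx P).1 p.1.2
    have b1 : P.γ (k - 1) ≤ P.node q n k i := by
      rw [← node_zero (q := q) (hn k hk)]; exact hmk (Nat.zero_le _)
    have b2 : P.node q n k (i + 1) ≤ P.γ k := by
      rw [← node_two_mul (q := q) (hn k hk)]; exact hmk (by omega)
    have c1 : P.γ (p.1 - 1) ≤ P.node q n p.1 (elementIndex n p j) := by
      rw [← node_zero (q := q) (hn p.1 p.1.2)]; exact hmono (Nat.zero_le _)
    have c2 : P.node q n p.1 (elementIndex n p j + 1) ≤ P.γ p.1 := by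
      rw [← node_two_mul (q := q) (hn p.1 p.1.2)]; exact hmono (by omega)
    rcases lt_or_gt_of_ne hkp with h1 | h1
    · have := γ_le_γ (P := P) (i := k) (j := p.1 - 1) (by omega) (by omega)
      linarith [h.2, hmem.1]
    · have := γ_le_γ (P := P) (i := p.1) (j := k - 1) (by omega) (by omega)
      linarith [h.1, hmem.2]
  · intro h; exact absurd p.1.2 h

theorem integral_bdry_eq (f : ℝ → ℝ)
    (hf : ∀ p : P.Piece, IntervalIntegrable (fun τ => f (p.pt τ)) volume 0 p.width) :
    ∫ t in (P.γ 0)..(P.γ P.r), f t = ∑ p : P.Piece, ∫ τ in 0..p.width, f (p.pt τ) := by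
  have hR : ∀ j (hj : j ∈ P.idx), IntervalIntegrable f volume (P.s j) (P.γ j) ∧
      ∫ t in (P.s j)..(P.γ j), f t = ∫ τ in 0..width (P := P) (⟨j, hj⟩, true),
        f (pt (P := P) (⟨j, hj⟩, true) τ) := fun j hj => by
    have h := (hf (⟨j, hj⟩, true)).comp_sub_right (P.s j)
    simp only [pt, sgn, width, if_true, one_mul, zero_add, sub_add_cancel, add_sub_cancel] at h ⊢
    refine ⟨h, ?_⟩
    rw [intervalIntegral.integral_comp_add_left]; simp
  have hL : ∀ j (hj : j ∈ P.idx), IntervalIntegrable f volume (P.γ (j - 1)) (P.s j) ∧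
      ∫ t in (P.γ (j - 1))..(P.s j), f t = ∫ τ in 0..width (P := P) (⟨j, hj⟩, false),
        f (pt (P := P) (⟨j, hj⟩, false) τ) := fun j hj => by
    have h := (hf (⟨j, hj⟩, false)).comp_sub_left (P.s j)
    simp only [pt, sgn, width, Bool.false_eq_true, if_false, neg_mul, one_mul, sub_zero,
      ← sub_eq_add_neg, sub_sub_cancel] at h ⊢
    refine ⟨h.symm, ?_⟩
    rw [intervalIntegral.integral_comp_sub_left]; simp
  have hmem : ∀ j < P.r, j + 1 ∈ P.idx := fun j hj => (mem_idx P).2 ⟨by omega, hj⟩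
  have h1 := intervalIntegral.sum_integral_adjacent_intervals (f := f) (μ := volume) (a := P.γ)
    (n := P.r) fun j hj => by
      have := (hL (j + 1) (hmem j hj)).1
      simp only [Nat.add_sub_cancel] at this
      exact this.trans (hR (j + 1) (hmem j hj)).1
  rw [← h1]
  have h2 : P.idx = Finset.Ico (0 + 1) (P.r + 1) := by
    ext j; rw [mem_idx, Finset.mem_Ico]; omega
  have h3 : ∑ j ∈ Finset.range P.r, ∫ t in (P.γ j)..(P.γ (j + 1)), f t =
      ∑ j ∈ P.idx, ∫ t in (P.γ (j - 1))..(P.γ j), f t := by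
    rw [h2, ← Finset.sum_Ico_add', ← Finset.range_eq_Ico]
    simp
  rw [h3]
  refine sum_piece _ _ fun j hj => ?_
  rw [← (hR j hj).2, ← (hL j hj).2, add_comm,
    intervalIntegral.integral_add_adjacent_intervals (hL j hj).1 (hR j hj).1]

/-- The operator `T (I - π)` in local coordinates. -/
theorem TIsubProj_eq_sum (hq : ∀ j ∈ P.idx, 0 < q j) (hn : ∀ j ∈ P.idx, 1 ≤ n j) {u : ℝ → ℝ}
    {v : P.Piece → ℝ → ℝ} {M : P.Piece → ℝ} (hv : ∀ p : P.Piece, ∀ τ ∈ Ioo 0 p.width, u (p.pt τ) = v p τ)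
    (hc : ∀ p : P.Piece, ContinuousOn (v p) (Ioo 0 p.width))
    (hM : ∀ p : P.Piece, ∀ τ ∈ Ioo 0 p.width, |v p τ| ≤ M p)
    (p₀ : P.Piece) {σ : ℝ} (hσ : σ ∈ Icc 0 p₀.width) :
    P.TIsubProj q n u (p₀.pt σ) = ∑ p : P.Piece, ∑ j ∈ Finset.range (n p.1),
      devIntegral (kern p₀ p 0 0 σ) (v p) (localNode q n p j) (localNode q n p (j + 1)) := by
  have hsub : ∀ p : P.Piece, ∀ j < n p.1,
      Ioo (localNode q n p j) (localNode q n p (j + 1)) ⊆ Ioo 0 p.width := fun p j hj =>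
    Ioo_gradedNode_subset p.width_pos (hq p.1 p.1.2) (hn p.1 p.1.2) hj
  have hlt : ∀ p : P.Piece, ∀ j, localNode q n p j < localNode q n p (j + 1) := fun p j =>
    localNode_lt p (hq p.1 p.1.2) (hn p.1 p.1.2) j
  have hk : ∀ p : P.Piece, ∀ j < n p.1, IntervalIntegrable (kern p₀ p 0 0 σ) volume
      (localNode q n p j) (localNode q n p (j + 1)) := fun p j hj => by
    refine (intervalIntegrable_kern p₀ p σ).mono_set ?_
    rw [uIcc_of_le (hlt p j).le, uIcc_of_le p.width_pos.le]
    exact Icc_subset_Icc (gradedNode_nonneg p.width_pos)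
      (gradedNode_le p.width_pos (hq p.1 p.1.2) (hn p.1 p.1.2) hj)
  have hel : ∀ p : P.Piece, ∀ j < n p.1,
      ∀ τ ∈ Ioo (localNode q n p j) (localNode q n p (j + 1)),
      P.k (p₀.pt σ) (p.pt τ) * (u (p.pt τ) - P.proj q n u (p.pt τ)) =
        kern p₀ p 0 0 σ τ * (v p τ - (localNode q n p (j + 1) - localNode q n p j)⁻¹ *
          ∫ τ in (localNode q n p j)..(localNode q n p (j + 1)), v p τ) := by
    intro p j hj τ hτ
    rw [k_eq_kern p₀ p hσ (hsub p j hj hτ), proj_pt hq hn u p hj hτ, hv p τ (hsub p j hj hτ),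
      integral_congr_Ioo (hlt p j).le fun x hx => hv p x (hsub p j hj hx)]
  have hint : ∀ p : P.Piece, ∀ j < n p.1, IntervalIntegrable
      (fun τ => P.k (p₀.pt σ) (p.pt τ) * (u (p.pt τ) - P.proj q n u (p.pt τ))) volume
      (localNode q n p j) (localNode q n p (j + 1)) := fun p j hj => by
    refine intervalIntegrable_congr_Ioo (hlt p j).le (f := fun τ => kern p₀ p 0 0 σ τ * v p τ -
      kern p₀ p 0 0 σ τ * ((localNode q n p (j + 1) - localNode q n p j)⁻¹ *
        ∫ τ in (localNode q n p j)..(localNode q n p (j + 1)), v p τ))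
      (fun τ hτ => by rw [hel p j hj τ hτ, mul_sub]) ?_
    exact (intervalIntegrable_mul_of_bound (hlt p j).le (hk p j hj) ((hc p).mono (hsub p j hj))
      (fun τ hτ => hM p τ (hsub p j hj hτ))).sub ((hk p j hj).mul_const _)
  have hends : ∀ p : P.Piece, localNode q n p 0 = 0 ∧ localNode q n p (n p.1) = p.width := fun p =>
    ⟨gradedNode_zero _ _ (hq p.1 p.1.2), gradedNode_self _ _ (hn p.1 p.1.2)⟩
  unfold TIsubProj T
  rw [integral_bdry_eq (P := P)
    (fun t => P.k (p₀.pt σ) t * (u t - P.proj q n u t)) fun p => by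
      have := IntervalIntegrable.trans_iterate (hint p)
      rwa [(hends p).1, (hends p).2] at this]
  refine Finset.sum_congr rfl fun p _ => ?_
  have := intervalIntegral.sum_integral_adjacent_intervals (hint p)
  rw [(hends p).1, (hends p).2] at this
  rw [← this]
  refine Finset.sum_congr rfl fun j hj => ?_
  rw [Finset.mem_range] at hj
  exact integral_congr_Ioo (hlt p j).le (hel p j hj)

/-- The leading term in local coordinates. -/
theorem leadingTerm_eq_sum (hq : ∀ j ∈ P.idx, 0 < q j) (hn : ∀ j ∈ P.idx, 1 ≤ n j) {u : ℝ → ℝ}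
    (hu : ∀ j ∈ P.idx, ContDiffOn ℝ 4 u (P.seg j \ {P.s j}))
    (p₀ : P.Piece) {s : ℝ} (hs : s ∈ Icc 0 p₀.width) :
    P.leadingTerm q n u (p₀.pt s) = 1 / 144 * ∑ p : P.Piece, ∑ p' : P.Piece,
      ∑ j ∈ Finset.Ico 1 (n p.1), ∑ j' ∈ Finset.Ico 1 (n p'.1),
        (localNode q n p (j + 1) - localNode q n p j) ^ 2 *
        (localNode q n p' (j' + 1) - localNode q n p' j') ^ 2 *
        ∫ σ in (localNode q n p j)..(localNode q n p (j + 1)), kern p₀ p 0 1 s σ *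
          ∫ τ in (localNode q n p' j')..(localNode q n p' (j' + 1)),
            kern p p' 1 1 σ τ * pull u p' 1 τ := by
  have hsub : ∀ p : P.Piece, ∀ j < n p.1,
      Ioo (localNode q n p j) (localNode q n p (j + 1)) ⊆ Ioo 0 p.width := fun p j hj =>
    Ioo_gradedNode_subset p.width_pos (hq p.1 p.1.2) (hn p.1 p.1.2) hj
  have hlt : ∀ p : P.Piece, ∀ j, localNode q n p j < localNode q n p (j + 1) := fun p j =>
    localNode_lt p (hq p.1 p.1.2) (hn p.1 p.1.2) j
  unfold leadingTerm
  congr 1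
  rw [Finset.sum_congr rfl fun j₁ _ => Finset.sum_comm]
  rw [sum_regularElements hq]
  refine Finset.sum_congr rfl fun p _ => ?_
  rw [Finset.sum_comm (s := Finset.univ)]
  refine Finset.sum_congr rfl fun j hj => ?_
  have hj' := (Finset.mem_Ico.1 hj).2
  rw [sum_regularElements hq (f := fun j₂ i₂ => P.len q n p.1 (elementIndex n p j) ^ 2 *
    P.len q n j₂ i₂ ^ 2 * ∫ t in (P.node q n p.1 (elementIndex n p j))..
      (P.node q n p.1 (elementIndex n p j + 1)), P.dtk (p₀.pt s) t *
        ∫ t' in (P.node q n j₂ i₂)..(P.node q n j₂ (i₂ + 1)), P.dtdsk t t' * deriv u t')]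
  refine Finset.sum_congr rfl fun p' _ => Finset.sum_congr rfl fun i hi => ?_
  have hi' := (Finset.mem_Ico.1 hi).2
  rw [len_element p (hq p.1 p.1.2) hj', len_element p' (hq p'.1 p'.1.2) hi',
    integral_element p (hq p.1 p.1.2) hj']
  congr 1
  refine integral_congr_Ioo (hlt p j).le fun σ hσ => ?_
  have hσ' := hsub p j hj' hσ
  rw [dtk_eq_kern p₀ p hs hσ', integral_element p' (hq p'.1 p'.1.2) hi',
    integral_congr_Ioo (g := fun τ => p.sgn * (kern p p' 1 1 σ τ * pull u p' 1 τ))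
      (hlt p' i).le fun τ hτ => ?_, intervalIntegral.integral_const_mul]
  · linear_combination (kern p₀ p 0 1 s σ * ∫ τ in (localNode q n p' i)..(localNode q n p' (i + 1)),
      kern p p' 1 1 σ τ * pull u p' 1 τ) * p.sgn_mul_self
  · have hτ' := hsub p' i hi' hτ
    rw [dtdsk_eq_kern p p' hσ' hτ', deriv_pt p' (hu p'.1 p'.1.2) hτ']
    linear_combination (p.sgn * kern p p' 1 1 σ τ * pull u p' 1 τ) * p'.sgn_mul_self

end PolygonBoundary

/-! ### Application of the abstract expansion to the polygon -/

namespace PolygonBoundary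

variable {P : PolygonBoundary} {q a : ℕ → ℝ} {n : ℕ → ℕ} {u : ℝ → ℝ} {G : GradedKernel P.Piece}

open Piece

theorem isMesh_mesh (hn : ∀ j ∈ P.idx, 1 ≤ n j) :
    GradedKernel.IsMesh (fun p : P.Piece => n p.1) (P.mesh n) where
  one_le p := hn p.1 p.1.2
  inv_le p := by
    rw [← one_div]
    exact Finset.le_sup' (fun j => 1 / (n j : ℝ)) p.1.2

/-- The maxima in the norm resolve: `a > 0` makes the weight trivial for `i = 0`, and `a ≤ 1 ≤ i`
gives the exponent `i - a` otherwise. -/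
theorem isWeighted_pull (hb : G.b = width) (ha : G.a = fun p => a p.1) (hu : P.MemC 4 a u) :
    G.IsWeighted (P.wnorm 4 a u).toReal (pull u) where
  hasDerivAt p i hi τ hτ := by
    rw [hb] at hτ
    exact hasDerivAt_pull p (hu.1 p.1 p.1.2) (by omega) hτ
  bound_zero p τ hτ := by
    have hpos := GradedKernel.a_pos (G := G) p
    rw [hb] at hτ
    rw [ha] at hpos
    have := abs_pull_le hu.2 p (i := 0) (by norm_num) hτ
    rwa [Nat.cast_zero, zero_sub, max_eq_right (by linarith), Real.rpow_zero, one_mul] at this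
  bound p i hi hi1 τ hτ := by
    have hle := G.a_le_one p
    rw [hb] at hτ
    rw [ha] at hle ⊢
    have hi1' : (1 : ℝ) ≤ i := by exact_mod_cast hi1
    have := abs_pull_le hu.2 p hi hτ
    rw [max_eq_left (by linarith)] at this
    have hp := Real.rpow_pos_of_pos hτ.1 ((i : ℝ) - a p.1)
    rw [show a p.1 - (i : ℝ) = -((i : ℝ) - a p.1) by ring, Real.rpow_neg hτ.1.le,
      ← div_eq_mul_inv, le_div_iff₀ hp, mul_comm]
    exact this

/-- The outer kernel is seen from an arbitrary boundary point, corners included. Hence the bounds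
are in `τ` alone, uniformly on the closed range of `σ`. -/
theorem isSection_kern (hb : G.b = width) {B : ℝ}
    (hB : ∀ (p p' : P.Piece), ∀ l ≤ 3, ∀ σ ∈ Icc 0 p.width, ∀ τ ∈ Ioo 0 p'.width,
      |kern p p' 0 l σ τ| ≤ B * τ ^ (-(1 + l) : ℝ))
    (p₀ : P.Piece) {σ : ℝ} (hσ : σ ∈ Icc 0 p₀.width) :
    G.IsSection B (fun p l => kern p₀ p 0 l σ) where
  hasDerivAt p i _ τ hτ := by
    rw [hb] at hτ
    exact hasDerivAt_kern_right' p₀ p 0 i hσ hτ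
  bound p i hi _ τ hτ := by
    rw [hb] at hτ
    exact hB p₀ p i hi σ hσ τ hτ
  integrable p := by
    rw [hb]
    exact intervalIntegrable_kern p₀ p σ
  integral_abs_le p := by
    rw [hb]
    exact integral_abs_kern_le p₀ p σ

/-- `TIsubProj_eq_sum` is used for `u` and again for `T(I-π)u`. The second use needs the inner
function only on the open pieces, where it is `cornerPart` plus `regularPart`, continuous and
bounded. -/
theorem TIsubProj_TIsubProj_eq_total (hb : G.b = width) (hqG : G.q = fun p => q p.1)
    (ha : G.a = fun p => a p.1) (hK : G.K = kern) (hq : ∀ j ∈ P.idx, 0 < q j)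
    (hn : ∀ j ∈ P.idx, 1 ≤ n j) (hu : P.MemC 4 a u) (p₀ : P.Piece) {σ A : ℝ}
    (hσ : σ ∈ Icc 0 p₀.width) (hk : G.IsSection A (fun p l => kern p₀ p 0 l σ)) :
    P.TIsubProj q n (P.TIsubProj q n u) (p₀.pt σ) =
      G.total (fun p => n p.1) (pull u) (fun p l => kern p₀ p 0 l σ) := by
  have hm := isMesh_mesh hn
  have hU := isWeighted_pull hb ha hu
  have hnode : ∀ p j, G.node (fun p => n p.1) p j = localNode q n p j := fun p j => by
    simp only [GradedKernel.node, hb, hqG, localNode]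
  have h1 : ∀ p : P.Piece, ∀ τ ∈ Ioo 0 p.width, P.TIsubProj q n u (p.pt τ) =
      G.cornerPart (fun p => n p.1) (pull u) p τ +
        G.regularPart (fun p => n p.1) (pull u) p 0 τ := fun p τ hτ => by
    rw [← GradedKernel.sum_devIntegral_eq hm, TIsubProj_eq_sum hq hn (v := fun p => pull u p 0)
      (fun p τ _ => (pull_zero u p τ).symm) (fun p τ hτ => ?_)
      (M := fun _ => (P.wnorm 4 a u).toReal) (fun p τ hτ => ?_) p ⟨hτ.1.le, hτ.2.le⟩]
    · simp only [hnode, hK]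
    · exact (hasDerivAt_pull p (hu.1 p.1 p.1.2) (by norm_num) hτ).continuousAt.continuousWithinAt
    · exact hU.bound_zero p τ (by rwa [hb])
  obtain ⟨C, -, hC⟩ := GradedKernel.exists_cornerPart_le G
  have hM : ∀ p, ∃ M, ∀ σ ∈ Ioo 0 (G.b p),
      |G.regularPart (fun p => n p.1) (pull u) p 0 σ| ≤ M := fun p => by
    obtain ⟨D, -, hD⟩ := GradedKernel.exists_devIntegral_regularPart_zero_le G p
    exact (hD _ _ _ _ _ _ hm hU hk).2
  choose M hM using hM
  rw [TIsubProj_eq_sum hq hn h1 (fun p => ?_)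
    (M := fun p => C * ((P.wnorm 4 a u).toReal * P.mesh n ^ 6) + M p) (fun p τ hτ => ?_) p₀ hσ]
  · simp only [GradedKernel.total, hnode]
  · rw [← hb]
    exact (GradedKernel.continuousOn_cornerPart hU hm p).add fun τ hτ =>
      (GradedKernel.hasDerivAt_regularPart hU hm p (i := 0) (by norm_num)
        hτ).continuousAt.continuousWithinAt
  · rw [← hb] at hτ
    exact (abs_add_le _ _).trans (add_le_add (hC _ _ _ _ hm hU p τ hτ) (hM p τ hτ))

theorem leadingTerm_eq_leading (hb : G.b = width) (hqG : G.q = fun p => q p.1)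
    (ha : G.a = fun p => a p.1) (hK : G.K = kern) (hq : ∀ j ∈ P.idx, 0 < q j)
    (hn : ∀ j ∈ P.idx, 1 ≤ n j) (hu : P.MemC 4 a u) (p₀ : P.Piece) {σ A : ℝ}
    (hσ : σ ∈ Icc 0 p₀.width) (hk : G.IsSection A (fun p l => kern p₀ p 0 l σ)) (hA : 0 ≤ A) :
    P.leadingTerm q n u (p₀.pt σ) =
      G.leading (fun p => n p.1) (pull u) (fun p l => kern p₀ p 0 l σ) := by
  rw [leadingTerm_eq_sum hq hn hu.1 p₀ hσ,
    GradedKernel.leading_eq_sum (isWeighted_pull hb ha hu) (isMesh_mesh hn) hk hA]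
  simp only [GradedKernel.node, hb, hqG, localNode, hK]

end PolygonBoundary

end

theorem mainTheorem2 (P : PolygonBoundary) (q a α : ℕ → ℝ)
    (ha1 : ∀ j ∈ P.idx, a j ≤ 1)
    (ha : ∀ j ∈ P.idx, 2 / q j < a j)
    (hα : ∀ j ∈ P.idx, α j = a j - 2 / q j)
    (hq : ∀ j ∈ P.idx, 4 / α j < q j) :
    ∃ C : ℝ, ∀ n : ℕ → ℕ, (∀ j ∈ P.idx, 1 ≤ n j) →
      ∀ u : ℝ → ℝ, P.MemC 4 a u → ∀ s ∈ P.bdry,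
        |P.TIsubProj q n (P.TIsubProj q n u) s - P.leadingTerm q n u s|
            ≤ C * P.mesh n ^ 6 * (P.wnorm 4 a u).toReal ∧
        |P.leadingTerm q n u s| ≤ C * P.mesh n ^ 4 * (P.wnorm 4 a u).toReal := by
  have hα0 : ∀ j ∈ P.idx, 0 < α j := fun j hj => by
    rw [hα j hj]; linarith [ha j hj]
  have hq0 : ∀ j ∈ P.idx, 0 < q j := fun j hj =>
    (div_pos (by norm_num) (hα0 j hj)).trans (hq j hj)
  -- `q α = q a - 2`, so `q α > 4` is `q a > 6`.
  have h6 : ∀ j ∈ P.idx, 6 < q j * a j := fun j hj => by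
    have h := hq j hj
    have h0 := hq0 j hj
    rw [div_lt_iff₀ (hα0 j hj), hα j hj, mul_sub, mul_div_cancel₀ _ h0.ne'] at h
    linarith
  obtain ⟨G, hb, hqG, haG, hK⟩ := PolygonBoundary.exists_gradedKernel P q a hq0 ha1 h6
  obtain ⟨B, hB0, hB⟩ := PolygonBoundary.Piece.exists_kern_bounds P
  obtain ⟨C, -, hC⟩ := GradedKernel.exists_total_sub_leading_le G hB0
  refine ⟨C, fun n hn u hu s hs => ?_⟩
  -- Corners and division points also have a local coordinate, in a closed piece, so the estimate
  -- holds at every `s`.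
  obtain ⟨p₀, σ, hσ, rfl⟩ := PolygonBoundary.Piece.exists_pt_eq hs
  have hk := PolygonBoundary.isSection_kern (G := G) hb (B := B) (fun p p' l hl σ hσ τ hτ => by
    have := (hB p p' 0 (by norm_num) l hl).2.1 σ hσ τ hτ
    rwa [Nat.cast_zero, add_zero] at this) p₀ hσ
  rw [PolygonBoundary.TIsubProj_TIsubProj_eq_total hb hqG haG hK hq0 hn hu p₀ hσ hk,
    PolygonBoundary.leadingTerm_eq_leading hb hqG haG hK hq0 hn hu p₀ hσ hk hB0]
  have := hC _ _ _ _ _ (PolygonBoundary.isMesh_mesh hn)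
    (PolygonBoundary.isWeighted_pull hb haG hu) hk
  rwa [mul_comm (P.wnorm 4 a u).toReal, mul_comm (P.wnorm 4 a u).toReal, ← mul_assoc,
    ← mul_assoc] at this
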